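/- Let $(\Omega,\Sigma,\mu)$ be a $\sigma$-finite measure space, $p\in(1,\infty)$, $q\in[1,\infty]$, and let $L^p(\Omega)$ be complex-valued. For $\theta\in(0,\pi)$ put $\Sigma_\theta=\{z\in\mathbb{C}\setminus\{0\}: |\arg z|<\theta\}$. A closed densely defined operator $A$ with dense range on a Banach space is called sectorial if there is $\psi\in(0,\frac{\pi}{2})$ with $\sigma(A)\subset\overline{\Sigma_\psi}$ and $\sup_{\lambda\notin\overline{\Sigma_\psi}}\|\lambda R(\lambda,A)\|<\infty$, where $R(\lambda,A)=(\lambda-A)^{-1}$; then $-A$ generates a $C_0$-semigroup $(e^{-sA})_{s\ge 0}$. For $r\in[1,\infty]$, a set $\mathcal{T}$ of bounded linear operators on $L^p(\Omega)$ is called $\mathcal{R}_r$-bounded if there is $C\ge 0$ such that for all $n\in\mathbb{N}$, $T_1,\dots,T_n\in\mathcal{T}$ and $f_1,\dots,f_n\in L^p(\Omega)$ $$\Bigl\|\Bigl(\sum_{k=1}^n|T_kf_k|^r\Bigr)^{1/r}\Bigr\|_p\le C\Bigl\|\Bigl(\sum_{k=1}^n|f_k|^r\Bigr)^{1/r}\Bigr\|_p$$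 (with $\sup_k|T_kf_k|$ and $\sup_k|f_k|$ in place of the sums if $r=\infty$). It is called $\mathcal{R}$-bounded if there is $C\ge 0$ such that always $\mathbb{E}\|\sum_{k=1}^n\epsilon_kT_kf_k\|_p\le C\,\mathbb{E}\|\sum_{k=1}^n\epsilon_kf_k\|_p$ for independent Rademacher variables $\epsilon_1,\dots,\epsilon_n$. Let $(A(t))_{t\in[0,T]}$ be a family of sectorial operators on $L^p(\Omega)$ such that (i) for some $\varphi\in(0,\frac{\pi}{2})$ one has $\sigma(A(t))\subset\overline{\Sigma_\varphi}$ for all $t\in[0,T]$ and $\sup_{t\in[0,T]}\sup_{\lambda\notin\overline{\Sigma_\varphi}}\|\lambda R(\lambda,A(t))\|<\infty$; (ii) there is an $\mathcal{R}_q$-bounded set $\mathcal{T}$ of bounded linear operators on $L^p(\Omega)$ such that for all $t\in[0,T]$ and $s\ge 0$ there is $D\in\mathcal{T}$ with $|e^{-sA(t)}f|(x)\le (D|f|)(x)$ for almost every $x\in\Omega$, for all $f\in L^p(\Omega)$. Then for every $r$ strictly between $p$ and $q$ (that is, $p<r<q$ or $q<r<p$) there is $\theta\in(\varphi,\frac{\pi}{2})$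 such that $\{\lambda R(\lambda,A(t)):\lambda\notin\overline{\Sigma_\theta},\ t\in[0,T]\}$ is $\mathcal{R}_r$-bounded. In particular, if $2$ lies strictly between $p$ and $q$, then there is $\theta\in(\varphi,\frac{\pi}{2})$ for which this set is both $\mathcal{R}_2$-bounded and $\mathcal{R}$-bounded. -/

import Mathlib

open Filter Topology MeasureTheory
open scoped ENNReal NNReal BigOperators

noncomputable section

namespace RBdd

/-! ### Closed operators, resolvents, sectorial operators -/

section Operators

variable {X : Type*} [NormedAddCommGroup X] [NormedSpace ℂ X]

/-- The bounded operator `R` is a two-sided inverse of `z - A : D(A) → X`. -/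
def IsResolventAt (A : X →ₗ.[ℂ] X) (z : ℂ) (R : X →L[ℂ] X) : Prop :=
  (∀ x : X, ∃ h : R x ∈ A.domain, z • R x - A ⟨R x, h⟩ = x) ∧
    ∀ x : A.domain, R (z • (x : X) - A x) = x

/-- The resolvent set `ρ(A)`. -/
def resolventSet (A : X →ₗ.[ℂ] X) : Set ℂ := {z | ∃ R : X →L[ℂ] X, IsResolventAt A z R}

/-- The spectrum `σ(A) = ℂ \ ρ(A)`. -/
def spectrum (A : X →ₗ.[ℂ] X) : Set ℂ := (resolventSet A)ᶜ

open Classical in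
/-- The resolvent `R(z, A) = (z - A)⁻¹` for `z ∈ ρ(A)` (and `0` for other `z`). -/
def resolvent (A : X →ₗ.[ℂ] X) (z : ℂ) : X →L[ℂ] X :=
  if h : ∃ R : X →L[ℂ] X, IsResolventAt A z R then h.choose else 0

theorem isResolventAt_unique {A : X →ₗ.[ℂ] X} {z : ℂ} {R R' : X →L[ℂ] X}
    (h : IsResolventAt A z R) (h' : IsResolventAt A z R') : R = R' := by
  ext x
  obtain ⟨hx, hx'⟩ := h'.1 x
  have := h.2 ⟨R' x, hx⟩
  rw [hx'] at this
  exact this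

theorem resolvent_spec {A : X →ₗ.[ℂ] X} {z : ℂ} (hz : z ∈ resolventSet A) :
    IsResolventAt A z (resolvent A z) := by
  have h : ∃ R : X →L[ℂ] X, IsResolventAt A z R := hz
  unfold resolvent
  rw [dif_pos h]
  exact h.choose_spec

/-- The open sector `Σ_φ = {z ≠ 0 : |arg z| < φ}`. -/
def sector (φ : ℝ) : Set ℂ := {z | z ≠ 0 ∧ |z.arg| < φ}

/-- Sectorial operators: closed, densely defined, with dense range, and for some angle
`φ ∈ (0, π/2)` the spectrum lies in the closed sector and `z R(z, A)` is bounded off it. -/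
structure IsSectorial (A : X →ₗ.[ℂ] X) : Prop where
  isClosed : A.IsClosed
  dense_domain : Dense (A.domain : Set X)
  dense_range : Dense (Set.range fun x : A.domain => A x)
  exists_angle : ∃ φ ∈ Set.Ioo (0 : ℝ) (Real.pi / 2), spectrum A ⊆ closure (sector φ) ∧
    ∃ C : ℝ, ∀ z ∉ closure (sector φ), ‖z • resolvent A z‖ ≤ C

/-- `S`, restricted to `[0, ∞)`, is a `C₀`-semigroup. -/
structure IsC0Semigroup (S : ℝ → X →L[ℂ] X) : Prop where
  zero : S 0 = ContinuousLinearMap.id ℂ X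
  add : ∀ s t : ℝ, 0 ≤ s → 0 ≤ t → S (s + t) = (S s).comp (S t)
  tendsto_zero : ∀ x : X, Tendsto (fun s => S s x) (𝓝[>] 0) (𝓝 x)

/-- `B` is the generator of `S`: `x ∈ D(B)` and `B x = y` if and only if
`(S(s) x - x) / s → y` as `s ↓ 0`. -/
def IsGeneratorOf (B : X →ₗ.[ℂ] X) (S : ℝ → X →L[ℂ] X) : Prop :=
  ∀ x y : X, (x, y) ∈ B.graph ↔
    Tendsto (fun s : ℝ => ((s⁻¹ : ℝ) : ℂ) • (S s x - x)) (𝓝[>] 0) (𝓝 y)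

open Classical in
/-- The `C₀`-semigroup `s ↦ e^{sB}`, `s ≥ 0`, generated by `B`
(the zero family if `B` does not generate a `C₀`-semigroup). -/
def semigroup (B : X →ₗ.[ℂ] X) : ℝ → X →L[ℂ] X :=
  if h : ∃ S : ℝ → X →L[ℂ] X, IsC0Semigroup S ∧ IsGeneratorOf B S then h.choose else 0

theorem semigroup_spec {B : X →ₗ.[ℂ] X}
    (h : ∃ S : ℝ → X →L[ℂ] X, IsC0Semigroup S ∧ IsGeneratorOf B S) :
    IsC0Semigroup (semigroup B) ∧ IsGeneratorOf B (semigroup B) := by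
  unfold semigroup
  rw [dif_pos h]
  exact h.choose_spec

/-- `𝓡`-boundedness. The expectation over `n` independent Rademacher variables is the average
over all sign vectors `ε ∈ {1, -1}ⁿ`. -/
def RBounded (𝒯 : Set (X →L[ℂ] X)) : Prop :=
  ∃ C : ℝ≥0, ∀ (n : ℕ) (T : Fin n → X →L[ℂ] X) (x : Fin n → X), (∀ k, T k ∈ 𝒯) →
    (𝔼 ε : Fin n → ℤˣ, ‖∑ k, ((ε k : ℤ) : ℂ) • T k (x k)‖) ≤
      C * 𝔼 ε : Fin n → ℤˣ, ‖∑ k, ((ε k : ℤ) : ℂ) • x k‖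

/-- The set `{z R(z, A(t)) : z ∉ closure Σ_θ, t ∈ [0, T]}`. -/
def resolventFamily (A : ℝ → X →ₗ.[ℂ] X) (T θ : ℝ) : Set (X →L[ℂ] X) :=
  {S | ∃ t ∈ Set.Icc 0 T, ∃ z ∉ closure (sector θ), S = z • resolvent (A t) z}

end Operators

/-! ### `𝓡_q`-boundedness and domination on `L^p` -/

section Lp

variable {Ω : Type*} [MeasurableSpace Ω] {μ : Measure Ω} {p : ℝ≥0∞} [Fact (1 ≤ p)]

/-- `𝓡_q`-boundedness on `L^p(Ω)`, for `1 ≤ q ≤ ∞`. The norm `‖WithLp.toLp q a‖` of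
`a ∈ ℂⁿ` is `(∑ₖ |aₖ|^q)^{1/q}` if `q < ∞` and `maxₖ |aₖ|` if `q = ∞`. -/
def RqBounded (q : ℝ≥0∞) (𝒯 : Set (Lp ℂ p μ →L[ℂ] Lp ℂ p μ)) : Prop :=
  ∃ C : ℝ≥0, ∀ (n : ℕ) (T : Fin n → Lp ℂ p μ →L[ℂ] Lp ℂ p μ) (f : Fin n → Lp ℂ p μ),
    (∀ k, T k ∈ 𝒯) →
    eLpNorm (fun x => ‖WithLp.toLp q fun k => (T k (f k) : Ω → ℂ) x‖) p μ ≤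
      C * eLpNorm (fun x => ‖WithLp.toLp q fun k => (f k : Ω → ℂ) x‖) p μ

/-- The modulus `|f| ∈ L^p(Ω)` of `f ∈ L^p(Ω)`. -/
def absLp (f : Lp ℂ p μ) : Lp ℂ p μ :=
  MemLp.toLp (fun x => ((‖f x‖ : ℝ) : ℂ)) (Lp.memLp f).norm.ofReal

open scoped ComplexOrder in
/-- `T` dominates `S`: for all `f` one has `|S f|(x) ≤ (T |f|)(x)` almost everywhere. (An
inequality `a ≤ b` of complex numbers means that `b - a` is real and nonnegative.) -/
def Dominates (T S : Lp ℂ p μ →L[ℂ] Lp ℂ p μ) : Prop :=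
  ∀ f : Lp ℂ p μ, ∀ᵐ x ∂μ, ((‖S f x‖ : ℝ) : ℂ) ≤ T (absLp f) x

end Lp

end RBdd

end

/-! Write $h$ for the contour and $e^{-zA}$ for the holomorphic extension of the semigroup.
`RqBounded` is a bound for diagonal operators $(f_k)\mapsto(T_kf_k)$ on $L^p(\ell^q)$, uniform in
their number, and the theorem interpolates between two such bounds for $e^{-zA(t)}$.

On the positive half-line, domination gives the bound in $L^p(\ell^q)$: the norm is monotone in the
moduli, so the $\mathcal R_q$-bound of the dominating operators passes to the semigroups. On a
complex sector the operators $e^{-zA(t)}$ are merely uniformly bounded; since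
$L^p(\ell^p)=\ell^p(L^p)$ by Fubini, this is already a bound in $L^p(\ell^p)$. Now apply Stein
interpolation to $\zeta\mapsto e^{-\rho_k e^{i\eta_k\zeta}A(t_k)}$ on the strip
$0\le\operatorname{Re}\zeta\le1$: on the left edge the time is positive, on the right edge it lies
in the sector. At $\zeta=\tau$, with $1/r=(1-\tau)/q+\tau/p$, this bounds $e^{-zA}$ in $L^p(\ell^r)$
on rays of angle $\eta_k\tau\ne0$ (`norm_vecLp_contourExp_le`). The Laplace transform along such a
rotated ray represents $\lambda R(\lambda,A)$ even for some $\lambda$ in the right half-plane, which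
gives an angle $\theta<\pi/2$ (`norm_vecLp_smul_resolvent_le`).

Two further ingredients are needed. The semigroup is specified only through its generator, so it has
to be identified with a Cauchy integral of the resolvent over a hyperbola, which supplies holomorphy
and bounds uniform in $t$ (`semigroup_eq`, `norm_contourExp_le`, `integral_laplace`). The unbounded
operator $A$ is avoided there by composing with the injective operator $R(-1)$. For the last claim,
Khintchine's inequality compares Rademacher averages in $L^p$, $p<\infty$, with the norm of
$L^p(\ell^2)$ (`RqBounded.rBounded`). -/

namespace RBdd

/-! ### A hyperbolic contour around the sectors -/

section Contour

open Complex (I)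

/-- A hyperbola around the closed sector of angle `ψ`, its vertex to the left of the origin. -/
noncomputable def contour (ψ u : ℝ) : ℂ := Complex.cosh (u + ψ * I) - 1

/-- The derivative of the parametrisation `contour ψ`. -/
noncomputable def contourDeriv (ψ u : ℝ) : ℂ := Complex.sinh (u + ψ * I)

theorem cosh_add_mul_I (u y : ℝ) : Complex.cosh (u + y * I) =
    (Real.cosh u * Real.cos y : ℝ) + (Real.sinh u * Real.sin y : ℝ) * I := by
  rw [Complex.cosh_add, Complex.cosh_mul_I, Complex.sinh_mul_I]; push_cast; ring

theorem sinh_add_mul_I (u y : ℝ) : Complex.sinh (u + y * I) =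
    (Real.sinh u * Real.cos y : ℝ) + (Real.cosh u * Real.sin y : ℝ) * I := by
  rw [Complex.sinh_add, Complex.cosh_mul_I, Complex.sinh_mul_I]; push_cast; ring

theorem contour_re (ψ u : ℝ) : (contour ψ u).re = Real.cosh u * Real.cos ψ - 1 := by
  rw [contour, cosh_add_mul_I]; simp [-Complex.ofReal_mul]

theorem contour_im (ψ u : ℝ) : (contour ψ u).im = Real.sinh u * Real.sin ψ := by
  rw [contour, cosh_add_mul_I]; simp [-Complex.ofReal_mul]

/-- The hyperbola $\cosh(u+i\psi)$ has foci $\pm1$; the shift by $-1$ puts a focus at the origin,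
and the distance to a focus involves no square root. -/
theorem norm_contour (ψ u : ℝ) : ‖contour ψ u‖ = Real.cosh u - Real.cos ψ := by
  have h : 0 ≤ Real.cosh u - Real.cos ψ := by
    linarith [Real.one_le_cosh u, Real.cos_le_one ψ]
  rw [← Real.sqrt_sq h, Complex.norm_eq_sqrt_sq_add_sq, contour_re, contour_im]
  congr 1
  have h1 := Real.cosh_sq u
  have h2 := Real.sin_sq_add_cos_sq ψ
  linear_combination (-Real.sin ψ ^ 2) * h1 + (Real.cosh u ^ 2 - 1) * h2

theorem norm_sq_sinh_add_mul_I (u y : ℝ) :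
    ‖Complex.sinh (u + y * I)‖ ^ 2 = Real.sinh u ^ 2 + Real.sin y ^ 2 := by
  rw [sinh_add_mul_I, Complex.sq_norm, Complex.normSq_add_mul_I]
  have h1 := Real.cosh_sq u
  have h2 := Real.sin_sq_add_cos_sq y
  linear_combination (Real.sin y ^ 2) * h1 + (Real.sinh u ^ 2) * h2

theorem abs_sinh_le_norm_sinh (u y : ℝ) : |Real.sinh u| ≤ ‖Complex.sinh (u + y * I)‖ := by
  apply abs_le_of_sq_le_sq _ (norm_nonneg _)
  rw [norm_sq_sinh_add_mul_I]
  nlinarith [sq_nonneg (Real.sin y)]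

theorem norm_cosh_le (u y : ℝ) : ‖Complex.cosh (u + y * I)‖ ≤ Real.cosh u := by
  apply le_of_sq_le_sq _ (Real.cosh_pos u).le
  rw [cosh_add_mul_I, Complex.sq_norm, Complex.normSq_add_mul_I]
  have h1 := Real.cosh_sq u
  have h2 := Real.sin_sq_add_cos_sq y
  nlinarith [sq_nonneg (Real.sin y)]

theorem norm_contourDeriv_le (ψ u : ℝ) : ‖contourDeriv ψ u‖ ≤ Real.cosh u := by
  apply le_of_sq_le_sq _ (Real.cosh_pos u).le
  rw [contourDeriv, norm_sq_sinh_add_mul_I, Real.cosh_sq]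
  nlinarith [Real.sin_sq_le_one ψ]

theorem hasDerivAt_contour (ψ u : ℝ) : HasDerivAt (contour ψ) (contourDeriv ψ u) u := by
  have h1 : HasDerivAt (fun z : ℂ => Complex.cosh (z + ψ * I) - 1) (contourDeriv ψ u) u := by
    simpa [contourDeriv] using ((hasDerivAt_id (u : ℂ)).add_const (ψ * I)).ccosh.sub_const 1
  exact h1.comp_ofReal

theorem continuous_contour (ψ : ℝ) : Continuous (contour ψ) :=
  continuous_iff_continuousAt.2 fun u => (hasDerivAt_contour ψ u).continuousAt

theorem continuous_contourDeriv (ψ : ℝ) : Continuous (contourDeriv ψ) := by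
  unfold contourDeriv; fun_prop

theorem norm_exp_neg_contour (ψ u : ℝ) :
    ‖Complex.exp (-contour ψ u)‖ = Real.exp (1 - Real.cos ψ * Real.cosh u) := by
  rw [Complex.norm_exp, Complex.neg_re, contour_re]; congr 1; ring

/-- An integrable majorant of `e^{-h} h'` along the contour `h`. -/
noncomputable def contourWeight (ψ u : ℝ) : ℝ :=
  Real.exp (1 - Real.cos ψ * Real.cosh u) * Real.cosh u

theorem contourWeight_nonneg (ψ u : ℝ) : 0 ≤ contourWeight ψ u :=
  mul_nonneg (Real.exp_pos _).le (Real.cosh_pos u).le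

theorem one_add_sq_le_cosh_sq (u : ℝ) : 1 + u ^ 2 ≤ Real.cosh u ^ 2 := by
  rw [Real.cosh_sq]
  have : u ^ 2 ≤ Real.sinh u ^ 2 := by
    rw [sq_le_sq, Real.abs_sinh]
    exact Real.self_le_sinh_iff.2 (abs_nonneg u)
  linarith

/-- By $e^{-x}\le 6/x^3$ with $x=\cos\psi\cosh u$: one power of $\cosh u$ cancels the factor in the
weight, and the other two give integrability. -/
theorem contourWeight_le {ψ : ℝ} (hψ : 0 < Real.cos ψ) (u : ℝ) :
    contourWeight ψ u ≤ Real.exp 1 * 6 / Real.cos ψ ^ 3 * (1 + u ^ 2)⁻¹ := by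
  have h1 := one_add_sq_le_cosh_sq u
  have hc := Real.cosh_pos u
  have h2 := Real.pow_div_factorial_le_exp (x := Real.cos ψ * Real.cosh u) (by positivity) 3
  have h3 : Real.exp (-(Real.cos ψ * Real.cosh u)) ≤ 6 / (Real.cos ψ * Real.cosh u) ^ 3 := by
    rw [Real.exp_neg, ← inv_div]
    apply inv_anti₀ (by positivity)
    simpa [Nat.factorial] using h2
  have h4 : contourWeight ψ u ≤ Real.exp 1 * 6 / Real.cos ψ ^ 3 * (Real.cosh u ^ 2)⁻¹ := by
    rw [contourWeight, sub_eq_add_neg, Real.exp_add]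
    calc _ ≤ Real.exp 1 * (6 / (Real.cos ψ * Real.cosh u) ^ 3) * Real.cosh u := by gcongr
      _ = _ := by field_simp
  refine h4.trans ?_
  gcongr

theorem integrable_contourWeight {ψ : ℝ} (hψ : 0 < Real.cos ψ) :
    Integrable (contourWeight ψ) := by
  refine (integrable_inv_one_add_sq.const_mul (Real.exp 1 * 6 / Real.cos ψ ^ 3)).mono' ?_ ?_
  · unfold contourWeight
    exact Continuous.aestronglyMeasurable (by fun_prop)
  · refine ae_of_all _ fun u => ?_
    rw [Real.norm_of_nonneg (contourWeight_nonneg ψ u)]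
    exact contourWeight_le hψ u

theorem norm_exp_mul_contourDeriv_le (ψ u : ℝ) :
    ‖Complex.exp (-contour ψ u) * contourDeriv ψ u‖ ≤ contourWeight ψ u := by
  rw [norm_mul, norm_exp_neg_contour, contourWeight]
  gcongr
  exact norm_contourDeriv_le ψ u

theorem tendsto_cosh_cocompact : Tendsto Real.cosh (cocompact ℝ) atTop := by
  refine tendsto_atTop_mono (f := fun u => ‖u‖) (fun u => ?_) tendsto_norm_cocompact_atTop
  rw [Real.norm_eq_abs]
  refine abs_le_of_sq_le_sq ?_ (Real.cosh_pos u).le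
  linarith [one_add_sq_le_cosh_sq u]

theorem tendsto_exp_neg_contour {ψ : ℝ} (hψ : 0 < Real.cos ψ) :
    Tendsto (fun u => Complex.exp (-contour ψ u)) (cocompact ℝ) (𝓝 0) := by
  rw [tendsto_zero_iff_norm_tendsto_zero]
  simp only [norm_exp_neg_contour]
  refine Real.tendsto_exp_atBot.comp ?_
  exact tendsto_const_nhds.add_atBot (tendsto_neg_atTop_atBot.comp
    (tendsto_cosh_cocompact.const_mul_atTop hψ))

/-- The primitive $-e^{-h}$ vanishes at both ends. This removes the terms of a contour integral that
are constant in the spectral variable. -/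
theorem integral_exp_mul_contourDeriv {ψ : ℝ} (hψ : 0 < Real.cos ψ) :
    ∫ u, Complex.exp (-contour ψ u) * contourDeriv ψ u = 0 := by
  have hd : ∀ u, HasDerivAt (fun u => -Complex.exp (-contour ψ u))
      (Complex.exp (-contour ψ u) * contourDeriv ψ u) u := fun u => by
    have := ((hasDerivAt_contour ψ u).fun_neg.cexp).fun_neg
    simpa using this
  have ht := (tendsto_exp_neg_contour hψ).neg
  have hi : Integrable fun u => Complex.exp (-contour ψ u) * contourDeriv ψ u := by
    refine (integrable_contourWeight hψ).mono' ?_ (ae_of_all _ (norm_exp_mul_contourDeriv_le ψ))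
    exact ((Complex.continuous_exp.comp (continuous_contour ψ).neg).mul
      (continuous_contourDeriv ψ)).aestronglyMeasurable
  rw [integral_of_hasDerivAt_of_tendsto hd hi (ht.mono_left atBot_le_cocompact)
    (ht.mono_left atTop_le_cocompact)]
  simp

/-- The normalising constant `∫ e^{-h} dh / h` of the contour integral. -/
noncomputable def contourConst (ψ : ℝ) : ℂ :=
  ∫ u, Complex.exp (-contour ψ u) * contourDeriv ψ u / contour ψ u

/-! ### Nonvanishing of the normalising constant -/

theorem one_add_sq_half_le_cosh (u : ℝ) : 1 + u ^ 2 / 2 ≤ Real.cosh u := by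
  have h1 : Real.cosh u = 1 + 2 * Real.sinh (u / 2) ^ 2 := by
    have := Real.cosh_two_mul (u / 2)
    rw [Real.cosh_sq, mul_div_cancel₀ u two_ne_zero] at this
    rw [this]; ring
  have h2 : (u / 2) ^ 2 ≤ Real.sinh (u / 2) ^ 2 := by
    rw [sq_le_sq, Real.abs_sinh]
    exact Real.self_le_sinh_iff.2 (abs_nonneg _)
  rw [h1]; linarith

theorem sin_mul_le_norm_sinh {y : ℝ} (hy : 0 ≤ Real.sin y) (u : ℝ) :
    Real.sin y * (1 + u ^ 2 / 2) ≤ ‖Complex.sinh (u + y * I)‖ := by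
  refine (mul_le_mul_of_nonneg_left (one_add_sq_half_le_cosh u) hy).trans ?_
  apply le_of_sq_le_sq _ (norm_nonneg _)
  rw [norm_sq_sinh_add_mul_I, mul_pow, Real.cosh_sq]
  nlinarith [Real.sin_sq_le_one y, sq_nonneg (Real.sinh u)]

theorem sinh_add_mul_I_ne_zero {y : ℝ} (hy : 0 < Real.sin y) (u : ℝ) :
    Complex.sinh (u + y * I) ≠ 0 := by
  rw [← norm_pos_iff]
  exact lt_of_lt_of_le (by positivity) (sin_mul_le_norm_sinh hy.le u)

/-- The difference of the integrand of `contourConst` and `2 / sinh`; the singularity at the origin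
is removable. -/
noncomputable def stripFun (w : ℂ) : ℂ :=
  (Complex.exp (-(Complex.cosh w - 1)) * (Complex.cosh w + 1) - 2) / Complex.sinh w

theorem stripFun_neg (w : ℂ) : stripFun (-w) = -stripFun w := by
  simp [stripFun, Complex.cosh_neg, Complex.sinh_neg, div_neg]

/-- The numerator vanishes at $0$ together with its derivative, while $\sinh$ has a simple zero; the
quotient of the two slopes tends to $0$, which is also the value produced by division by zero. -/
theorem continuousAt_stripFun_zero : ContinuousAt stripFun 0 := by
  have hN : HasDerivAt (fun w : ℂ => Complex.exp (-(Complex.cosh w - 1)) * (Complex.cosh w + 1) - 2)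
      0 0 := by
    have h1 := Complex.hasDerivAt_cosh 0
    have := (((h1.sub_const 1).fun_neg.cexp).fun_mul (h1.add_const 1)).sub_const 2
    simpa using this
  have hS : HasDerivAt Complex.sinh 1 0 := by simpa using Complex.hasDerivAt_sinh 0
  rw [hasDerivAt_iff_tendsto_slope] at hN hS
  have h0 : stripFun 0 = 0 := by simp [stripFun]
  rw [← continuousWithinAt_compl_self, ContinuousWithinAt, h0]
  have := hN.div hS one_ne_zero
  rw [zero_div] at this
  refine this.congr' ?_
  filter_upwards [self_mem_nhdsWithin] with w hw
  have hw' : w ≠ 0 := hw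
  simp only [Pi.div_apply, slope_def_field, stripFun]
  norm_num
  rw [div_div_div_cancel_right₀ hw']

theorem differentiableAt_stripFun {w : ℂ} (hw : Complex.sinh w ≠ 0) :
    DifferentiableAt ℂ stripFun w := by
  unfold stripFun
  fun_prop (disch := exact hw)

theorem exists_norm_stripFun_le {ψ : ℝ} (hψ : ψ ∈ Set.Ioo 0 (Real.pi / 2)) :
    ∃ C : ℝ, 0 ≤ C ∧ ∀ u : ℝ, ∀ y ∈ Set.Icc 0 ψ,
      ‖stripFun (u + y * I)‖ ≤ C / ‖Complex.sinh (u + y * I)‖ := by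
  have hc : 0 < Real.cos ψ := Real.cos_pos_of_mem_Ioo ⟨by linarith [hψ.1, Real.pi_pos], hψ.2⟩
  refine ⟨Real.exp 1 * 6 / Real.cos ψ ^ 3 * 2 + 2, by positivity, fun u y hy => ?_⟩
  rw [stripFun, norm_div]
  gcongr
  have h1 : ‖Complex.exp (-(Complex.cosh (u + y * I) - 1))‖ ≤
      Real.exp (1 - Real.cos ψ * Real.cosh u) := by
    rw [← contour, norm_exp_neg_contour]
    have : Real.cos ψ ≤ Real.cos y :=
      Real.cos_le_cos_of_nonneg_of_le_pi hy.1 (by linarith [hψ.2, Real.pi_pos]) hy.2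
    have hcu := Real.cosh_pos u
    gcongr
  have h2 : ‖Complex.cosh (u + y * I) + 1‖ ≤ Real.cosh u * 2 := by
    refine (norm_add_le _ _).trans ?_
    rw [norm_one]
    linarith [norm_cosh_le u y, Real.one_le_cosh u]
  have h3 := contourWeight_le hc u
  have h4 : (1 + u ^ 2)⁻¹ ≤ 1 := inv_le_one_of_one_le₀ (by nlinarith)
  have h5 : contourWeight ψ u ≤ Real.exp 1 * 6 / Real.cos ψ ^ 3 :=
    h3.trans (mul_le_of_le_one_right (by positivity) h4)
  refine (norm_sub_le _ _).trans ?_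
  rw [norm_mul, Complex.norm_ofNat]
  refine add_le_add_left ?_ 2
  calc _ ≤ Real.exp (1 - Real.cos ψ * Real.cosh u) * (Real.cosh u * 2) := by gcongr
    _ = contourWeight ψ u * 2 := by rw [contourWeight]; ring
    _ ≤ _ := by gcongr

theorem tendsto_integral_stripFun_vertical {ψ : ℝ} (hψ : ψ ∈ Set.Ioo 0 (Real.pi / 2))
    {l : Filter ℝ} {g : ℝ → ℝ} (hg : Tendsto (fun L => |g L|) l atTop) :
    Tendsto (fun L => ∫ y in (0 : ℝ)..ψ, stripFun (g L + y * I)) l (𝓝 0) := by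
  obtain ⟨C, hC, h⟩ := exists_norm_stripFun_le hψ
  have hb : ∀ᶠ L in l, ‖∫ y in (0 : ℝ)..ψ, stripFun (g L + y * I)‖ ≤ C / |g L| * |ψ - 0| := by
    filter_upwards [hg.eventually_gt_atTop 0] with L hL
    refine intervalIntegral.norm_integral_le_of_norm_le_const fun y hy => ?_
    rw [Set.uIoc_of_le hψ.1.le] at hy
    refine (h _ y ⟨hy.1.le, hy.2⟩).trans ?_
    gcongr
    refine le_trans ?_ (abs_sinh_le_norm_sinh _ _)
    rw [Real.abs_sinh]
    exact Real.self_le_sinh_iff.2 (abs_nonneg _)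
  refine squeeze_zero_norm' hb ?_
  simpa using (hg.const_div_atTop C).mul_const |ψ - 0|

theorem integrable_inv_sinh {y : ℝ} (hy : 0 < Real.sin y) :
    Integrable fun u : ℝ => (‖Complex.sinh (u + y * I)‖)⁻¹ := by
  refine (integrable_inv_one_add_sq.const_mul (2 / Real.sin y)).mono' ?_ ?_
  · refine (Continuous.inv₀ (by fun_prop) fun u => ?_).aestronglyMeasurable
    exact norm_ne_zero_iff.2 (sinh_add_mul_I_ne_zero hy u)
  · refine ae_of_all _ fun u => ?_
    rw [norm_inv, norm_norm]
    have := sin_mul_le_norm_sinh hy.le u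
    rw [div_eq_mul_inv, ← inv_inv (2 : ℝ), ← mul_inv, ← mul_inv]
    apply inv_anti₀ (by positivity)
    nlinarith [sq_nonneg u]

theorem continuous_stripFun_line {y : ℝ} (hy : 0 < Real.sin y) :
    Continuous fun u : ℝ => stripFun (u + y * I) := by
  refine continuous_iff_continuousAt.2 fun u => ?_
  have h1 := (differentiableAt_stripFun (sinh_add_mul_I_ne_zero hy u)).continuousAt
  have h2 : ContinuousAt (fun u : ℝ => (u : ℂ) + y * I) u := by fun_prop
  exact ContinuousAt.comp (f := fun u : ℝ => (u : ℂ) + y * I) h1 h2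

theorem integrable_stripFun_line {ψ : ℝ} (hψ : ψ ∈ Set.Ioo 0 (Real.pi / 2)) :
    Integrable fun u : ℝ => stripFun (u + ψ * I) := by
  have hs : 0 < Real.sin ψ := Real.sin_pos_of_pos_of_lt_pi hψ.1 (by linarith [hψ.2, Real.pi_pos])
  obtain ⟨C, hC, h⟩ := exists_norm_stripFun_le hψ
  refine ((integrable_inv_sinh hs).const_mul C).mono'
    (continuous_stripFun_line hs).aestronglyMeasurable (ae_of_all _ fun u => ?_)
  simpa [div_eq_mul_inv] using h u ψ ⟨hψ.1.le, le_rfl⟩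

/-- Cauchy's theorem moves the line of integration from height $\psi$ down to the real axis, where
the function is odd; the vertical sides vanish in the limit. -/
theorem integral_stripFun_line {ψ : ℝ} (hψ : ψ ∈ Set.Ioo 0 (Real.pi / 2)) :
    ∫ u : ℝ, stripFun (u + ψ * I) = 0 := by
  have hsin : ∀ y ∈ Set.Ioc 0 ψ, 0 < Real.sin y := fun y hy =>
    Real.sin_pos_of_pos_of_lt_pi hy.1 (by linarith [hψ.2, Real.pi_pos, hy.2])
  have hrect : ∀ L : ℝ, ∫ u in -L..L, stripFun (u + ψ * I) =
      I • (∫ y in (0 : ℝ)..ψ, stripFun (L + y * I)) -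
        I • ∫ y in (0 : ℝ)..ψ, stripFun ((-L : ℝ) + y * I) := by
    intro L
    have hodd : ∫ x in -L..L, stripFun (x + (0 : ℝ) * I) = 0 := by
      have h1 := intervalIntegral.integral_comp_neg (a := -L) (b := L)
        (fun x : ℝ => stripFun (x + (0 : ℝ) * I))
      simp only [Complex.ofReal_neg, Complex.ofReal_zero, zero_mul, add_zero, stripFun_neg,
        intervalIntegral.integral_neg, neg_neg] at h1 ⊢
      exact self_eq_neg.1 h1.symm
    -- The removable singularity lies on the boundary of the rectangle, so continuity there is
    -- enough.
    have := Complex.integral_boundary_rect_eq_zero_of_continuousOn_of_differentiableOn stripFun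
      (⟨-L, 0⟩ : ℂ) ⟨L, ψ⟩ ?_ ?_
    · simp only [hodd] at this
      rw [zero_sub, neg_add_eq_sub, sub_right_comm, sub_eq_zero] at this
      exact this.symm
    · intro w hw
      rw [Complex.mem_reProdIm] at hw
      have hy : w.im ∈ Set.Icc 0 ψ := by simpa [Set.uIcc_of_le hψ.1.le] using hw.2
      apply ContinuousAt.continuousWithinAt
      rcases hy.1.eq_or_lt with h0 | h0
      · by_cases hr : w.re = 0
        · have : w = 0 := Complex.ext hr h0.symm
          rw [this]; exact continuousAt_stripFun_zero
        · refine (differentiableAt_stripFun ?_).continuousAt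
          rw [← Complex.re_add_im w, ← h0, ← norm_pos_iff]
          refine lt_of_lt_of_le ?_ (abs_sinh_le_norm_sinh _ _)
          rw [abs_pos]
          exact fun h => hr (Real.sinh_eq_zero.1 h)
      · refine (differentiableAt_stripFun ?_).continuousAt
        rw [← Complex.re_add_im w]
        exact sinh_add_mul_I_ne_zero (hsin _ ⟨h0, hy.2⟩) _
    · intro w hw
      rw [Complex.mem_reProdIm] at hw
      have hy : w.im ∈ Set.Ioo 0 ψ := by simpa [hψ.1.le] using hw.2
      refine (differentiableAt_stripFun ?_).differentiableWithinAt
      rw [← Complex.re_add_im w]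
      exact sinh_add_mul_I_ne_zero (hsin _ ⟨hy.1, hy.2.le⟩) _
  have h1 := intervalIntegral_tendsto_integral (integrable_stripFun_line hψ)
    tendsto_neg_atTop_atBot tendsto_id
  have h2 : Tendsto (fun L : ℝ => ∫ u in -L..L, stripFun (u + ψ * I)) atTop (𝓝 0) := by
    simp only [hrect]
    have e1 := tendsto_integral_stripFun_vertical hψ (l := atTop) (g := fun L => L)
      tendsto_abs_atTop_atTop
    have e2 := tendsto_integral_stripFun_vertical hψ (l := atTop) (g := fun L => -L)
      (by simpa using tendsto_abs_atTop_atTop)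
    simpa using (e1.const_smul I).sub (e2.const_smul I)
  exact tendsto_nhds_unique h1 h2

theorem contour_integrand_eq {ψ : ℝ} (hs : 0 < Real.sin ψ) (u : ℝ) :
    Complex.exp (-contour ψ u) * contourDeriv ψ u / contour ψ u =
      stripFun (u + ψ * I) + 2 * (Complex.sinh (u + ψ * I))⁻¹ := by
  have h0 := sinh_add_mul_I_ne_zero hs u
  have h1 : Complex.sinh (u + ψ * I) ^ 2 =
      (Complex.cosh (u + ψ * I) - 1) * (Complex.cosh (u + ψ * I) + 1) := by
    rw [Complex.sinh_sq]; ring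
  have h2 : Complex.cosh (u + ψ * I) - 1 ≠ 0 := by
    intro h; rw [h, zero_mul] at h1; exact h0 (pow_eq_zero_iff two_ne_zero |>.1 h1)
  rw [contour, contourDeriv, stripFun]
  field_simp
  rw [h1]; ring

/-- With $w=u+i\psi$ the integrand is $e^{-(\cosh w-1)}(\cosh w+1)/\sinh w$. After removal of
`stripFun`, whose integral is zero, there remains $2/\sinh w$, whose imaginary part is negative
everywhere. The exact value of the constant is not needed. -/
theorem contourConst_ne_zero {ψ : ℝ} (hψ : ψ ∈ Set.Ioo 0 (Real.pi / 2)) : contourConst ψ ≠ 0 := by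
  have hs : 0 < Real.sin ψ := Real.sin_pos_of_pos_of_lt_pi hψ.1 (by linarith [hψ.2, Real.pi_pos])
  have hi : Integrable fun u : ℝ => (Complex.sinh (u + ψ * I))⁻¹ := by
    refine (integrable_inv_sinh hs).mono' ?_ (ae_of_all _ fun u => by rw [norm_inv])
    exact (Continuous.inv₀ (by fun_prop) (sinh_add_mul_I_ne_zero hs)).aestronglyMeasurable
  have h1 : contourConst ψ = 2 * ∫ u : ℝ, (Complex.sinh (u + ψ * I))⁻¹ := by
    simp only [contourConst, contour_integrand_eq hs]
    rw [integral_add (integrable_stripFun_line hψ) (hi.const_mul 2), integral_stripFun_line hψ,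
      zero_add, integral_const_mul]
  have him : ∀ u : ℝ, 0 < -((Complex.sinh (u + ψ * I))⁻¹).im := fun u => by
    have := Complex.normSq_pos.2 (sinh_add_mul_I_ne_zero hs u)
    rw [Complex.inv_im, neg_div, neg_neg]
    refine div_pos ?_ this
    rw [sinh_add_mul_I]
    simpa [-Complex.ofReal_mul] using mul_pos (Real.cosh_pos u) hs
  have h2 : (∫ u : ℝ, (Complex.sinh (u + ψ * I))⁻¹).im =
      ∫ u : ℝ, ((Complex.sinh (u + ψ * I))⁻¹).im :=
    (Complex.imCLM.integral_comp_comm hi).symm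
  have h3 : 0 < ∫ u : ℝ, -((Complex.sinh (u + ψ * I))⁻¹).im := by
    rw [integral_pos_iff_support_of_nonneg (fun u => (him u).le) (Complex.imCLM.integrable_comp hi).neg]
    have : Function.support (fun u : ℝ => -((Complex.sinh (u + ψ * I))⁻¹).im) = Set.univ :=
      Set.eq_univ_of_forall fun u => (him u).ne'
    rw [this]; simp
  intro h
  rw [h1, mul_eq_zero] at h
  have h4 := h.resolve_left two_ne_zero
  rw [h4, Complex.zero_im] at h2
  rw [integral_neg, ← h2] at h3
  simp at h3

end Contour

end RBdd

namespace RBdd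

/-! ### Bounded holomorphic semigroups as contour integrals -/

section Resolvent

/-- The complement of the closed sector of angle `φ`, for `φ ∈ (0, π / 2)`. -/
def offSector (φ : ℝ) : Set ℂ := {z | z.re < ‖z‖ * Real.cos φ}

theorem isOpen_offSector (φ : ℝ) : IsOpen (offSector φ) :=
  isOpen_lt Complex.continuous_re (continuous_norm.mul continuous_const)

theorem ne_zero_of_mem_offSector {φ : ℝ} {z : ℂ} (hz : z ∈ offSector φ) : z ≠ 0 := by
  rintro rfl; simp [offSector] at hz

theorem notMem_closure_sector {φ : ℝ} (hφ : φ ∈ Set.Ioo 0 (Real.pi / 2)) {z : ℂ}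
    (hz : z ∈ offSector φ) : z ∉ closure (sector φ) := by
  have h : closure (sector φ) ⊆ (offSector φ)ᶜ := by
    refine closure_minimal (fun w hw hw' => ?_) (isOpen_offSector φ).isClosed_compl
    have h1 : Real.cos φ < Real.cos |w.arg| :=
      Real.cos_lt_cos_of_nonneg_of_le_pi (abs_nonneg _) (by linarith [hφ.2, Real.pi_pos]) hw.2
    rw [Real.cos_abs] at h1
    have h2 : w.re < ‖w‖ * Real.cos φ := hw'
    rw [← Complex.norm_mul_cos_arg w] at h2
    have h3 := norm_pos_iff.2 hw.1
    nlinarith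
  exact fun h' => h h' hz

theorem re_le_of_notMem_closure_sector {θ : ℝ} (hθ : θ ∈ Set.Ioo 0 Real.pi) {z : ℂ}
    (hz : z ∉ closure (sector θ)) : z ≠ 0 ∧ θ ≤ |z.arg| := by
  have h0 : z ≠ 0 := by
    rintro rfl
    refine hz (Metric.mem_closure_iff.2 fun ε hε => ⟨((ε / 2 : ℝ) : ℂ), ⟨?_, ?_⟩, ?_⟩)
    · exact_mod_cast (half_pos hε).ne'
    · rw [Complex.arg_ofReal_of_nonneg (half_pos hε).le, abs_zero]; exact hθ.1
    · rw [dist_zero_left, Complex.norm_real, Real.norm_of_nonneg (half_pos hε).le]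
      exact half_lt_self hε
  refine ⟨h0, not_lt.1 fun h => hz (subset_closure ⟨h0, h⟩)⟩

theorem neg_one_mem_offSector {φ : ℝ} (hφ : φ ∈ Set.Ioo 0 (Real.pi / 2)) :
    (-1 : ℂ) ∈ offSector φ := by
  have : 0 < Real.cos φ := Real.cos_pos_of_mem_Ioo ⟨by linarith [hφ.1, Real.pi_pos], hφ.2⟩
  simp only [offSector, Set.mem_ofPred_eq, Complex.neg_re, Complex.one_re, norm_neg, norm_one]
  linarith

theorem isOpen_sector (δ : ℝ) (hδ : δ ≤ Real.pi) : IsOpen (sector δ) := by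
  have h : sector δ = Complex.slitPlane ∩ Complex.arg ⁻¹' {x | |x| < δ} := by
    ext z
    simp only [sector, Set.mem_ofPred_eq, Set.mem_inter_iff, Set.mem_preimage,
      Complex.mem_slitPlane_iff_arg]
    constructor
    · rintro ⟨h0, h1⟩
      exact ⟨⟨fun h => by rw [h, abs_of_pos Real.pi_pos] at h1; linarith, h0⟩, h1⟩
    · rintro ⟨⟨-, h0⟩, h1⟩
      exact ⟨h0, h1⟩
  rw [h]
  refine ContinuousOn.isOpen_inter_preimage (fun z hz =>
    (Complex.continuousAt_arg hz).continuousWithinAt) Complex.isOpen_slitPlane ?_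
  exact isOpen_lt continuous_abs continuous_const

theorem re_div_eq (w z : ℂ) : (w / z).re =
    (w.re * Real.cos z.arg + w.im * Real.sin z.arg) / ‖z‖ := by
  rcases eq_or_ne z 0 with rfl | hz
  · simp
  have h := norm_pos_iff.2 hz
  rw [Complex.div_re, ← Complex.sq_norm]
  conv_lhs => rw [← Complex.norm_mul_cos_arg z, ← Complex.norm_mul_sin_arg z]
  field_simp

/-- Division by $z$ turns the contour by at most $|\arg z|<\psi-\varphi$. After clearing $|z|$, the
claim follows from $\cos(\psi-|\arg z|)<\cos\varphi$ and $\cos\arg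
z\ge\cos\psi\ge\cos\psi\cos\varphi$. -/
theorem contour_div_mem_offSector {φ ψ : ℝ} (hφ : 0 < φ) (hφψ : φ < ψ) (hψ : ψ < Real.pi / 2)
    {z : ℂ} (hz : z ∈ sector (ψ - φ)) (u : ℝ) : contour ψ u / z ∈ offSector φ := by
  have hz0 := norm_pos_iff.2 hz.1
  have hz1 := hz.2
  rw [offSector, Set.mem_ofPred_eq, re_div_eq, norm_div, div_mul_eq_mul_div,
    div_lt_div_iff_of_pos_right hz0, norm_contour, contour_re, contour_im]
  have hpi := Real.pi_pos
  have hsψ : 0 < Real.sin ψ := Real.sin_pos_of_pos_of_lt_pi (by linarith) (by linarith)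
  have h1 : Real.cos (ψ - |z.arg|) < Real.cos φ :=
    Real.cos_lt_cos_of_nonneg_of_le_pi hφ.le (by linarith [abs_nonneg z.arg]) (by linarith)
  have h2 : Real.cos ψ ≤ Real.cos z.arg := by
    rw [← Real.cos_abs z.arg]
    exact Real.cos_le_cos_of_nonneg_of_le_pi (abs_nonneg _) (by linarith) (by linarith)
  have hcψ : 0 ≤ Real.cos ψ := Real.cos_nonneg_of_neg_pi_div_two_le_of_le (by linarith) hψ.le
  have h3 : Real.cos ψ * Real.cos φ ≤ Real.cos ψ :=
    mul_le_of_le_one_right hcψ (Real.cos_le_one φ)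
  have h4 : Real.sinh u * Real.sin ψ * Real.sin z.arg ≤
      Real.cosh u * (Real.sin ψ * Real.sin |z.arg|) := by
    have e1 : |Real.sin z.arg| = Real.sin |z.arg| :=
      Real.abs_sin_eq_sin_abs_of_abs_le_pi (by linarith)
    have e2 : |Real.sinh u| ≤ Real.cosh u := by
      apply abs_le_of_sq_le_sq _ (Real.cosh_pos u).le
      rw [Real.cosh_sq]; linarith
    rw [← e1]
    calc _ ≤ |Real.sinh u * Real.sin ψ * Real.sin z.arg| := le_abs_self _
      _ = |Real.sinh u| * (Real.sin ψ * |Real.sin z.arg|) := by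
        rw [abs_mul, abs_mul, abs_of_pos hsψ]; ring
      _ ≤ _ := by gcongr
  rw [Real.cos_sub, Real.cos_abs] at h1
  have hc := Real.one_le_cosh u
  nlinarith [mul_lt_mul_of_pos_left h1 (Real.cosh_pos u)]

variable {X : Type*} [NormedAddCommGroup X] [NormedSpace ℂ X]

/-- `R` is the resolvent of `A` off the closed sector of angle `φ`, with `‖z R(z)‖ ≤ M`. -/
structure IsSectorResolvent (A : X →ₗ.[ℂ] X) (φ M : ℝ) (R : ℂ → X →L[ℂ] X) : Prop where
  mem_Ioo : φ ∈ Set.Ioo 0 (Real.pi / 2)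
  isResolventAt : ∀ z ∈ offSector φ, IsResolventAt A z (R z)
  norm_le : ∀ z ∈ offSector φ, ‖R z‖ ≤ M / ‖z‖

namespace IsSectorResolvent

variable {A : X →ₗ.[ℂ] X} {φ M : ℝ} {R : ℂ → X →L[ℂ] X} (h : IsSectorResolvent A φ M R)
include h

theorem nonneg : 0 ≤ M := by
  have := h.norm_le _ (neg_one_mem_offSector h.mem_Ioo)
  rw [norm_neg, norm_one, div_one] at this
  exact (norm_nonneg _).trans this

theorem resolvent_identity {z w : ℂ} (hz : z ∈ offSector φ) (hw : w ∈ offSector φ) :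
    R z - R w = (w - z) • (R z * R w) := by
  ext x
  obtain ⟨hd, hx⟩ := (h.isResolventAt w hw).1 x
  have h1 := (h.isResolventAt z hz).2 ⟨R w x, hd⟩
  have h2 : z • R w x - A ⟨R w x, hd⟩ = x + (z - w) • R w x := by
    rw [sub_smul, add_sub_left_comm, sub_eq_add_neg]
    congr 1
    rw [eq_sub_iff_add_eq', ← sub_eq_add_neg, hx]
  simp only [h2, map_add, map_smul] at h1
  simp only [sub_apply, smul_apply, mul_apply_eq_comp]
  rw [← neg_sub z w, neg_smul, sub_eq_iff_eq_add, neg_add_eq_sub, eq_sub_iff_add_eq, h1]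

theorem commute {z w : ℂ} (hz : z ∈ offSector φ) (hw : w ∈ offSector φ) :
    R z * R w = R w * R z := by
  rcases eq_or_ne z w with rfl | hne
  · rfl
  have h1 := h.resolvent_identity hz hw
  have h2 := h.resolvent_identity hw hz
  have h3 : (w - z) • (R z * R w) = (w - z) • (R w * R z) := by
    rw [← h1, ← neg_sub (R w), h2, ← neg_smul, neg_sub]
  exact smul_right_injective _ (sub_ne_zero.2 hne.symm) h3

theorem injective {z : ℂ} (hz : z ∈ offSector φ) : Function.Injective (R z) := by
  rw [injective_iff_map_eq_zero]
  intro x hx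
  obtain ⟨hd, h1⟩ := (h.isResolventAt z hz).1 x
  have : (⟨R z x, hd⟩ : A.domain) = 0 := Subtype.ext hx
  rw [this, hx, smul_zero, zero_sub, LinearPMap.map_zero, neg_zero] at h1
  exact h1.symm

theorem continuousAt {z : ℂ} (hz : z ∈ offSector φ) : ContinuousAt R z := by
  rw [ContinuousAt, tendsto_iff_norm_sub_tendsto_zero]
  have hz0 := ne_zero_of_mem_offSector hz
  have ht : Tendsto (fun w => ‖z - w‖ * (M / ‖w‖ * (M / ‖z‖))) (𝓝 z) (𝓝 0) := by
    have h1 : ContinuousAt (fun w => ‖z - w‖ * (M / ‖w‖ * (M / ‖z‖))) z := by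
      have := norm_ne_zero_iff.2 hz0
      fun_prop (disch := assumption)
    simpa [ContinuousAt] using h1
  refine squeeze_zero' (Eventually.of_forall fun _ => norm_nonneg _) ?_ ht
  filter_upwards [(isOpen_offSector φ).mem_nhds hz] with w hw
  rw [h.resolvent_identity hw hz, norm_smul]
  gcongr
  refine (norm_mul_le _ _).trans ?_
  have := h.nonneg
  gcongr
  · exact h.norm_le w hw
  · exact h.norm_le z hz

theorem hasDerivAt {z : ℂ} (hz : z ∈ offSector φ) : HasDerivAt R (-(R z * R z)) z := by
  rw [hasDerivAt_iff_tendsto_slope]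
  have h1 : Tendsto (fun w => -(R w * R z)) (𝓝[≠] z) (𝓝 (-(R z * R z))) :=
    (((h.continuousAt hz).mul continuousAt_const).neg).tendsto.mono_left nhdsWithin_le_nhds
  refine h1.congr' ?_
  filter_upwards [self_mem_nhdsWithin,
    nhdsWithin_le_nhds ((isOpen_offSector φ).mem_nhds hz)] with w hw hw'
  rw [slope_def_module, h.resolvent_identity hw' hz, smul_smul, ← neg_sub w z, mul_neg,
    inv_mul_cancel₀ (sub_ne_zero.2 hw), neg_one_smul]

end IsSectorResolvent

/-- The integrand of the contour integral for `e^{-zA}`, up to the normalising constant. -/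
noncomputable def expKernel (R : ℂ → X →L[ℂ] X) (ψ : ℝ) (z : ℂ) (u : ℝ) : X →L[ℂ] X :=
  (Complex.exp (-contour ψ u) * contourDeriv ψ u) • z⁻¹ • R (contour ψ u / z)

/-- The derivative in `z` of `expKernel`. -/
noncomputable def expKernelDeriv (R : ℂ → X →L[ℂ] X) (ψ : ℝ) (z : ℂ) (u : ℝ) : X →L[ℂ] X :=
  (Complex.exp (-contour ψ u) * contourDeriv ψ u) • (-(z ^ 2)⁻¹) •
    (R (contour ψ u / z) - (contour ψ u / z) • (R (contour ψ u / z) * R (contour ψ u / z)))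

/-- The operators `e^{-zA}`, in terms of the resolvent `R` of `A`. -/
noncomputable def contourExp (R : ℂ → X →L[ℂ] X) (ψ : ℝ) (z : ℂ) : X →L[ℂ] X :=
  (contourConst ψ)⁻¹ • ∫ u, expKernel R ψ z u

namespace IsSectorResolvent

variable {A : X →ₗ.[ℂ] X} {φ ψ M : ℝ} {R : ℂ → X →L[ℂ] X} (h : IsSectorResolvent A φ M R)
  (hφψ : φ < ψ) (hψ : ψ < Real.pi / 2)
include h hφψ hψ

theorem pos_cos : 0 < Real.cos ψ :=
  Real.cos_pos_of_mem_Ioo ⟨by linarith [h.mem_Ioo.1, Real.pi_pos], hψ⟩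

theorem one_sub_cos_pos : 0 < 1 - Real.cos ψ := by
  have h0 := h.mem_Ioo.1
  have := Real.cos_lt_cos_of_nonneg_of_le_pi le_rfl (by linarith [Real.pi_pos]) (h0.trans hφψ)
  rw [Real.cos_zero] at this
  linarith

omit hφψ hψ h in
theorem _root_.RBdd.one_sub_cos_le_norm_contour (ψ u : ℝ) :
    1 - Real.cos ψ ≤ ‖contour ψ u‖ := by
  rw [norm_contour]; linarith [Real.one_le_cosh u]

theorem contour_mem {z : ℂ} (hz : z ∈ sector (ψ - φ)) (u : ℝ) : contour ψ u / z ∈ offSector φ :=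
  contour_div_mem_offSector h.mem_Ioo.1 hφψ hψ hz u

theorem norm_contour_pos (u : ℝ) : 0 < ‖contour ψ u‖ :=
  (h.one_sub_cos_pos hφψ hψ).trans_le (one_sub_cos_le_norm_contour ψ u)

theorem norm_resolvent_contour_le {z : ℂ} (hz : z ∈ sector (ψ - φ)) (u : ℝ) :
    ‖R (contour ψ u / z)‖ ≤ M * ‖z‖ / ‖contour ψ u‖ := by
  have := h.norm_le _ (h.contour_mem hφψ hψ hz u)
  rwa [norm_div, div_div_eq_mul_div] at this

theorem continuous_resolvent_contour {z : ℂ} (hz : z ∈ sector (ψ - φ)) :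
    Continuous fun u => R (contour ψ u / z) :=
  continuous_iff_continuousAt.2 fun u =>
    ContinuousAt.comp (f := fun u => contour ψ u / z)
      (h.continuousAt (h.contour_mem hφψ hψ hz u)) ((continuous_contour ψ).div_const z).continuousAt

/-- The exponential in the kernel does not involve $z$, and $\|z^{-1}R(h/z)\|\le M/|h|$, so the
majorant is independent of $z$ and depends on the operator only through $M$. -/
theorem norm_expKernel_le {z : ℂ} (hz : z ∈ sector (ψ - φ)) (u : ℝ) :
    ‖expKernel R ψ z u‖ ≤ contourWeight ψ u * (M / (1 - Real.cos ψ)) := by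
  rw [expKernel, norm_smul, norm_smul, norm_inv]
  have hz0 := norm_pos_iff.2 hz.1
  have h1 := h.one_sub_cos_pos hφψ hψ
  have hM := h.nonneg
  have h2 := one_sub_cos_le_norm_contour ψ u
  have h3 : ‖z‖⁻¹ * ‖R (contour ψ u / z)‖ ≤ M / (1 - Real.cos ψ) := by
    calc _ ≤ ‖z‖⁻¹ * (M * ‖z‖ / ‖contour ψ u‖) := by
          gcongr; exact h.norm_resolvent_contour_le hφψ hψ hz u
      _ = M / ‖contour ψ u‖ := by field_simp
      _ ≤ _ := by gcongr
  gcongr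
  · exact contourWeight_nonneg ψ u
  · exact norm_exp_mul_contourDeriv_le ψ u

theorem continuous_expKernel {z : ℂ} (hz : z ∈ sector (ψ - φ)) : Continuous (expKernel R ψ z) := by
  have h1 := h.continuous_resolvent_contour hφψ hψ hz
  have h2 := continuous_contour ψ
  have h3 := continuous_contourDeriv ψ
  exact ((Complex.continuous_exp.comp h2.neg).mul h3).smul (h1.const_smul z⁻¹)

theorem integrable_expKernel {z : ℂ} (hz : z ∈ sector (ψ - φ)) : Integrable (expKernel R ψ z) :=
  ((integrable_contourWeight (h.pos_cos hφψ hψ)).mul_const _).mono'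
    (h.continuous_expKernel hφψ hψ hz).aestronglyMeasurable
    (ae_of_all _ (h.norm_expKernel_le hφψ hψ hz))

theorem norm_contourExp_le {z : ℂ} (hz : z ∈ sector (ψ - φ)) :
    ‖contourExp R ψ z‖ ≤
      ‖(contourConst ψ)⁻¹‖ * ((∫ u, contourWeight ψ u) * (M / (1 - Real.cos ψ))) := by
  rw [contourExp, norm_smul, ← integral_mul_const]
  gcongr
  exact norm_integral_le_of_norm_le ((integrable_contourWeight (h.pos_cos hφψ hψ)).mul_const _)
    (ae_of_all _ (h.norm_expKernel_le hφψ hψ hz))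

theorem norm_smul_sq_le {z : ℂ} (hz : z ∈ sector (ψ - φ)) (u : ℝ) :
    ‖(contour ψ u / z) • (R (contour ψ u / z) * R (contour ψ u / z))‖ ≤
      M ^ 2 * ‖z‖ / ‖contour ψ u‖ := by
  have hz0 := norm_pos_iff.2 hz.1
  have hc := h.norm_contour_pos hφψ hψ u
  have hM := h.nonneg
  have h1 := h.norm_resolvent_contour_le hφψ hψ hz u
  rw [norm_smul, norm_div]
  calc _ ≤ ‖contour ψ u‖ / ‖z‖ * (M * ‖z‖ / ‖contour ψ u‖ * (M * ‖z‖ / ‖contour ψ u‖)) := by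
        gcongr; exact (norm_mul_le _ _).trans (by gcongr)
    _ = _ := by field_simp

theorem norm_sub_smul_sq_le {z : ℂ} (hz : z ∈ sector (ψ - φ)) (u : ℝ) :
    ‖R (contour ψ u / z) - (contour ψ u / z) • (R (contour ψ u / z) * R (contour ψ u / z))‖ ≤
      (M + M ^ 2) * ‖z‖ / (1 - Real.cos ψ) := by
  have hz0 := norm_pos_iff.2 hz.1
  have hM := h.nonneg
  have h1 := h.norm_resolvent_contour_le hφψ hψ hz u
  have h2 := h.norm_smul_sq_le hφψ hψ hz u
  have h3 := h.one_sub_cos_pos hφψ hψ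
  have h4 := one_sub_cos_le_norm_contour ψ u
  calc _ ≤ _ := norm_sub_le _ _
    _ ≤ M * ‖z‖ / ‖contour ψ u‖ + M ^ 2 * ‖z‖ / ‖contour ψ u‖ := add_le_add h1 h2
    _ = (M + M ^ 2) * ‖z‖ / ‖contour ψ u‖ := by ring
    _ ≤ _ := by gcongr

theorem hasDerivAt_expKernel {z : ℂ} (hz : z ∈ sector (ψ - φ)) (u : ℝ) :
    HasDerivAt (fun z => expKernel R ψ z u) (expKernelDeriv R ψ z u) z := by
  have hz0 := hz.1
  have h1 : HasDerivAt (fun z => contour ψ u / z) (contour ψ u * (-(z ^ 2)⁻¹)) z := by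
    simpa [div_eq_mul_inv] using (hasDerivAt_inv hz0).const_mul (contour ψ u)
  have h2 := (h.hasDerivAt (h.contour_mem hφψ hψ hz u)).scomp z h1
  have h3 := ((hasDerivAt_inv hz0).smul h2).const_smul
    (Complex.exp (-contour ψ u) * contourDeriv ψ u)
  refine HasDerivAt.congr_deriv (f := fun z => expKernel R ψ z u) h3 ?_
  unfold expKernelDeriv
  congr 1
  simp only [Function.comp_apply]
  match_scalars <;> field_simp

theorem continuous_expKernelDeriv {z : ℂ} (hz : z ∈ sector (ψ - φ)) :
    Continuous (expKernelDeriv R ψ z) := by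
  have h1 := h.continuous_resolvent_contour hφψ hψ hz
  have h2 := continuous_contour ψ
  have h3 := continuous_contourDeriv ψ
  exact ((Complex.continuous_exp.comp h2.neg).mul h3).smul
    ((h1.sub ((h2.div_const z).smul (h1.mul h1))).const_smul (-(z ^ 2)⁻¹))

theorem hasDerivAt_integral_expKernel {z : ℂ} (hz : z ∈ sector (ψ - φ)) :
    HasDerivAt (fun z => ∫ u, expKernel R ψ z u) (∫ u, expKernelDeriv R ψ z u) z := by
  have hz0 := norm_pos_iff.2 hz.1
  -- The majorant of the derivative carries a factor $|w|^{-1}$, so $w$ is kept away from $0$.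
  have hs : sector (ψ - φ) ∩ {w | ‖z‖ / 2 < ‖w‖} ∈ 𝓝 z := by
    refine inter_mem ((isOpen_sector _ ?_).mem_nhds hz)
      ((isOpen_lt continuous_const continuous_norm).mem_nhds (half_lt_self hz0))
    linarith [h.mem_Ioo.1, Real.pi_pos]
  have h3 := h.one_sub_cos_pos hφψ hψ
  have hM := h.nonneg
  refine (hasDerivAt_integral_of_dominated_loc_of_deriv_le
    (bound := fun u => contourWeight ψ u * ((M + M ^ 2) / (1 - Real.cos ψ) * (‖z‖ / 2)⁻¹))
    hs ?_ (h.integrable_expKernel hφψ hψ hz)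
    (h.continuous_expKernelDeriv hφψ hψ hz).aestronglyMeasurable ?_
    ((integrable_contourWeight (h.pos_cos hφψ hψ)).mul_const _) ?_).2
  · filter_upwards [hs] with w hw using
      (h.continuous_expKernel hφψ hψ hw.1).aestronglyMeasurable
  · refine ae_of_all _ fun u w hw => ?_
    have hw2 : ‖z‖ / 2 < ‖w‖ := hw.2
    have hw0 : 0 < ‖w‖ := by linarith
    rw [expKernelDeriv, norm_smul, norm_smul, norm_neg, norm_inv, norm_pow]
    refine mul_le_mul (norm_exp_mul_contourDeriv_le ψ u) ?_ (by positivity)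
      (contourWeight_nonneg ψ u)
    · calc _ ≤ (‖w‖ ^ 2)⁻¹ * ((M + M ^ 2) * ‖w‖ / (1 - Real.cos ψ)) := by
            gcongr; exact h.norm_sub_smul_sq_le hφψ hψ hw.1 u
        _ = (M + M ^ 2) / (1 - Real.cos ψ) * ‖w‖⁻¹ := by field_simp
        _ ≤ _ := by gcongr
  · exact ae_of_all _ fun u w hw => h.hasDerivAt_expKernel hφψ hψ hw.1 u

end IsSectorResolvent

end Resolvent

end RBdd

namespace RBdd

/-! ### The differential equation $U'=-AU$ for the contour integral -/

section ContourExp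

variable {X : Type*} [NormedAddCommGroup X] [NormedSpace ℂ X]

namespace IsSectorResolvent

variable {A : X →ₗ.[ℂ] X} {φ ψ M : ℝ} {R : ℂ → X →L[ℂ] X} (h : IsSectorResolvent A φ M R)
  (hφψ : φ < ψ) (hψ : ψ < Real.pi / 2)
include h hφψ hψ

theorem integrable_contour_smul {z : ℂ} (hz : z ∈ sector (ψ - φ)) :
    Integrable fun u => (Complex.exp (-contour ψ u) * contourDeriv ψ u) •
      (contour ψ u • R (contour ψ u / z)) := by
  have h2 := continuous_contour ψ
  refine ((integrable_contourWeight (h.pos_cos hφψ hψ)).mul_const (M * ‖z‖)).mono'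
    (Continuous.aestronglyMeasurable ?_) (ae_of_all _ fun u => ?_)
  · exact ((Complex.continuous_exp.comp h2.neg).mul (continuous_contourDeriv ψ)).smul
      (h2.smul (h.continuous_resolvent_contour hφψ hψ hz))
  · rw [norm_smul, norm_smul]
    refine mul_le_mul (norm_exp_mul_contourDeriv_le ψ u) ?_ (by positivity)
      (contourWeight_nonneg ψ u)
    rw [mul_comm, ← le_div_iff₀ (h.norm_contour_pos hφψ hψ u)]
    exact h.norm_resolvent_contour_le hφψ hψ hz u

theorem integrable_contour_smul_sub {z : ℂ} (hz : z ∈ sector (ψ - φ)) :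
    Integrable fun u => (Complex.exp (-contour ψ u) * contourDeriv ψ u) •
      (R (contour ψ u / z) - (contour ψ u / z) • (R (contour ψ u / z) * R (contour ψ u / z))) := by
  have h1 := h.continuous_resolvent_contour hφψ hψ hz
  have h2 := continuous_contour ψ
  refine ((integrable_contourWeight (h.pos_cos hφψ hψ)).mul_const
    ((M + M ^ 2) * ‖z‖ / (1 - Real.cos ψ))).mono'
    (Continuous.aestronglyMeasurable ?_) (ae_of_all _ fun u => ?_)
  · exact ((Complex.continuous_exp.comp h2.neg).mul (continuous_contourDeriv ψ)).smul
      (h1.sub ((h2.div_const z).smul (h1.mul h1)))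
  · rw [norm_smul]
    exact mul_le_mul (norm_exp_mul_contourDeriv_le ψ u) (h.norm_sub_smul_sq_le hφψ hψ hz u)
      (norm_nonneg _) (contourWeight_nonneg ψ u)

variable [CompleteSpace X]

/-- Integration by parts along the contour. -/
theorem integral_contour_smul_eq {z : ℂ} (hz : z ∈ sector (ψ - φ)) :
    ∫ u, (Complex.exp (-contour ψ u) * contourDeriv ψ u) •
        (R (contour ψ u / z) - (contour ψ u / z) • (R (contour ψ u / z) * R (contour ψ u / z))) =
      ∫ u, (Complex.exp (-contour ψ u) * contourDeriv ψ u) •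
        (contour ψ u • R (contour ψ u / z)) := by
  have hz0 := hz.1
  have hd : ∀ u, HasDerivAt
      (fun u => (Complex.exp (-contour ψ u) * contour ψ u) • R (contour ψ u / z))
      ((Complex.exp (-contour ψ u) * contourDeriv ψ u) •
        (R (contour ψ u / z) - (contour ψ u / z) • (R (contour ψ u / z) * R (contour ψ u / z))) -
      (Complex.exp (-contour ψ u) * contourDeriv ψ u) •
        (contour ψ u • R (contour ψ u / z))) u := by
    intro u
    have e1 := hasDerivAt_contour ψ u
    have e2 := e1.fun_neg.cexp.fun_mul e1
    have e3 := (h.hasDerivAt (h.contour_mem hφψ hψ hz u)).scomp u (e1.div_const z)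
    refine (HasDerivAt.fun_smul e2 e3).congr_deriv ?_
    simp only [Function.comp_apply]
    match_scalars <;> field_simp
    ring
  have ht : Tendsto (fun u => (Complex.exp (-contour ψ u) * contour ψ u) • R (contour ψ u / z))
      (cocompact ℝ) (𝓝 0) := by
    rw [tendsto_zero_iff_norm_tendsto_zero]
    have e1 := ((tendsto_exp_neg_contour (h.pos_cos hφψ hψ)).norm).mul_const (M * ‖z‖)
    rw [norm_zero, zero_mul] at e1
    refine squeeze_zero (fun u => norm_nonneg _) (fun u => ?_) e1
    rw [mul_smul, norm_smul, norm_smul]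
    refine mul_le_mul_of_nonneg_left ?_ (norm_nonneg _)
    rw [mul_comm, ← le_div_iff₀ (h.norm_contour_pos hφψ hψ u)]
    exact h.norm_resolvent_contour_le hφψ hψ hz u
  have i1 := h.integrable_contour_smul_sub hφψ hψ hz
  have i2 := h.integrable_contour_smul hφψ hψ hz
  have := integral_of_hasDerivAt_of_tendsto hd (i1.sub i2) (ht.mono_left atBot_le_cocompact)
    (ht.mono_left atTop_le_cocompact)
  rw [sub_zero, integral_sub i1 i2, sub_eq_zero] at this
  exact this

/-- Since $\lambda R(-1)R(\lambda)=R(-1)-R(\lambda)-R(-1)R(\lambda)$ for $\lambda=h/z$, the factor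
$h$ is absorbed; the term in $R(-1)$ alone integrates to zero. -/
theorem mul_integral_contour {z : ℂ} (hz : z ∈ sector (ψ - φ)) :
    R (-1) * ∫ u, (Complex.exp (-contour ψ u) * contourDeriv ψ u) •
        (contour ψ u • R (contour ψ u / z)) =
      -(z ^ 2) • ((1 + R (-1)) * ∫ u, expKernel R ψ z u) := by
  have hJ := neg_one_mem_offSector h.mem_Ioo
  have hz0 := hz.1
  have i2 := h.integrable_contour_smul hφψ hψ hz
  have i3 := h.integrable_expKernel hφψ hψ hz
  have e1 := (ContinuousLinearMap.mul ℂ (X →L[ℂ] X) (R (-1))).integral_comp_comm i2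
  have e2 := (ContinuousLinearMap.mul ℂ (X →L[ℂ] X) (1 + R (-1))).integral_comp_comm i3
  simp only [ContinuousLinearMap.mul_apply'] at e1 e2
  rw [← e1, ← e2, ← integral_smul]
  have i4 : Integrable fun u => (Complex.exp (-contour ψ u) * contourDeriv ψ u) • (z • R (-1)) := by
    refine Integrable.smul_const ?_ _
    refine (integrable_contourWeight (h.pos_cos hφψ hψ)).mono' ?_
      (ae_of_all _ (norm_exp_mul_contourDeriv_le ψ))
    exact ((Complex.continuous_exp.comp (continuous_contour ψ).neg).mul
      (continuous_contourDeriv ψ)).aestronglyMeasurable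
  have i5 : Integrable fun u => -(z ^ 2) • ((1 + R (-1)) * expKernel R ψ z u) :=
    ((ContinuousLinearMap.mul ℂ (X →L[ℂ] X) (1 + R (-1))).integrable_comp i3).smul (-(z ^ 2))
  have e3 : ∀ u, R (-1) * ((Complex.exp (-contour ψ u) * contourDeriv ψ u) •
      (contour ψ u • R (contour ψ u / z))) =
      (Complex.exp (-contour ψ u) * contourDeriv ψ u) • (z • R (-1)) +
        -(z ^ 2) • ((1 + R (-1)) * expKernel R ψ z u) := by
    intro u
    have e4 := h.resolvent_identity hJ (h.contour_mem hφψ hψ hz u)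
    have e5 : (contour ψ u / z) • (R (-1) * R (contour ψ u / z)) =
        R (-1) - R (contour ψ u / z) - R (-1) * R (contour ψ u / z) := by
      rw [e4, sub_neg_eq_add, add_smul, one_smul, add_sub_cancel_right]
    have e6 : contour ψ u • (R (-1) * R (contour ψ u / z)) =
        z • (R (-1) - R (contour ψ u / z) - R (-1) * R (contour ψ u / z)) := by
      rw [← e5, smul_smul, mul_div_cancel₀ _ hz0]
    rw [expKernel, mul_smul_comm, mul_smul_comm, e6, add_mul, one_mul, mul_smul_comm,
      mul_smul_comm]
    match_scalars <;> field_simp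
  simp only [e3]
  rw [integral_add i4 i5, integral_smul_const, integral_exp_mul_contourDeriv (h.pos_cos hφψ hψ),
    zero_smul, zero_add]

/-- The function `z ↦ e^{-zA}` is holomorphic with derivative `-A e^{-zA}`; the latter is expressed
by means of the resolvent at `-1`. -/
theorem exists_hasDerivAt_contourExp {z : ℂ} (hz : z ∈ sector (ψ - φ)) :
    ∃ U' : X →L[ℂ] X, HasDerivAt (contourExp R ψ) U' z ∧
      R (-1) * U' = (1 + R (-1)) * contourExp R ψ z := by
  have hz0 := hz.1
  refine ⟨_, (h.hasDerivAt_integral_expKernel hφψ hψ hz).const_smul (contourConst ψ)⁻¹, ?_⟩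
  have e1 : ∫ u, expKernelDeriv R ψ z u = (-(z ^ 2)⁻¹) •
      ∫ u, (Complex.exp (-contour ψ u) * contourDeriv ψ u) •
        (contour ψ u • R (contour ψ u / z)) := by
    rw [← h.integral_contour_smul_eq hφψ hψ hz, ← integral_smul]
    simp only [expKernelDeriv]
    congr 1 with u : 1
    rw [smul_comm]
  rw [e1, mul_smul_comm, mul_smul_comm, h.mul_integral_contour hφψ hψ hz, contourExp,
    mul_smul_comm]
  have := pow_ne_zero 2 hz0
  match_scalars
  field_simp

theorem commute_contourExp {z w : ℂ} (hz : z ∈ sector (ψ - φ)) (hw : w ∈ offSector φ) :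
    R w * contourExp R ψ z = contourExp R ψ z * R w := by
  have i3 := h.integrable_expKernel hφψ hψ hz
  have e1 := (ContinuousLinearMap.mul ℂ (X →L[ℂ] X) (R w)).integral_comp_comm i3
  have e2 := ((ContinuousLinearMap.mul ℂ (X →L[ℂ] X)).flip (R w)).integral_comp_comm i3
  simp only [ContinuousLinearMap.mul_apply', ContinuousLinearMap.flip_apply] at e1 e2
  rw [contourExp, mul_smul_comm, smul_mul_assoc, ← e1, ← e2]
  congr 2 with u : 1
  rw [expKernel, mul_smul_comm, mul_smul_comm, smul_mul_assoc, smul_mul_assoc,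
    h.commute hw (h.contour_mem hφψ hψ hz u)]

/-- Subtract $R(-1)$, written as the normalised integral of $e^{-h}h'/h$ times $R(-1)$. The
resolvent identity leaves $h^{-1}R(h/z)(1+R(-1))$, of size $O(|z|/|h|^2)$. Here the normalising
constant must be nonzero; the estimate gives convergence to the identity on the range of $R(-1)$. -/
theorem norm_contourExp_mul_sub_le : ∃ C : ℝ, ∀ z ∈ sector (ψ - φ),
    ‖contourExp R ψ z * R (-1) - R (-1)‖ ≤ C * ‖z‖ := by
  have h1 := h.one_sub_cos_pos hφψ hψ
  have hM := h.nonneg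
  have hJ := neg_one_mem_offSector h.mem_Ioo
  have hc := h.pos_cos hφψ hψ
  have hψ' : ψ ∈ Set.Ioo 0 (Real.pi / 2) := ⟨h.mem_Ioo.1.trans hφψ, hψ⟩
  refine ⟨‖(contourConst ψ)⁻¹‖ * ((∫ u, contourWeight ψ u) *
    (M * ‖1 + R (-1)‖ / (1 - Real.cos ψ) ^ 2)), fun z hz => ?_⟩
  have hz0 := hz.1
  have i3 := h.integrable_expKernel hφψ hψ hz
  have e2 := ((ContinuousLinearMap.mul ℂ (X →L[ℂ] X)).flip (R (-1))).integral_comp_comm i3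
  simp only [ContinuousLinearMap.mul_apply', ContinuousLinearMap.flip_apply] at e2
  have hk : Integrable fun u => Complex.exp (-contour ψ u) * contourDeriv ψ u / contour ψ u := by
    refine ((integrable_contourWeight hc).mul_const (1 - Real.cos ψ)⁻¹).mono' ?_
      (ae_of_all _ fun u => ?_)
    · refine Continuous.aestronglyMeasurable ?_
      exact ((Complex.continuous_exp.comp (continuous_contour ψ).neg).mul
        (continuous_contourDeriv ψ)).div (continuous_contour ψ)
        fun u => norm_pos_iff.1 (h.norm_contour_pos hφψ hψ u)
    · rw [norm_div, div_eq_mul_inv]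
      exact mul_le_mul (norm_exp_mul_contourDeriv_le ψ u)
        (inv_anti₀ h1 (one_sub_cos_le_norm_contour ψ u)) (by positivity) (contourWeight_nonneg ψ u)
  have e3 : ∀ u, expKernel R ψ z u * R (-1) -
      (Complex.exp (-contour ψ u) * contourDeriv ψ u / contour ψ u) • R (-1) =
      -((Complex.exp (-contour ψ u) * contourDeriv ψ u / contour ψ u) •
        (R (contour ψ u / z) * (1 + R (-1)))) := by
    intro u
    have hu := norm_pos_iff.1 (h.norm_contour_pos hφψ hψ u)
    have e4 := h.resolvent_identity hJ (h.contour_mem hφψ hψ hz u)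
    have e5 : (contour ψ u / z) • (R (contour ψ u / z) * R (-1)) =
        R (-1) - R (contour ψ u / z) - R (contour ψ u / z) * R (-1) := by
      rw [e4, sub_neg_eq_add, add_smul, one_smul, h.commute hJ (h.contour_mem hφψ hψ hz u),
        add_sub_cancel_right]
    have e6 : z⁻¹ • (R (contour ψ u / z) * R (-1)) =
        (contour ψ u)⁻¹ • (R (-1) - R (contour ψ u / z) - R (contour ψ u / z) * R (-1)) := by
      rw [← e5, smul_smul]; congr 1; field_simp
    rw [expKernel, smul_mul_assoc, smul_mul_assoc, e6, mul_add, mul_one]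
    match_scalars <;> field_simp
    ring
  have e7 : contourExp R ψ z * R (-1) - R (-1) = (contourConst ψ)⁻¹ •
      ∫ u, -((Complex.exp (-contour ψ u) * contourDeriv ψ u / contour ψ u) •
        (R (contour ψ u / z) * (1 + R (-1)))) := by
    simp only [← e3]
    rw [integral_sub, integral_smul_const, ← contourConst, e2, smul_sub, smul_smul,
      inv_mul_cancel₀ (contourConst_ne_zero hψ'), one_smul, contourExp, smul_mul_assoc]
    · exact ((ContinuousLinearMap.mul ℂ (X →L[ℂ] X)).flip (R (-1))).integrable_comp i3
    · exact hk.smul_const _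
  rw [e7, norm_smul, mul_assoc, mul_assoc, ← integral_mul_const]
  gcongr
  refine norm_integral_le_of_norm_le
    ((integrable_contourWeight hc).mul_const _) (ae_of_all _ fun u => ?_)
  have h4 := one_sub_cos_le_norm_contour ψ u
  rw [norm_neg, norm_smul, norm_div, div_mul_eq_mul_div, mul_div_assoc]
  refine mul_le_mul (norm_exp_mul_contourDeriv_le ψ u) ?_ (by positivity) (contourWeight_nonneg ψ u)
  calc _ ≤ (M * ‖z‖ / ‖contour ψ u‖) * ‖1 + R (-1)‖ / ‖contour ψ u‖ := by
        gcongr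
        exact (norm_mul_le _ _).trans
          (mul_le_mul_of_nonneg_right (h.norm_resolvent_contour_le hφψ hψ hz u) (norm_nonneg _))
    _ ≤ (M * ‖z‖ / (1 - Real.cos ψ)) * ‖1 + R (-1)‖ / (1 - Real.cos ψ) := by gcongr
    _ = _ := by field_simp

end IsSectorResolvent

end ContourExp

end RBdd

namespace RBdd

/-! ### The contour integral is the semigroup generated by $-A$ -/

section Generation

variable {X : Type*} [NormedAddCommGroup X] [NormedSpace ℂ X]

open Classical in
/-- The semigroup `s ↦ e^{-sA}`, in terms of the resolvent `R` of `A`. -/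
noncomputable def contourSemigroup (R : ℂ → X →L[ℂ] X) (ψ s : ℝ) : X →L[ℂ] X :=
  if s ≤ 0 then 1 else contourExp R ψ s

theorem ofReal_mem_sector {δ s : ℝ} (hδ : 0 < δ) (hs : 0 < s) : (s : ℂ) ∈ sector δ :=
  ⟨by exact_mod_cast hs.ne', by rwa [Complex.arg_ofReal_of_nonneg hs.le, abs_zero]⟩

theorem ofReal_mul_mem_sector {δ s : ℝ} {z : ℂ} (hz : z ∈ sector δ) (hs : 0 < s) :
    (s : ℂ) * z ∈ sector δ :=
  ⟨mul_ne_zero (by exact_mod_cast hs.ne') hz.1, by rw [Complex.arg_real_mul _ hs]; exact hz.2⟩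

theorem tendsto_apply_of_tendsto {ι : Type*} {l : Filter ι} {S : ι → X →L[ℂ] X} {S₀ : X →L[ℂ] X}
    {v : ι → X} {v₀ : X} (hS : Tendsto S l (𝓝 S₀)) (hv : Tendsto v l (𝓝 v₀)) :
    Tendsto (fun i => S i (v i)) l (𝓝 (S₀ v₀)) :=
  ((isBoundedBilinearMap_apply (𝕜 := ℂ) (E := X) (F := X)).continuous.tendsto (S₀, v₀)).comp
    (hS.prodMk_nhds hv)

theorem hasDerivWithinAt_apply {c : ℝ → X →L[ℂ] X} {c' : X →L[ℂ] X} {u : ℝ → X} {u' : X}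
    {s : Set ℝ} {x : ℝ} (hc : HasDerivWithinAt c c' s x) (hu : HasDerivWithinAt u u' s x) :
    HasDerivWithinAt (fun y => c y (u y)) (c' (u x) + c x u') s x :=
  ((ContinuousLinearMap.restrictScalarsL ℂ X X ℝ ℝ).hasFDerivAt.comp_hasDerivWithinAt
    x hc).clm_apply hu

theorem hasDerivAt_apply_const {c : ℝ → X →L[ℂ] X} {c' : X →L[ℂ] X} {x : ℝ}
    (hc : HasDerivAt c c' x) (v : X) : HasDerivAt (fun y => c y v) (c' v) x := by
  rw [← hasDerivWithinAt_univ] at hc ⊢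
  simpa using hasDerivWithinAt_apply hc (hasDerivWithinAt_const x Set.univ v)

namespace IsSectorResolvent

variable {A : X →ₗ.[ℂ] X} {φ ψ M : ℝ} {R : ℂ → X →L[ℂ] X} (h : IsSectorResolvent A φ M R)
include h

/-- $y=-Ax$ means $(-1-A)x=y-x$. In this form the generator is tested with the bounded operator
$R(-1)$, without reference to domains. -/
theorem mem_graph_neg_iff (x y : X) : (x, y) ∈ (-A).graph ↔ R (-1) (y - x) = x := by
  have hJ := h.isResolventAt _ (neg_one_mem_offSector h.mem_Ioo)
  rw [LinearPMap.mem_graph_iff]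
  constructor
  · rintro ⟨v, hv, hy⟩
    simp only at hv hy
    have := hJ.2 v
    rw [← hy, LinearPMap.neg_apply, ← hv]
    rwa [neg_one_smul, ← neg_add', add_comm, neg_add'] at this
  · intro hx
    obtain ⟨hd, h1⟩ := hJ.1 (y - x)
    refine ⟨⟨R (-1) (y - x), hd⟩, hx, ?_⟩
    rw [LinearPMap.neg_apply]
    simp only
    generalize A ⟨R (-1) (y - x), hd⟩ = v at h1 ⊢
    rw [hx, neg_one_smul, sub_eq_add_neg, add_comm y (-x) |> (sub_eq_add_neg y x).trans] at h1
    exact add_left_cancel h1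

theorem dense_range (hA : Dense (A.domain : Set X)) : DenseRange (R (-1)) := by
  have hJ := h.isResolventAt _ (neg_one_mem_offSector h.mem_Ioo)
  exact hA.mono fun v hv => ⟨_, hJ.2 ⟨v, hv⟩⟩

variable (hφψ : φ < ψ) (hψ : ψ < Real.pi / 2) [CompleteSpace X]
include hφψ hψ

/-- The commutation of $U'$ with $R(-1)$ follows by differentiating that of `contourExp` with
$R(-1)$. -/
theorem exists_hasDerivAt_contourExp' {z : ℂ} (hz : z ∈ sector (ψ - φ)) :
    ∃ U' : X →L[ℂ] X, HasDerivAt (contourExp R ψ) U' z ∧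
      R (-1) * U' = (1 + R (-1)) * contourExp R ψ z ∧ U' * R (-1) = R (-1) * U' := by
  obtain ⟨U', h1, h2⟩ := h.exists_hasDerivAt_contourExp hφψ hψ hz
  refine ⟨U', h1, h2, ?_⟩
  have h3 : HasDerivAt (fun w => contourExp R ψ w * R (-1)) (U' * R (-1)) z := h1.mul_const _
  have h4 : HasDerivAt (fun w => R (-1) * contourExp R ψ w) (R (-1) * U') z := h1.const_mul _
  refine h3.unique (h4.congr_of_eventuallyEq ?_)
  have hs : sector (ψ - φ) ∈ 𝓝 z :=
    (isOpen_sector _ (by linarith [h.mem_Ioo.1, Real.pi_pos])).mem_nhds hz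
  filter_upwards [hs] with w hw
  exact (h.commute_contourExp hφψ hψ hw (neg_one_mem_offSector h.mem_Ioo)).symm

/-- Convergence on the dense range of $R(-1)$ extends to all $x$ by the uniform bound on the sector.
-/
theorem tendsto_contourExp (hA : Dense (A.domain : Set X)) (x : X) :
    Tendsto (fun z => contourExp R ψ z x) (𝓝[sector (ψ - φ)] 0) (𝓝 x) := by
  obtain ⟨C, hC⟩ := h.norm_contourExp_mul_sub_le hφψ hψ
  obtain ⟨K, hK0, hK⟩ : ∃ K : ℝ, 0 < K ∧ ∀ z ∈ sector (ψ - φ), ‖contourExp R ψ z‖ ≤ K :=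
    ⟨_, lt_of_lt_of_le zero_lt_one (le_max_left 1 _),
      fun z hz => (h.norm_contourExp_le hφψ hψ hz).trans (le_max_right _ _)⟩
  rw [Metric.tendsto_nhds]
  intro ε hε
  obtain ⟨w, hw⟩ := Metric.denseRange_iff.1 (h.dense_range hA) x (ε / (2 * (K + 1))) (by positivity)
  have h1 : Tendsto (fun z : ℂ => C * ‖z‖ * ‖w‖) (𝓝[sector (ψ - φ)] 0) (𝓝 0) := by
    have : Continuous fun z : ℂ => C * ‖z‖ * ‖w‖ := by fun_prop
    have := this.tendsto 0
    rw [norm_zero, mul_zero, zero_mul] at this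
    exact this.mono_left nhdsWithin_le_nhds
  filter_upwards [h1.eventually_lt_const (half_pos hε), self_mem_nhdsWithin] with z hz hzs
  rw [dist_eq_norm] at hw ⊢
  have h2 : ‖contourExp R ψ z (R (-1) w) - R (-1) w‖ ≤ C * ‖z‖ * ‖w‖ :=
    ((contourExp R ψ z * R (-1) - R (-1)).le_opNorm w).trans
      (mul_le_mul_of_nonneg_right (hC z hzs) (norm_nonneg _))
  have h3 : ‖contourExp R ψ z (x - R (-1) w)‖ ≤ K * ‖x - R (-1) w‖ :=
    (ContinuousLinearMap.le_opNorm _ _).trans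
      (mul_le_mul_of_nonneg_right (hK z hzs) (norm_nonneg _))
  have h4 : contourExp R ψ z x - x = contourExp R ψ z (x - R (-1) w) +
      (contourExp R ψ z (R (-1) w) - R (-1) w) - (x - R (-1) w) := by
    rw [map_sub]; abel
  rw [h4]
  have h5 : (K + 1) * ‖x - R (-1) w‖ < ε / 2 := by
    rw [lt_div_iff₀ (by positivity)] at hw
    linarith
  calc _ ≤ _ := norm_sub_le _ _
    _ ≤ _ := add_le_add (norm_add_le _ _) le_rfl
    _ < ε := by linarith

theorem tendsto_contourExp_ofReal_mul (hA : Dense (A.domain : Set X)) {z : ℂ}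
    (hz : z ∈ sector (ψ - φ)) (x : X) :
    Tendsto (fun s : ℝ => contourExp R ψ (s * z) x) (𝓝[>] 0) (𝓝 x) := by
  refine (h.tendsto_contourExp hφψ hψ hA x).comp (tendsto_nhdsWithin_iff.2 ⟨?_, ?_⟩)
  · have : Continuous fun s : ℝ => (s : ℂ) * z := by fun_prop
    have := this.tendsto 0
    rw [Complex.ofReal_zero, zero_mul] at this
    exact this.mono_left nhdsWithin_le_nhds
  · filter_upwards [self_mem_nhdsWithin] with s hs using ofReal_mul_mem_sector hz hs

theorem tendsto_contourExp_ofReal (hA : Dense (A.domain : Set X)) (x : X) :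
    Tendsto (fun s : ℝ => contourExp R ψ s x) (𝓝[>] 0) (𝓝 x) := by
  simpa using h.tendsto_contourExp_ofReal_mul hφψ hψ hA
    (ofReal_mem_sector (sub_pos.2 hφψ) one_pos) x

theorem exists_hasDerivAt_ofReal {s : ℝ} (hs : 0 < s) :
    ∃ U' : X →L[ℂ] X, HasDerivAt (fun s : ℝ => contourExp R ψ s) U' s ∧
      R (-1) * U' = (1 + R (-1)) * contourExp R ψ s ∧ U' * R (-1) = R (-1) * U' := by
  obtain ⟨U', h1, h2⟩ := h.exists_hasDerivAt_contourExp' hφψ hψ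
    (ofReal_mem_sector (sub_pos.2 hφψ) hs)
  refine ⟨U', ?_, h2⟩
  have := HasDerivAt.scomp s h1 (Complex.ofRealCLM.hasDerivAt (x := s))
  rw [Complex.ofRealCLM_apply, Complex.ofReal_one, one_smul] at this
  exact this

/-- The function $\tau\mapsto e^{-(s+t-\tau)A}e^{-\tau A}$ is constant on $(0,s+t)$. Its value at
$\tau=t$ is the product, its strong limit at $0$ is $e^{-(s+t)A}$. -/
theorem contourExp_add (hA : Dense (A.domain : Set X)) {s t : ℝ} (hs : 0 < s) (ht : 0 < t) :
    contourExp R ψ (s + t : ℝ) = contourExp R ψ s * contourExp R ψ t := by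
  have hJ := neg_one_mem_offSector h.mem_Ioo
  have hmem : ∀ {a : ℝ}, 0 < a → (a : ℂ) ∈ sector (ψ - φ) :=
    fun ha => ofReal_mem_sector (sub_pos.2 hφψ) ha
  set g : ℝ → X →L[ℂ] X := fun τ => contourExp R ψ (s + t - τ : ℝ) * contourExp R ψ τ with hg
  have hd : ∀ τ ∈ Set.Ioo 0 (s + t), HasDerivAt g 0 τ := by
    intro τ hτ
    have ha : 0 < s + t - τ := sub_pos.2 hτ.2
    obtain ⟨U', e1, e2, e3⟩ := h.exists_hasDerivAt_ofReal hφψ hψ hτ.1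
    obtain ⟨V', f1, f2, f3⟩ := h.exists_hasDerivAt_ofReal hφψ hψ ha
    have f4 : HasDerivAt (fun τ : ℝ => contourExp R ψ (s + t - τ : ℝ)) (-V') τ := by
      have := f1.scomp τ ((hasDerivAt_id τ).const_sub (s + t))
      rw [neg_one_smul] at this
      exact this
    refine (f4.mul e1).congr_deriv ?_
    ext x
    apply h.injective hJ
    -- After composition with $R(-1)$ both terms of the derivative become $\mp(1+R(-1))$ times the
    -- same product and cancel; injectivity of $R(-1)$ then gives derivative zero.
    have : R (-1) * (-V' * contourExp R ψ τ + contourExp R ψ (s + t - τ : ℝ) * U') = 0 := by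
      rw [mul_add, ← mul_assoc, mul_neg, f2, ← mul_assoc (R (-1)),
        h.commute_contourExp hφψ hψ (hmem ha) hJ, mul_assoc _ (R (-1)), e2, ← mul_assoc, mul_add,
        mul_one, ← h.commute_contourExp hφψ hψ (hmem ha) hJ]
      noncomm_ring
    simpa using congrArg (fun T : X →L[ℂ] X => T x) this
  have hconst : ∀ τ ∈ Set.Ioo 0 (s + t), g τ = g t := by
    intro τ hτ
    refine isOpen_Ioo.is_const_of_deriv_eq_zero isPreconnected_Ioo
      (fun r hr => (hd r hr).differentiableAt.differentiableWithinAt)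
      (fun r hr => (hd r hr).deriv) hτ ⟨ht, by linarith⟩
  ext x
  have h1 : Tendsto (fun τ : ℝ => contourExp R ψ (s + t - τ : ℝ)) (𝓝[>] 0)
      (𝓝 (contourExp R ψ (s + t : ℝ))) := by
    obtain ⟨V', f1, -⟩ := h.exists_hasDerivAt_ofReal hφψ hψ (add_pos hs ht)
    have h2 : Tendsto (fun τ : ℝ => s + t - τ) (𝓝[>] 0) (𝓝 (s + t)) := by
      have : Continuous fun τ : ℝ => s + t - τ := by fun_prop
      simpa using (this.tendsto 0).mono_left nhdsWithin_le_nhds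
    exact f1.continuousAt.tendsto.comp h2
  have h2 := tendsto_apply_of_tendsto h1 (h.tendsto_contourExp_ofReal hφψ hψ hA x)
  have h3 : Tendsto (fun τ : ℝ => contourExp R ψ (s + t - τ : ℝ) (contourExp R ψ τ x)) (𝓝[>] 0)
      (𝓝 ((contourExp R ψ s * contourExp R ψ t) x)) := by
    refine tendsto_const_nhds.congr' ?_
    filter_upwards [Ioo_mem_nhdsGT (add_pos hs ht)] with τ hτ
    have := congrArg (fun T : X →L[ℂ] X => T x) (hconst τ hτ)
    simp only [hg, add_sub_cancel_right] at this
    exact this.symm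
  exact tendsto_nhds_unique h2 h3

omit hψ hφψ h [CompleteSpace X] in
theorem _root_.RBdd.contourSemigroup_of_pos {R : ℂ → X →L[ℂ] X} {ψ s : ℝ} (hs : 0 < s) :
    contourSemigroup R ψ s = contourExp R ψ s := if_neg hs.not_ge

theorem isC0Semigroup_contourSemigroup (hA : Dense (A.domain : Set X)) :
    IsC0Semigroup (contourSemigroup R ψ) where
  zero := if_pos le_rfl
  add s t hs ht := by
    rcases hs.eq_or_lt with rfl | hs
    · rw [zero_add, contourSemigroup, contourSemigroup, if_pos le_rfl]
      rfl
    rcases ht.eq_or_lt with rfl | ht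
    · rw [add_zero, contourSemigroup, contourSemigroup, if_pos (le_refl (0 : ℝ))]
      rfl
    rw [contourSemigroup_of_pos hs, contourSemigroup_of_pos ht,
      contourSemigroup_of_pos (add_pos hs ht)]
    exact h.contourExp_add hφψ hψ hA hs ht
  tendsto_zero x := by
    refine (h.tendsto_contourExp_ofReal hφψ hψ hA x).congr' ?_
    filter_upwards [self_mem_nhdsWithin] with s hs
    rw [contourSemigroup_of_pos hs]

/-- For $x=R(-1)w$ one has $-Ax=w+x$. The derivative of the orbit at $s>0$ is $e^{-sA}(w+x)$, and
its limit at $0$ is the one-sided derivative there. -/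
theorem tendsto_contourSemigroup_slope (hA : Dense (A.domain : Set X)) (w : X) :
    Tendsto (fun s : ℝ => ((s⁻¹ : ℝ) : ℂ) • (contourSemigroup R ψ s (R (-1) w) - R (-1) w))
      (𝓝[>] 0) (𝓝 (w + R (-1) w)) := by
  have hJ := neg_one_mem_offSector h.mem_Ioo
  have hd : ∀ s : ℝ, 0 < s → HasDerivAt (fun s => contourSemigroup R ψ s (R (-1) w))
      (contourExp R ψ s (w + R (-1) w)) s := by
    intro s hs
    obtain ⟨U', e1, e2, e3⟩ := h.exists_hasDerivAt_ofReal hφψ hψ hs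
    have e4 : HasDerivAt (fun s : ℝ => contourExp R ψ s (R (-1) w)) (U' (R (-1) w)) s :=
      hasDerivAt_apply_const e1 _
    have e5 : U' (R (-1) w) = contourExp R ψ s (w + R (-1) w) := by
      have e6 : U' * R (-1) = contourExp R ψ s * (1 + R (-1)) := by
        rw [e3, e2, add_mul, mul_add, one_mul, mul_one, h.commute_contourExp hφψ hψ
          (ofReal_mem_sector (sub_pos.2 hφψ) hs) hJ]
      simpa using congrArg (fun T : X →L[ℂ] X => T w) e6
    rw [← e5]
    refine e4.congr_of_eventuallyEq ?_
    filter_upwards [lt_mem_nhds hs] with r hr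
    rw [contourSemigroup_of_pos hr]
  have h0 : contourSemigroup R ψ 0 (R (-1) w) = R (-1) w := by
    rw [contourSemigroup, if_pos le_rfl]; rfl
  have h1 : HasDerivWithinAt (fun s => contourSemigroup R ψ s (R (-1) w)) (w + R (-1) w)
      (Set.Ici 0) 0 := by
    refine hasDerivWithinAt_Ici_of_tendsto_deriv (s := Set.Ioi 0)
      (fun s hs => (hd s hs).differentiableAt.differentiableWithinAt) ?_ self_mem_nhdsWithin ?_
    · rw [ContinuousWithinAt, h0]
      exact (h.isC0Semigroup_contourSemigroup hφψ hψ hA).tendsto_zero _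
    · refine (h.tendsto_contourExp_ofReal hφψ hψ hA (w + R (-1) w)).congr' ?_
      filter_upwards [self_mem_nhdsWithin] with s hs
      rw [(hd s hs).deriv]
  rw [hasDerivWithinAt_iff_tendsto_slope, Set.Ici_sdiff_left] at h1
  refine h1.congr fun s => ?_
  rw [slope_def_module, sub_zero, h0, Complex.coe_smul]

theorem isGeneratorOf_contourSemigroup (hA : Dense (A.domain : Set X)) :
    IsGeneratorOf (-A) (contourSemigroup R ψ) := by
  have hJ := neg_one_mem_offSector h.mem_Ioo
  intro x y
  rw [h.mem_graph_neg_iff]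
  constructor
  · intro hx
    have := h.tendsto_contourSemigroup_slope hφψ hψ hA (y - x)
    rwa [hx, sub_add_cancel] at this
  -- The generator is not larger than $-A$: $R(-1)$ applied to the difference quotient at $x$ is the
  -- quotient at $R(-1)x$, whose limit is already known.
  · intro ht
    have h1 := ((R (-1)).continuous.tendsto y).comp ht
    have h2 := h.tendsto_contourSemigroup_slope hφψ hψ hA x
    have h3 : R (-1) y = x + R (-1) x := by
      refine tendsto_nhds_unique h1 (h2.congr' ?_)
      filter_upwards [self_mem_nhdsWithin] with s hs
      have h4 := congrArg (fun T : X →L[ℂ] X => T x)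
        (h.commute_contourExp hφψ hψ (ofReal_mem_sector (sub_pos.2 hφψ) hs) hJ)
      simp only [mul_apply_eq_comp] at h4
      simp only [Function.comp_apply]
      rw [map_smul, map_sub, contourSemigroup_of_pos hs, ← h4]
    rw [map_sub, h3, add_sub_cancel_right]

end IsSectorResolvent

end Generation

end RBdd

namespace RBdd

/-! ### Uniqueness of the generated semigroup, and the Laplace transform -/

section Uniqueness

variable {X : Type*} [NormedAddCommGroup X] [NormedSpace ℂ X]

namespace IsC0Semigroup

variable {S : ℝ → X →L[ℂ] X} (hS : IsC0Semigroup S)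
include hS

/-- Otherwise the norms are unbounded along a sequence of times tending to $0$, against
Banach–Steinhaus, as every orbit converges there. -/
theorem exists_norm_le_near_zero [CompleteSpace X] :
    ∃ δ > 0, ∃ C : ℝ, ∀ s ∈ Set.Icc 0 δ, ‖S s‖ ≤ C := by
  by_contra! hcon
  -- The maximum with $\|S(0)\|$ forces $s_n>0$, which is needed because the continuity hypothesis
  -- concerns the limit from the right only.
  have h1 : ∀ n : ℕ, ∃ s ∈ Set.Icc (0 : ℝ) (1 / (n + 1)), max (n : ℝ) ‖S 0‖ < ‖S s‖ := fun n =>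
    hcon _ (by positivity) _
  choose s hs hs' using h1
  have hpos : ∀ n, 0 < s n := fun n => (hs n).1.lt_of_ne fun h0 => by
    have := (le_max_right (n : ℝ) ‖S 0‖).trans_lt (hs' n)
    rw [← h0] at this
    exact lt_irrefl _ this
  have hlim : Tendsto s atTop (𝓝[>] 0) := by
    refine tendsto_nhdsWithin_iff.2 ⟨?_, Eventually.of_forall hpos⟩
    exact squeeze_zero (fun n => (hs n).1) (fun n => (hs n).2) tendsto_one_div_add_atTop_nhds_zero_nat
  obtain ⟨C, hC⟩ := banach_steinhaus (g := fun n => S (s n)) fun x => by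
    obtain ⟨C, hC⟩ := (((hS.tendsto_zero x).comp hlim).norm).bddAbove_range
    exact ⟨C, fun n => hC ⟨n, rfl⟩⟩
  obtain ⟨n, hn⟩ := exists_nat_gt C
  exact absurd (hC n) (not_le.2 (hn.trans ((le_max_left _ _).trans_lt (hs' n))))

theorem exists_norm_le [CompleteSpace X] (t : ℝ) :
    ∃ C : ℝ, ∀ s ∈ Set.Icc 0 t, ‖S s‖ ≤ C := by
  obtain ⟨δ, hδ, C, hC⟩ := hS.exists_norm_le_near_zero
  have hC0 : 0 ≤ C := (norm_nonneg _).trans (hC 0 ⟨le_rfl, hδ.le⟩)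
  have key : ∀ n : ℕ, ∃ K : ℝ, ∀ s ∈ Set.Icc 0 (n * δ), ‖S s‖ ≤ K := by
    intro n
    induction n with
    | zero => exact ⟨C, fun s hs => hC s ⟨hs.1, hs.2.trans (by simpa using hδ.le)⟩⟩
    | succ n ih =>
      obtain ⟨K, hK⟩ := ih
      refine ⟨max K (C * K), fun s hs => ?_⟩
      rcases le_total s (n * δ) with h | h
      · exact (hK s ⟨hs.1, h⟩).trans (le_max_left _ _)
      · have h1 : s - n * δ ∈ Set.Icc 0 δ := by
          have := hs.2
          push_cast at this
          constructor <;> linarith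
        have h2 : (n * δ : ℝ) ∈ Set.Icc 0 (n * δ) := ⟨by positivity, le_rfl⟩
        have h3 := hS.add _ _ h1.1 h2.1
        rw [sub_add_cancel] at h3
        rw [h3]
        refine le_trans ?_ (le_max_right _ _)
        exact (ContinuousLinearMap.opNorm_comp_le _ _).trans
          (mul_le_mul (hC _ h1) (hK _ h2) (norm_nonneg _) hC0)
  obtain ⟨n, hn⟩ := exists_nat_gt (t / δ)
  obtain ⟨K, hK⟩ := key n
  exact ⟨K, fun s hs => hK s ⟨hs.1, hs.2.trans ((div_lt_iff₀ hδ).1 hn).le⟩⟩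

theorem tendsto_zero_Ici (x : X) : Tendsto (fun s => S s x) (𝓝[≥] 0) (𝓝 x) := by
  have h0 : S 0 x = x := by rw [hS.zero]; rfl
  have : ContinuousWithinAt (fun s => S s x) (Set.Ici 0) 0 := by
    rw [← continuousWithinAt_Ioi_iff_Ici, ContinuousWithinAt, h0]
    exact hS.tendsto_zero x
  rwa [ContinuousWithinAt, h0] at this

theorem continuousOn [CompleteSpace X] (t : ℝ) (x : X) :
    ContinuousOn (fun s => S s x) (Set.Icc 0 t) := by
  obtain ⟨C, hC⟩ := hS.exists_norm_le t
  -- $S(b)-S(a)=S(a)(S(b-a)-1)$ reduces continuity on both sides to continuity at $0$, by the local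
  -- bound.
  have key : ∀ a ∈ Set.Icc 0 t, ∀ b ∈ Set.Icc 0 t, a ≤ b → ‖S b x - S a x‖ ≤ C * ‖S |b - a| x - x‖ := by
    intro a ha b hb hab
    have h1 := hS.add a (b - a) ha.1 (sub_nonneg.2 hab)
    rw [add_sub_cancel] at h1
    rw [h1, abs_of_nonneg (sub_nonneg.2 hab), ContinuousLinearMap.comp_apply, ← map_sub]
    exact (ContinuousLinearMap.le_opNorm _ _).trans
      (mul_le_mul_of_nonneg_right (hC a ha) (norm_nonneg _))
  intro a ha
  rw [ContinuousWithinAt, tendsto_iff_norm_sub_tendsto_zero]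
  have h1 : Tendsto (fun b : ℝ => |b - a|) (𝓝[Set.Icc 0 t] a) (𝓝[≥] 0) := by
    refine tendsto_nhdsWithin_iff.2 ⟨?_, Eventually.of_forall fun b => abs_nonneg (b - a)⟩
    have : Continuous fun b : ℝ => |b - a| := by fun_prop
    simpa using (this.tendsto a).mono_left nhdsWithin_le_nhds
  have h2 : Tendsto (fun b : ℝ => C * ‖S |b - a| x - x‖) (𝓝[Set.Icc 0 t] a) (𝓝 0) := by
    have := (((hS.tendsto_zero_Ici x).comp h1).sub_const x).norm.const_mul C
    simpa using this
  refine squeeze_zero' (Eventually.of_forall fun _ => norm_nonneg _) ?_ h2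
  filter_upwards [self_mem_nhdsWithin] with b hb
  rcases le_total a b with hab | hab
  · exact key a ha b hb hab
  · rw [norm_sub_rev, abs_sub_comm]
    exact key b hb a ha hab

theorem hasDerivWithinAt {B : X →ₗ.[ℂ] X} (hB : IsGeneratorOf B S) {x y : X}
    (hxy : (x, y) ∈ B.graph) {s : ℝ} (hs : 0 ≤ s) :
    HasDerivWithinAt (fun s => S s x) (S s y) (Set.Ici s) s := by
  rw [hasDerivWithinAt_iff_tendsto_slope, Set.Ici_sdiff_left]
  have h1 := ((S s).continuous.tendsto y).comp ((hB x y).1 hxy)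
  have h2 : Tendsto (fun r : ℝ => r - s) (𝓝[>] s) (𝓝[>] 0) := by
    refine tendsto_nhdsWithin_iff.2 ⟨?_, ?_⟩
    · have : Continuous fun r : ℝ => r - s := by fun_prop
      simpa using (this.tendsto s).mono_left nhdsWithin_le_nhds
    · filter_upwards [self_mem_nhdsWithin] with r hr using sub_pos.2 (Set.mem_Ioi.1 hr)
  refine (h1.comp h2).congr' ?_
  filter_upwards [self_mem_nhdsWithin] with r hr
  have h3 := hS.add s (r - s) hs (sub_nonneg.2 (le_of_lt hr))
  rw [add_sub_cancel] at h3
  simp only [Function.comp_apply]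
  rw [slope_def_module, h3, map_smul, map_sub, ContinuousLinearMap.comp_apply, Complex.coe_smul]

theorem mem_graph {B : X →ₗ.[ℂ] X} (hB : IsGeneratorOf B S) {x y : X}
    (hxy : (x, y) ∈ B.graph) {s : ℝ} (hs : 0 ≤ s) : (S s x, S s y) ∈ B.graph := by
  rw [hB]
  refine (((S s).continuous.tendsto y).comp ((hB x y).1 hxy)).congr' ?_
  filter_upwards [self_mem_nhdsWithin] with r hr
  have h1 := hS.add s r hs (le_of_lt hr)
  have h2 := hS.add r s (le_of_lt hr) hs
  rw [add_comm, h1] at h2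
  have h3 := congrArg (fun T : X →L[ℂ] X => T x) h2
  simp only [ContinuousLinearMap.comp_apply] at h3
  simp only [Function.comp_apply]
  rw [map_smul, map_sub, h3]

end IsC0Semigroup

namespace IsSectorResolvent

variable {A : X →ₗ.[ℂ] X} {φ ψ M : ℝ} {R : ℂ → X →L[ℂ] X} (h : IsSectorResolvent A φ M R)
  (hφψ : φ < ψ) (hψ : ψ < Real.pi / 2) [CompleteSpace X]
include h hφψ hψ

/-- A `C₀`-semigroup generated by `-A` is given by the contour integral. -/
theorem eq_contourExp (hA : Dense (A.domain : Set X)) {S : ℝ → X →L[ℂ] X} (hS : IsC0Semigroup S)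
    (hB : IsGeneratorOf (-A) S) {t : ℝ} (ht : 0 < t) : S t = contourExp R ψ t := by
  have hJ := neg_one_mem_offSector h.mem_Ioo
  refine DFunLike.coe_injective (DenseRange.equalizer (h.dense_range hA) (S t).continuous
    (contourExp R ψ t).continuous (funext fun w => ?_))
  simp only [Function.comp_apply]
  set x := R (-1) w with hx
  have hxy : (x, w + x) ∈ (-A).graph := by
    rw [h.mem_graph_neg_iff, add_sub_cancel_right]
  have hcont := hS.continuousOn t x
  have hS0 : S 0 x = x := by rw [hS.zero]; rfl
  -- The right derivative of $s\mapsto e^{-(t-s)A}S(s)x$ vanishes. The interval stops at $t'<t$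
  -- because at $s=t$ the first factor converges only strongly.
  have key : ∀ t' ∈ Set.Ico 0 t, contourExp R ψ (t - t' : ℝ) (S t' x) = contourExp R ψ t x := by
    intro t' ht'
    have hd : ∀ s ∈ Set.Icc 0 t', HasDerivWithinAt
        (fun s : ℝ => contourExp R ψ (t - s : ℝ) (S s x)) 0 (Set.Ici s) s := by
      intro s hs
      have ha : 0 < t - s := by linarith [hs.2, ht'.2]
      obtain ⟨V', f1, f2, f3⟩ := h.exists_hasDerivAt_ofReal hφψ hψ ha
      have f4 : HasDerivAt (fun s : ℝ => contourExp R ψ (t - s : ℝ)) (-V') s := by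
        have := f1.scomp s ((hasDerivAt_id s).const_sub t)
        rw [neg_one_smul] at this
        exact this
      have f5 := hS.hasDerivWithinAt hB hxy hs.1
      have f6 := (h.mem_graph_neg_iff _ _).1 (hS.mem_graph hB hxy hs.1)
      refine (hasDerivWithinAt_apply f4.hasDerivWithinAt f5).congr_deriv ?_
      set v := S s x
      set y := S s (w + x)
      have f7 : V' * R (-1) = contourExp R ψ (t - s : ℝ) * (1 + R (-1)) := by
        rw [f3, f2, add_mul, mul_add, one_mul, mul_one, h.commute_contourExp hφψ hψ
          (ofReal_mem_sector (sub_pos.2 hφψ) ha) hJ]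
      have f8 := congrArg (fun T : X →L[ℂ] X => T (y - v)) f7
      simp only [mul_apply_eq_comp, add_apply, one_apply_eq_self, f6, sub_add_cancel] at f8
      rw [neg_apply, f8, neg_add_cancel]
    have hc : ContinuousOn (fun s : ℝ => contourExp R ψ (t - s : ℝ) (S s x)) (Set.Icc 0 t') := by
      intro s hs
      have ha : 0 < t - s := by linarith [hs.2, ht'.2]
      obtain ⟨V', f1, -⟩ := h.exists_hasDerivAt_ofReal hφψ hψ ha
      refine tendsto_apply_of_tendsto ?_
        ((hcont s ⟨hs.1, hs.2.trans ht'.2.le⟩).mono (Set.Icc_subset_Icc_right ht'.2.le))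
      have h2 : ContinuousAt (fun s : ℝ => t - s) s := by fun_prop
      exact (ContinuousAt.comp (f := fun s : ℝ => t - s) f1.continuousAt h2).continuousWithinAt
    have := constant_of_has_deriv_right_zero hc (fun s hs => hd s ⟨hs.1, hs.2.le⟩) t' ⟨ht'.1, le_rfl⟩
    simpa [hS0] using this
  have hlt : Tendsto (fun t' => S t' x) (𝓝[<] t) (𝓝 (S t x)) :=
    ((hcont t ⟨ht.le, le_rfl⟩).mono_left (nhdsWithin_le_of_mem
      (mem_of_superset (Ioo_mem_nhdsLT ht) Set.Ioo_subset_Icc_self)))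
  have hsub : Tendsto (fun t' : ℝ => t - t') (𝓝[<] t) (𝓝[>] 0) := by
    refine tendsto_nhdsWithin_iff.2 ⟨?_, ?_⟩
    · have : Continuous fun r : ℝ => t - r := by fun_prop
      simpa using (this.tendsto t).mono_left nhdsWithin_le_nhds
    · filter_upwards [self_mem_nhdsWithin] with r hr using sub_pos.2 (Set.mem_Iio.1 hr)
  have h1 : Tendsto (fun t' : ℝ => contourExp R ψ (t - t' : ℝ) (S t x)) (𝓝[<] t) (𝓝 (S t x)) :=
    (h.tendsto_contourExp_ofReal hφψ hψ hA (S t x)).comp hsub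
  -- To let $t'\uparrow t$, the vector $S(t')x$ is replaced by $S(t)x$ at a cost controlled by the
  -- uniform bound of `contourExp`.
  have h2 : Tendsto (fun t' : ℝ => contourExp R ψ (t - t' : ℝ) (S t' x - S t x)) (𝓝[<] t) (𝓝 0) := by
    rw [tendsto_zero_iff_norm_tendsto_zero]
    have e1 := ((hlt.sub_const (S t x)).norm).const_mul
      (‖(contourConst ψ)⁻¹‖ * ((∫ u, contourWeight ψ u) * (M / (1 - Real.cos ψ))))
    rw [sub_self, norm_zero, mul_zero] at e1
    refine squeeze_zero' (Eventually.of_forall fun _ => norm_nonneg _) ?_ e1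
    filter_upwards [self_mem_nhdsWithin] with r hr
    exact (ContinuousLinearMap.le_opNorm _ _).trans (mul_le_mul_of_nonneg_right
      (h.norm_contourExp_le hφψ hψ (ofReal_mem_sector (sub_pos.2 hφψ) (sub_pos.2 hr)))
      (norm_nonneg _))
  have h3 := h2.add h1
  rw [zero_add] at h3
  refine tendsto_nhds_unique h3 (tendsto_const_nhds.congr' ?_)
  filter_upwards [Ioo_mem_nhdsLT ht] with r hr
  rw [map_sub, sub_add_cancel, key r ⟨hr.1.le, hr.2⟩]

/-- The contour integral shows that a generated semigroup exists, so the choice in `semigroup` is a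
genuine one; uniqueness then identifies it. -/
theorem semigroup_eq (hA : Dense (A.domain : Set X)) {t : ℝ} (ht : 0 < t) :
    semigroup (-A) t = contourExp R ψ t :=
  have hs := semigroup_spec ⟨contourSemigroup R ψ, h.isC0Semigroup_contourSemigroup hφψ hψ hA,
    h.isGeneratorOf_contourSemigroup hφψ hψ hA⟩
  h.eq_contourExp hφψ hψ hA hs.1 hs.2 ht

theorem integrable_laplace {lam z : ℂ} (hz : z ∈ sector (ψ - φ)) (hre : (lam * z).re < 0) (x : X) :
    IntegrableOn (fun s : ℝ => Complex.exp (s * (lam * z)) • contourExp R ψ (s * z) x)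
      (Set.Ioi 0) := by
  set K := ‖(contourConst ψ)⁻¹‖ * ((∫ u, contourWeight ψ u) * (M / (1 - Real.cos ψ)))
  have h1 : IntegrableOn (fun s : ℝ => Real.exp ((lam * z).re * s)) (Set.Ioi 0) :=
    integrableOn_exp_mul_Ioi hre 0
  refine Integrable.mono' (h1.mul_const (K * ‖x‖)) ?_ ?_
  · refine ContinuousOn.aestronglyMeasurable (fun s hs => ?_) measurableSet_Ioi
    obtain ⟨U', e1, -⟩ := h.exists_hasDerivAt_contourExp' hφψ hψ (ofReal_mul_mem_sector hz hs)
    have e2 : ContinuousAt (fun s : ℝ => (s : ℂ) * z) s := by fun_prop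
    have e3 : ContinuousAt (fun s : ℝ => contourExp R ψ (s * z)) s :=
      ContinuousAt.comp (f := fun s : ℝ => (s : ℂ) * z) e1.continuousAt e2
    have e4 : ContinuousAt (fun s : ℝ => Complex.exp (s * (lam * z))) s := by fun_prop
    exact (e4.smul (tendsto_apply_of_tendsto e3 tendsto_const_nhds)).continuousWithinAt
  · refine (ae_restrict_iff' measurableSet_Ioi).2 (ae_of_all _ fun s hs => ?_)
    rw [norm_smul, Complex.norm_exp, Complex.re_ofReal_mul, mul_comm s]
    refine mul_le_mul_of_nonneg_left ?_ (Real.exp_pos _).le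
    exact (ContinuousLinearMap.le_opNorm _ _).trans (mul_le_mul_of_nonneg_right
      (h.norm_contourExp_le hφψ hψ (ofReal_mul_mem_sector hz hs)) (norm_nonneg _))

/-- The resolvent is the Laplace transform of the semigroup along a ray. -/
theorem integral_laplace (hA : Dense (A.domain : Set X)) {lam z : ℂ} (hl : lam ∈ offSector φ)
    (hz : z ∈ sector (ψ - φ)) (hre : (lam * z).re < 0) (x : X) :
    lam • R lam x = -(lam * z) • ∫ s in Set.Ioi (0 : ℝ),
      Complex.exp (s * (lam * z)) • contourExp R ψ (s * z) x := by
  have hJ := neg_one_mem_offSector h.mem_Ioo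
  have hint := h.integrable_laplace hφψ hψ hz hre x
  -- The primitive $e^{s\lambda z}R(\lambda)e^{-szA}x$ of $z$ times the integrand, extended by its
  -- limit $R(\lambda)x$ at $0$.
  set f : ℝ → X := fun s => if s ≤ 0 then R lam x else
    Complex.exp (s * (lam * z)) • R lam (contourExp R ψ (s * z) x) with hf
  have hfpos : ∀ s : ℝ, 0 < s → f s = Complex.exp (s * (lam * z)) • R lam (contourExp R ψ (s * z) x) :=
    fun s hs => if_neg hs.not_ge
  have hf0 : f 0 = R lam x := if_pos le_rfl
  have hd : ∀ s ∈ Set.Ioi (0 : ℝ), HasDerivAt f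
      (z • Complex.exp (s * (lam * z)) • contourExp R ψ (s * z) x) s := by
    intro s hs
    have hsz := ofReal_mul_mem_sector hz hs
    obtain ⟨U', e1, e2, -⟩ := h.exists_hasDerivAt_contourExp' hφψ hψ hsz
    have e3 : HasDerivAt (fun s : ℝ => (s : ℂ) * z) z s := by
      have := (Complex.ofRealCLM.hasDerivAt (x := s)).mul_const z
      rwa [Complex.ofRealCLM_apply, Complex.ofReal_one, one_mul] at this
    have e4 : HasDerivAt (fun s : ℝ => contourExp R ψ (s * z)) (z • U') s :=
      HasDerivAt.scomp (h := fun s : ℝ => (s : ℂ) * z) s e1 e3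
    have e5 : HasDerivAt (fun s : ℝ => R lam * contourExp R ψ (s * z)) (R lam * (z • U')) s :=
      e4.const_mul _
    have e6 := hasDerivAt_apply_const e5 x
    have e7 : HasDerivAt (fun s : ℝ => (s : ℂ) * (lam * z)) (lam * z) s := by
      have := (Complex.ofRealCLM.hasDerivAt (x := s)).mul_const (lam * z)
      rwa [Complex.ofRealCLM_apply, Complex.ofReal_one, one_mul] at this
    -- This is $-AR(\lambda)=1-\lambda R(\lambda)$ applied to $e^{-szA}$, verified after composition
    -- with the injective $R(-1)$.
    have e8 : R lam * U' = contourExp R ψ (s * z) - lam • (R lam * contourExp R ψ (s * z)) := by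
      have e9 : R (-1) * (R lam * U') =
          R (-1) * (contourExp R ψ (s * z) - lam • (R lam * contourExp R ψ (s * z))) := by
        have e10 := h.resolvent_identity hJ hl
        rw [sub_neg_eq_add, add_smul, one_smul] at e10
        have e11 : R lam + R lam * R (-1) = R (-1) - lam • (R (-1) * R lam) := by
          rw [h.commute hl hJ, eq_sub_iff_add_eq, add_assoc, add_comm (R (-1) * R lam), ← e10,
            add_sub_cancel]
        rw [← mul_assoc, h.commute hJ hl, mul_assoc, e2, ← mul_assoc, mul_add, mul_one, e11,
          mul_sub, sub_mul, mul_smul_comm, smul_mul_assoc, mul_assoc]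
      ext v
      apply h.injective hJ
      simpa using congrArg (fun T : X →L[ℂ] X => T v) e9
    have e12 := e7.cexp.fun_smul e6
    have e13 : HasDerivAt f (Complex.exp (s * (lam * z)) • (R lam * z • U') x +
        (Complex.exp (s * (lam * z)) * (lam * z)) • (R lam * contourExp R ψ (s * z)) x) s := by
      refine e12.congr_of_eventuallyEq ?_
      filter_upwards [lt_mem_nhds hs] with r hr using hfpos r hr
    refine e13.congr_deriv ?_
    rw [mul_smul_comm, e8]
    simp only [smul_apply, sub_apply, mul_apply_eq_comp]
    module
  have hc : ContinuousWithinAt f (Set.Ici 0) 0 := by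
    rw [← continuousWithinAt_Ioi_iff_Ici, ContinuousWithinAt, hf0]
    have e1 := ((R lam).continuous.tendsto x).comp
      (h.tendsto_contourExp_ofReal_mul hφψ hψ hA hz x)
    have e2 : Tendsto (fun s : ℝ => Complex.exp (s * (lam * z))) (𝓝[>] 0) (𝓝 1) := by
      have : Continuous fun s : ℝ => Complex.exp (s * (lam * z)) := by fun_prop
      simpa using (this.tendsto 0).mono_left nhdsWithin_le_nhds
    have e3 := e2.smul e1
    rw [one_smul] at e3
    refine e3.congr' ?_
    filter_upwards [self_mem_nhdsWithin] with s hs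
    exact (hfpos s hs).symm
  have hlim : Tendsto f atTop (𝓝 0) := by
    set K := ‖(contourConst ψ)⁻¹‖ * ((∫ u, contourWeight ψ u) * (M / (1 - Real.cos ψ)))
    rw [tendsto_zero_iff_norm_tendsto_zero]
    have e1 : Tendsto (fun s : ℝ => Real.exp ((lam * z).re * s) * (‖R lam‖ * (K * ‖x‖))) atTop
        (𝓝 0) := by
      have := (Real.tendsto_exp_atBot.comp
        (tendsto_id.const_mul_atTop_of_neg hre)).mul_const (‖R lam‖ * (K * ‖x‖))
      rwa [zero_mul] at this
    refine squeeze_zero' (Eventually.of_forall fun _ => norm_nonneg _) ?_ e1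
    filter_upwards [eventually_gt_atTop 0] with s hs
    rw [hfpos s hs, norm_smul, Complex.norm_exp, Complex.re_ofReal_mul, mul_comm s]
    refine mul_le_mul_of_nonneg_left ?_ (Real.exp_pos _).le
    refine (ContinuousLinearMap.le_opNorm _ _).trans (mul_le_mul_of_nonneg_left ?_ (norm_nonneg _))
    exact (ContinuousLinearMap.le_opNorm _ _).trans (mul_le_mul_of_nonneg_right
      (h.norm_contourExp_le hφψ hψ (ofReal_mul_mem_sector hz hs)) (norm_nonneg _))
  have := integral_Ioi_of_hasDerivAt_of_tendsto hc hd (hint.smul z) hlim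
  rw [hf0, zero_sub, integral_smul] at this
  rw [neg_smul, mul_smul, this, smul_neg, neg_neg]

end IsSectorResolvent

end Uniqueness

end RBdd

namespace RBdd

/-! ### Finite-dimensional `ℓ^q` norms -/

section FiniteDimensional

variable {n : ℕ}

theorem norm_toLp_eq_sum {q : ℝ≥0∞} (hq1 : 1 ≤ q) (hq : q ≠ ∞) (v : Fin n → ℂ) :
    ‖WithLp.toLp q v‖ = (∑ k, ‖v k‖ ^ q.toReal) ^ (1 / q.toReal) :=
  PiLp.norm_eq_sum (ENNReal.toReal_pos (zero_lt_one.trans_le hq1).ne' hq) _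

theorem norm_toLp_rpow {q : ℝ≥0∞} (hq1 : 1 ≤ q) (hq : q ≠ ∞) (v : Fin n → ℂ) :
    ‖WithLp.toLp q v‖ ^ q.toReal = ∑ k, ‖v k‖ ^ q.toReal := by
  have h0 : q.toReal ≠ 0 := (ENNReal.toReal_pos (zero_lt_one.trans_le hq1).ne' hq).ne'
  rw [norm_toLp_eq_sum hq1 hq, ← Real.rpow_mul (by positivity), one_div_mul_cancel h0,
    Real.rpow_one]

theorem norm_apply_le_norm_toLp {q : ℝ≥0∞} (hq : 1 ≤ q) (v : Fin n → ℂ) (k : Fin n) :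
    ‖v k‖ ≤ ‖WithLp.toLp q v‖ := by
  have : Fact (1 ≤ q) := ⟨hq⟩
  exact PiLp.norm_apply_le (WithLp.toLp q v) k

theorem norm_toLp_nonneg {q : ℝ≥0∞} (hq : 1 ≤ q) (v : Fin n → ℂ) : 0 ≤ ‖WithLp.toLp q v‖ := by
  have : Fact (1 ≤ q) := ⟨hq⟩
  exact norm_nonneg (WithLp.toLp q v)

theorem norm_toLp_le_of_top {q : ℝ≥0∞} (hq : q = ∞) {v : Fin n → ℂ} {C : ℝ} (hC : 0 ≤ C)
    (h : ∀ k, ‖v k‖ ≤ C) : ‖WithLp.toLp q v‖ ≤ C := by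
  subst hq
  rw [PiLp.norm_eq_ciSup]
  exact Real.iSup_le h hC

theorem norm_toLp_mono {q : ℝ≥0∞} (hq : 1 ≤ q) {v w : Fin n → ℂ} (h : ∀ k, ‖v k‖ ≤ ‖w k‖) :
    ‖WithLp.toLp q v‖ ≤ ‖WithLp.toLp q w‖ := by
  by_cases hq' : q = ∞
  · exact norm_toLp_le_of_top hq' (norm_toLp_nonneg hq w)
      fun k => (h k).trans (norm_apply_le_norm_toLp hq w k)
  · rw [norm_toLp_eq_sum hq hq', norm_toLp_eq_sum hq hq']
    gcongr with k
    exact h k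

theorem norm_sum_mul_le_of_one_top {v w : Fin n → ℂ} :
    ‖∑ k, v k * w k‖ ≤ ‖WithLp.toLp 1 v‖ * ‖WithLp.toLp ∞ w‖ := by
  rw [norm_toLp_eq_sum le_rfl ENNReal.one_ne_top]
  simp only [ENNReal.toReal_one, Real.rpow_one, div_one]
  rw [Finset.sum_mul]
  refine (norm_sum_le _ _).trans (Finset.sum_le_sum fun k _ => ?_)
  rw [norm_mul]
  gcongr
  exact norm_apply_le_norm_toLp le_top w k

theorem norm_sum_mul_le {q q' : ℝ≥0∞} [hqq : q.HolderConjugate q'] (v w : Fin n → ℂ) :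
    ‖∑ k, v k * w k‖ ≤ ‖WithLp.toLp q v‖ * ‖WithLp.toLp q' w‖ := by
  have hq1 : 1 ≤ q := ENNReal.HolderConjugate.one_le q q'
  have hq1' : 1 ≤ q' := ENNReal.HolderConjugate.one_le q' q
  have hinv := ENNReal.holderConjugate_iff.1 hqq
  by_cases hq : q = ∞
  · subst hq
    have : q' = 1 := by simpa using hinv
    subst this
    simp only [mul_comm (v _)]
    rw [mul_comm]
    exact norm_sum_mul_le_of_one_top
  by_cases hq' : q' = ∞
  · subst hq'
    have : q = 1 := by simpa using hinv
    subst this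
    exact norm_sum_mul_le_of_one_top
  have h := ENNReal.HolderConjugate.toReal_of_ne_top hq hq'
  rw [norm_toLp_eq_sum hq1 hq, norm_toLp_eq_sum hq1' hq']
  refine (norm_sum_le _ _).trans ?_
  simp only [norm_mul]
  exact Real.inner_le_Lp_mul_Lq_of_nonneg _ h (fun _ _ => norm_nonneg _) fun _ _ => norm_nonneg _

/-- The analytic family `‖v‖ (|v_k| / ‖v‖)^γ sgn v_k`, with the norm of `ℓ^s`. -/
noncomputable def powerMap (s : ℝ≥0∞) (γ : ℂ) (v : Fin n → ℂ) (k : Fin n) : ℂ :=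
  if v k = 0 then 0 else
    ‖WithLp.toLp s v‖ * ((‖v k‖ / ‖WithLp.toLp s v‖ : ℝ) : ℂ) ^ γ * (v k / ‖v k‖)

theorem powerMap_zero (s : ℝ≥0∞) (γ : ℂ) : powerMap s γ (0 : Fin n → ℂ) = 0 := by
  ext k; simp [powerMap]

theorem norm_toLp_pos {s : ℝ≥0∞} (hs : 1 ≤ s) {v : Fin n → ℂ} {k : Fin n} (hk : v k ≠ 0) :
    0 < ‖WithLp.toLp s v‖ :=
  (norm_pos_iff.2 hk).trans_le (norm_apply_le_norm_toLp hs v k)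

theorem powerMap_one {s : ℝ≥0∞} (hs : 1 ≤ s) (v : Fin n → ℂ) : powerMap s 1 v = v := by
  ext k
  rw [powerMap]
  split_ifs with hk
  · exact hk.symm
  · have h1 : (‖WithLp.toLp s v‖ : ℂ) ≠ 0 := by exact_mod_cast (norm_toLp_pos hs hk).ne'
    have h2 : (‖v k‖ : ℂ) ≠ 0 := by exact_mod_cast norm_ne_zero_iff.2 hk
    rw [Complex.cpow_one]
    push_cast
    field_simp

theorem differentiable_powerMap {s : ℝ≥0∞} (hs : 1 ≤ s) (v : Fin n → ℂ) (k : Fin n) :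
    Differentiable ℂ fun γ => powerMap s γ v k := by
  unfold powerMap
  split_ifs with hk
  · exact differentiable_const _
  · have h1 : ((‖v k‖ / ‖WithLp.toLp s v‖ : ℝ) : ℂ) ≠ 0 := by
      exact_mod_cast (div_pos (norm_pos_iff.2 hk) (norm_toLp_pos hs hk)).ne'
    exact ((differentiable_id.const_cpow (Or.inl h1)).const_mul _).mul_const _

theorem norm_powerMap {s : ℝ≥0∞} (hs : 1 ≤ s) (γ : ℂ) {v : Fin n → ℂ} {k : Fin n} (hk : v k ≠ 0) :
    ‖powerMap s γ v k‖ =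
      ‖WithLp.toLp s v‖ * (‖v k‖ / ‖WithLp.toLp s v‖) ^ γ.re := by
  have h1 := norm_toLp_pos hs hk
  have h2 := norm_pos_iff.2 hk
  rw [powerMap, if_neg hk, norm_mul, norm_mul, norm_div, Complex.norm_real, Complex.norm_real,
    norm_norm, div_self h2.ne', mul_one, Complex.norm_cpow_eq_rpow_re_of_pos (div_pos h2 h1),
    Real.norm_of_nonneg h1.le]

theorem norm_powerMap_le {s : ℝ≥0∞} (hs : 1 ≤ s) {γ : ℂ} (hγ : 0 ≤ γ.re) (v : Fin n → ℂ)
    (k : Fin n) : ‖powerMap s γ v k‖ ≤ ‖WithLp.toLp s v‖ := by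
  by_cases hk : v k = 0
  · rw [powerMap, if_pos hk, norm_zero]
    exact norm_toLp_nonneg hs v
  · have h1 := norm_toLp_pos hs hk
    rw [norm_powerMap hs γ hk]
    refine mul_le_of_le_one_right h1.le (Real.rpow_le_one (by positivity) ?_ hγ)
    exact (div_le_one h1).2 (norm_apply_le_norm_toLp hs v k)

/-- With $\operatorname{Re}\gamma=s/q$ the $q$-th powers of the moduli are $\|v\|^{q-s}|v_k|^s$,
which sum to $\|v\|^q$. For $q=\infty$ the real part is $0$ and each modulus is at most $\|v\|$. -/
theorem norm_toLp_powerMap_le {s q : ℝ≥0∞} (hs : 1 ≤ s) (hs' : s ≠ ∞) (hq : 1 ≤ q) {γ : ℂ}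
    (hγ : γ.re = s.toReal * (q⁻¹).toReal) (v : Fin n → ℂ) :
    ‖WithLp.toLp q (powerMap s γ v)‖ ≤ ‖WithLp.toLp s v‖ := by
  have hγ0 : 0 ≤ γ.re := by rw [hγ]; positivity
  have hN := norm_toLp_nonneg hs v
  by_cases hq' : q = ∞
  · exact norm_toLp_le_of_top hq' hN fun k => norm_powerMap_le hs hγ0 v k
  have hq0 : 0 < q.toReal := ENNReal.toReal_pos (zero_lt_one.trans_le hq).ne' hq'
  rw [← Real.rpow_le_rpow_iff (norm_toLp_nonneg hq _) hN hq0, norm_toLp_rpow hq hq']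
  rcases hN.eq_or_lt with h0 | hpos
  · have hv : ∀ k, v k = 0 := fun k => norm_le_zero_iff.1
      ((norm_apply_le_norm_toLp hs v k).trans h0.symm.le)
    simp [powerMap, hv, hq0.ne', Real.rpow_nonneg hN]
  · have h1 : ∀ k, ‖powerMap s γ v k‖ ^ q.toReal =
        ‖WithLp.toLp s v‖ ^ q.toReal * (‖v k‖ ^ s.toReal / ‖WithLp.toLp s v‖ ^ s.toReal) := by
      intro k
      by_cases hk : v k = 0
      · have hs0 : s.toReal ≠ 0 := (ENNReal.toReal_pos (zero_lt_one.trans_le hs).ne' hs').ne'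
        rw [powerMap, if_pos hk, hk, norm_zero, Real.zero_rpow hq0.ne', Real.zero_rpow hs0,
          zero_div, mul_zero]
      · rw [norm_powerMap hs γ hk, Real.mul_rpow hpos.le (by positivity), ← Real.rpow_mul
          (by positivity), hγ, ENNReal.toReal_inv, mul_assoc, inv_mul_cancel₀ hq0.ne', mul_one,
          Real.div_rpow (norm_nonneg _) hpos.le]
    simp only [h1]
    rw [← Finset.mul_sum, ← Finset.sum_div, ← norm_toLp_rpow hs hs', div_self, mul_one]
    exact (Real.rpow_pos_of_pos hpos _).ne'

/-- The vector in `ℓ^{r'}` that norms `v` in `ℓ^r`, scaled to have norm `‖v‖ ^ (p - 1)`. -/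
noncomputable def normingMap (r : ℝ≥0∞) (p : ℝ) (v : Fin n → ℂ) (k : Fin n) : ℂ :=
  if v k = 0 then 0 else
    (‖WithLp.toLp r v‖ ^ (p - r.toReal) * ‖v k‖ ^ (r.toReal - 1) : ℝ) * (star (v k) / ‖v k‖)

theorem normingMap_zero (r : ℝ≥0∞) (p : ℝ) : normingMap r p (0 : Fin n → ℂ) = 0 := by
  ext k; simp [normingMap]

theorem sum_mul_normingMap {r : ℝ≥0∞} (hr1 : 1 ≤ r) (hr : r ≠ ∞) {p : ℝ} (hp : 0 < p)
    (v : Fin n → ℂ) : ∑ k, v k * normingMap r p v k = (‖WithLp.toLp r v‖ ^ p : ℝ) := by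
  have hr0 : 0 < r.toReal := ENNReal.toReal_pos (zero_lt_one.trans_le hr1).ne' hr
  rcases (norm_toLp_nonneg hr1 v).eq_or_lt with h0 | hpos
  · have hv : ∀ k, v k = 0 := fun k => norm_le_zero_iff.1
      ((norm_apply_le_norm_toLp hr1 v k).trans h0.symm.le)
    rw [← h0, Real.zero_rpow hp.ne']
    simp [hv]
  have h1 : ∀ k, v k * normingMap r p v k =
      (‖WithLp.toLp r v‖ ^ (p - r.toReal) * ‖v k‖ ^ r.toReal : ℝ) := by
    intro k
    by_cases hk : v k = 0
    · rw [hk, norm_zero, Real.zero_rpow hr0.ne']; simp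
    · have h2 := norm_pos_iff.2 hk
      have h3 : v k * star (v k) = ((‖v k‖ ^ 2 : ℝ) : ℂ) := by
        rw [Complex.star_def, Complex.mul_conj, Complex.normSq_eq_norm_sq]
      have h4 : ‖v k‖ ^ r.toReal = ‖v k‖ ^ (r.toReal - 1) * ‖v k‖ := by
        rw [← Real.rpow_add_one h2.ne', sub_add_cancel]
      rw [normingMap, if_neg hk, mul_left_comm, mul_div_assoc', h3, h4]
      have h5 : (‖v k‖ : ℂ) ≠ 0 := by exact_mod_cast h2.ne'
      push_cast
      field_simp
  simp only [h1]
  rw [← Complex.ofReal_sum, ← Finset.mul_sum, ← norm_toLp_rpow hr1 hr, ← Real.rpow_add hpos,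
    sub_add_cancel]

/-- By $(r-1)r'=r$ the $r'$-th powers of the moduli add up to $\|v\|^{(p-r)r'+r}$. The scaling makes
the pairing with $v$ equal to $\|v\|^p$, so both the inner and the outer Hölder inequality are
attained. -/
theorem norm_toLp_normingMap {r r' : ℝ≥0∞} [hrr : r.HolderConjugate r'] (hr1 : 1 < r) (hr : r ≠ ∞)
    {p : ℝ} (hp : 1 < p) (v : Fin n → ℂ) :
    ‖WithLp.toLp r' (normingMap r p v)‖ = ‖WithLp.toLp r v‖ ^ (p - 1) := by
  have hr1' : 1 ≤ r' := ENNReal.HolderConjugate.one_le r' r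
  have hr' : r' ≠ ∞ := by
    rintro rfl
    have := ENNReal.holderConjugate_iff.1 hrr
    simp only [ENNReal.inv_top, add_zero, ENNReal.inv_eq_one] at this
    exact hr1.ne' this
  have h := ENNReal.HolderConjugate.toReal_of_ne_top hr hr'
  have hr0' := h.symm.pos
  rw [norm_toLp_eq_sum hr1' hr']
  have hN := norm_toLp_nonneg hr1.le v
  rcases hN.eq_or_lt with h0 | hpos
  · have hv : ∀ k, v k = 0 := fun k => norm_le_zero_iff.1
      ((norm_apply_le_norm_toLp hr1.le v k).trans h0.symm.le)
    rw [← h0, Real.zero_rpow (by linarith)]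
    simp [normingMap, hv, hr0'.ne', Real.zero_rpow]
  have h1 : ∀ k, ‖normingMap r p v k‖ ^ r'.toReal =
      ‖WithLp.toLp r v‖ ^ ((p - r.toReal) * r'.toReal) * ‖v k‖ ^ r.toReal := by
    intro k
    by_cases hk : v k = 0
    · rw [normingMap, if_pos hk, hk, norm_zero, Real.zero_rpow hr0'.ne', Real.zero_rpow h.pos.ne',
        mul_zero]
    · have h2 := norm_pos_iff.2 hk
      rw [normingMap, if_neg hk, norm_mul, norm_div, norm_star, Complex.norm_real,
        Complex.norm_real, norm_norm, div_self h2.ne', mul_one,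
        Real.norm_of_nonneg (by positivity), Real.mul_rpow (by positivity) (by positivity),
        ← Real.rpow_mul hN, ← Real.rpow_mul h2.le, h.sub_one_mul_conj]
  simp only [h1]
  rw [← Finset.mul_sum, ← norm_toLp_rpow hr1.le hr, ← Real.rpow_add hpos, ← Real.rpow_mul hN]
  congr 1
  have h3 := h.sub_one_mul_conj
  field_simp
  linarith

end FiniteDimensional

end RBdd

namespace RBdd

/-! ### The spaces `L^p(ℓ^q)` -/

section VecLp

variable {Ω : Type*} [MeasurableSpace Ω] {μ : Measure Ω} {p p' q q' r r' : ℝ≥0∞}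
  [Fact (1 ≤ p)] [Fact (1 ≤ p')] {n : ℕ}

omit [Fact (1 ≤ p)] in
theorem coeFn_finsetSum {ι E : Type*} [NormedAddCommGroup E] (s : Finset ι) (f : ι → Lp E p μ) :
    ⇑(∑ i ∈ s, f i) =ᵐ[μ] fun x => ∑ i ∈ s, f i x := by
  classical
  induction s using Finset.induction_on with
  | empty =>
    simp only [Finset.sum_empty]
    filter_upwards [Lp.coeFn_zero E p μ] with x hx using hx
  | insert a s ha ih =>
    simp only [Finset.sum_insert ha]
    filter_upwards [Lp.coeFn_add (f a) (∑ i ∈ s, f i), ih] with x h1 h2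
    rw [h1, Pi.add_apply, h2]

/-- The inclusion of the `k`-th coordinate in `ℓ^q`. -/
noncomputable def singleCLM (q : ℝ≥0∞) [Fact (1 ≤ q)] (k : Fin n) :
    ℂ →L[ℂ] PiLp q fun _ : Fin n => ℂ :=
  (PiLp.continuousLinearEquiv q ℂ fun _ : Fin n => ℂ).symm.toContinuousLinearMap ∘L
    ContinuousLinearMap.single ℂ (fun _ : Fin n => ℂ) k

/-- The element of `L^p(ℓ^q)` with given components. -/
noncomputable def vecLp (q : ℝ≥0∞) [Fact (1 ≤ q)] :
    (Fin n → Lp ℂ p μ) →L[ℂ] Lp (PiLp q fun _ : Fin n => ℂ) p μ :=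
  ∑ k, ((singleCLM q k).compLpL p μ) ∘L
    ContinuousLinearMap.proj (R := ℂ) (φ := fun _ : Fin n => Lp ℂ p μ) k

theorem coeFn_vecLp [Fact (1 ≤ q)] (f : Fin n → Lp ℂ p μ) :
    vecLp q f =ᵐ[μ] fun x => WithLp.toLp q fun k => f k x := by
  classical
  have h1 : ∀ k : Fin n, ∀ᵐ x ∂μ, (singleCLM q k).compLpL p μ (f k) x =
      WithLp.toLp q (Pi.single k (f k x)) := fun k => by
    filter_upwards [ContinuousLinearMap.coeFn_compLpL (p := p) (singleCLM q k) (f k)] with x hx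
    rw [hx]; rfl
  filter_upwards [coeFn_finsetSum Finset.univ fun k => (singleCLM q k).compLpL p μ (f k),
    ae_all_iff.2 h1] with x hx hx1
  rw [vecLp, sum_apply]
  simp only [ContinuousLinearMap.comp_apply, ContinuousLinearMap.proj_apply]
  rw [hx]
  simp only [hx1]
  refine PiLp.ext fun i => ?_
  simp [Pi.single_apply]

theorem enorm_vecLp [Fact (1 ≤ q)] (f : Fin n → Lp ℂ p μ) :
    ‖vecLp q f‖ₑ = eLpNorm (fun x => ‖WithLp.toLp q fun k => f k x‖) p μ := by
  rw [Lp.enorm_def, eLpNorm_congr_ae (coeFn_vecLp f)]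
  exact (eLpNorm_norm _).symm

theorem rqBounded_iff [Fact (1 ≤ q)] (𝒯 : Set (Lp ℂ p μ →L[ℂ] Lp ℂ p μ)) :
    RqBounded q 𝒯 ↔ ∃ C : ℝ≥0, ∀ (n : ℕ) (T : Fin n → Lp ℂ p μ →L[ℂ] Lp ℂ p μ)
      (f : Fin n → Lp ℂ p μ), (∀ k, T k ∈ 𝒯) →
        ‖vecLp q fun k => T k (f k)‖ ≤ C * ‖vecLp q f‖ := by
  unfold RqBounded
  simp only [← enorm_vecLp]
  refine exists_congr fun C => forall₃_congr fun n T f => imp_congr_right fun _ => ?_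
  rw [enorm_eq_nnnorm, enorm_eq_nnnorm, ← ENNReal.coe_mul, ENNReal.coe_le_coe, ← NNReal.coe_le_coe]
  simp

theorem norm_vecLp_le_of_ae [Fact (1 ≤ q)] [Fact (1 ≤ r)] {f g : Fin n → Lp ℂ p μ}
    (h : ∀ᵐ x ∂μ, ‖WithLp.toLp q fun k => f k x‖ ≤ ‖WithLp.toLp r fun k => g k x‖) :
    ‖vecLp q f‖ ≤ ‖vecLp r g‖ := by
  rw [← enorm_le_iff_norm_le, enorm_vecLp, enorm_vecLp]
  refine eLpNorm_mono_ae ?_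
  filter_upwards [h] with x hx
  rwa [Real.norm_of_nonneg (norm_nonneg _), Real.norm_of_nonneg (norm_nonneg _)]

open Classical in
/-- The indicator function of a measurable set of finite measure in `L^p` (and `0` for other
sets). -/
noncomputable def indLp (p : ℝ≥0∞) (μ : Measure Ω) (s : Set Ω) : Lp ℂ p μ :=
  if h : MeasurableSet s ∧ μ s ≠ ∞ then indicatorConstLp p h.1 h.2 1 else 0

open Classical in
/-- The element `φ ∘ G` of `L^p`, for a simple function `G`. -/
noncomputable def stepLp (p : ℝ≥0∞) (μ : Measure Ω) (φ : (Fin n → ℂ) → ℂ)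
    (G : SimpleFunc Ω (Fin n → ℂ)) : Lp ℂ p μ :=
  ∑ v ∈ G.range.filter (· ≠ 0), φ v • indLp p μ (G ⁻¹' {v})

omit [Fact (1 ≤ p)] in
theorem coeFn_indLp {s : Set Ω} (hs : MeasurableSet s) (hμ : μ s ≠ ∞) :
    indLp p μ s =ᵐ[μ] s.indicator fun _ => (1 : ℂ) := by
  rw [indLp, dif_pos ⟨hs, hμ⟩]
  exact indicatorConstLp_coeFn

omit [Fact (1 ≤ p)] in
-- The fibre over $0$ may have infinite measure and is left out of `stepLp`; the condition
-- $\varphi(0)=0$ accounts for it.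
theorem coeFn_stepLp {φ : (Fin n → ℂ) → ℂ} (hφ : φ 0 = 0) {G : SimpleFunc Ω (Fin n → ℂ)}
    (hG : G.FinMeasSupp μ) : stepLp p μ φ G =ᵐ[μ] fun x => φ (G x) := by
  classical
  have h1 : ∀ v : Fin n → ℂ, ∀ᵐ x ∂μ, v ∈ G.range.filter (· ≠ 0) →
      (φ v • indLp p μ (G ⁻¹' {v})) x = if G x = v then φ v else 0 := by
    intro v
    by_cases hv : v ∈ G.range.filter (· ≠ 0)
    · have hv0 : v ≠ 0 := (Finset.mem_filter.1 hv).2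
      filter_upwards [Lp.coeFn_smul (φ v) (indLp p μ (G ⁻¹' {v})), coeFn_indLp (p := p)
        (G.measurableSet_fiber v) (SimpleFunc.finMeasSupp_iff.1 hG v hv0).ne] with x hx hx' _
      rw [hx, Pi.smul_apply, hx']
      by_cases hGx : G x = v
      · rw [Set.indicator_of_mem (by simpa using hGx), if_pos hGx, smul_eq_mul, mul_one]
      · rw [Set.indicator_of_notMem (by simpa using hGx), if_neg hGx, smul_zero]
    · exact ae_of_all _ fun x h => absurd h hv
  have h2 : ∀ᵐ x ∂μ, ∀ v ∈ G.range.filter (· ≠ 0),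
      (φ v • indLp p μ (G ⁻¹' {v})) x = if G x = v then φ v else 0 := by
    rw [Finset.eventually_all]
    intro v hv
    filter_upwards [h1 v] with x hx using hx hv
  filter_upwards [coeFn_finsetSum (G.range.filter (· ≠ 0))
    fun v => φ v • indLp p μ (G ⁻¹' {v}), h2] with x hx hx2
  rw [stepLp, hx, Finset.sum_congr rfl hx2]
  by_cases h0 : G x = 0
  · rw [h0, hφ]
    refine Finset.sum_eq_zero fun v hv => if_neg fun h => ?_
    exact (Finset.mem_filter.1 hv).2 h.symm
  · rw [Finset.sum_ite_eq, if_pos]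
    exact Finset.mem_filter.2 ⟨SimpleFunc.mem_range_self G x, h0⟩

/-- The tuple of the components of `Φ ∘ G` in `L^p`, for a simple function `G`. -/
noncomputable def stepTuple (p : ℝ≥0∞) (μ : Measure Ω) (Φ : (Fin n → ℂ) → Fin n → ℂ)
    (G : SimpleFunc Ω (Fin n → ℂ)) : Fin n → Lp ℂ p μ :=
  fun k => stepLp p μ (fun v => Φ v k) G

omit [Fact (1 ≤ p)] in
theorem coeFn_stepTuple {Φ : (Fin n → ℂ) → Fin n → ℂ} (hΦ : Φ 0 = 0)
    {G : SimpleFunc Ω (Fin n → ℂ)} (hG : G.FinMeasSupp μ) :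
    ∀ᵐ x ∂μ, (fun k => stepTuple p μ Φ G k x) = Φ (G x) := by
  have h : ∀ k, ∀ᵐ x ∂μ, stepTuple p μ Φ G k x = Φ (G x) k := fun k =>
    coeFn_stepLp (φ := fun v => Φ v k) (by rw [hΦ]; rfl) hG
  filter_upwards [ae_all_iff.2 h] with x hx
  exact funext hx

theorem norm_vecLp_stepTuple_le [Fact (1 ≤ q)] [Fact (1 ≤ r)] {Φ Ψ : (Fin n → ℂ) → Fin n → ℂ}
    (hΦ : Φ 0 = 0) (hΨ : Ψ 0 = 0) {G : SimpleFunc Ω (Fin n → ℂ)} (hG : G.FinMeasSupp μ)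
    (h : ∀ v, ‖WithLp.toLp q (Φ v)‖ ≤ ‖WithLp.toLp r (Ψ v)‖) :
    ‖vecLp q (stepTuple p μ Φ G)‖ ≤ ‖vecLp r (stepTuple p μ Ψ G)‖ := by
  refine norm_vecLp_le_of_ae ?_
  filter_upwards [coeFn_stepTuple (p := p) hΦ hG, coeFn_stepTuple (p := p) hΨ hG] with x h1 h2
  rw [h1, h2]
  exact h _

omit [Fact (1 ≤ p)] in
theorem stepTuple_map {Φ : (Fin n → ℂ) → Fin n → ℂ} (hΦ : Φ 0 = 0)
    {G : SimpleFunc Ω (Fin n → ℂ)} (hG : G.FinMeasSupp μ) :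
    stepTuple p μ id (G.map Φ) = stepTuple p μ Φ G := by
  funext k
  refine Lp.ext ?_
  filter_upwards [coeFn_stepTuple (p := p) (Φ := id) rfl (hG.map hΦ),
    coeFn_stepTuple (p := p) hΦ hG] with x h1 h2
  have h3 := congrFun h1 k
  have h4 := congrFun h2 k
  simp only [id, SimpleFunc.map_apply] at h3 h4
  rw [h3, h4]

/-- The components are approximated jointly, by one simple function with values in $\mathbb C^n$, so
that maps mixing the coordinates, such as `powerMap` and `normingMap`, can be applied value by
value. -/
theorem exists_stepTuple_near (hp : p ≠ ∞) (f : Fin n → Lp ℂ p μ) {ε : ℝ} (hε : 0 < ε) :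
    ∃ G : SimpleFunc Ω (Fin n → ℂ), G.FinMeasSupp μ ∧ ‖f - stepTuple p μ id G‖ < ε := by
  have hp0 : p ≠ 0 := (zero_lt_one.trans_le (Fact.out : 1 ≤ p)).ne'
  have hF : MemLp (fun x => fun k => f k x) p μ := memLp_pi_iff.2 fun k => Lp.memLp (f k)
  obtain ⟨G, hG, hGm⟩ := hF.exists_simpleFunc_eLpNorm_sub_lt hp
    (ε := ENNReal.ofReal ε) (by simpa using hε)
  have hfin := (SimpleFunc.memLp_iff_finMeasSupp hp0 hp).1 hGm
  refine ⟨G, hfin, (pi_norm_lt_iff hε).2 fun k => ?_⟩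
  rw [← ENNReal.ofReal_lt_ofReal_iff hε, ofReal_norm, Lp.enorm_def]
  refine lt_of_le_of_lt (eLpNorm_mono_ae ?_) hG
  filter_upwards [Lp.coeFn_sub (f k) (stepTuple p μ id G k),
    coeFn_stepTuple (p := p) (Φ := id) rfl hfin] with x h1 h2
  rw [Pi.sub_apply, h1, Pi.sub_apply, congrFun h2 k]
  exact norm_le_pi_norm (((fun x => fun k => f k x) - ⇑G) x) k

/-- The duality pairing `∑ ∫ f_k g_k` between tuples in `L^p` and `L^{p'}`. -/
noncomputable def pairLp [p.HolderConjugate p'] (f : Fin n → Lp ℂ p μ) (g : Fin n → Lp ℂ p' μ) :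
    ℂ :=
  ∑ k, (ContinuousLinearMap.mul ℂ ℂ).lpPairing μ p p' (f k) (g k)

theorem pairLp_eq_integral [p.HolderConjugate p'] (f : Fin n → Lp ℂ p μ)
    (g : Fin n → Lp ℂ p' μ) : pairLp f g = ∫ x, ∑ k, f k x * g k x ∂μ := by
  simp only [pairLp, ContinuousLinearMap.lpPairing_eq_integral, ContinuousLinearMap.mul_apply']
  rw [integral_finsetSum]
  exact fun k _ => (Lp.memLp (f k)).integrable_mul (Lp.memLp (g k))

theorem pairLp_sub_left [p.HolderConjugate p'] (f f' : Fin n → Lp ℂ p μ) (g : Fin n → Lp ℂ p' μ) :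
    pairLp (f - f') g = pairLp f g - pairLp f' g := by
  simp [pairLp, Finset.sum_sub_distrib]

/-- Hölder's inequality in $\ell^q$ at each point, then in $L^p$. -/
theorem norm_pairLp_le [p.HolderConjugate p'] [q.HolderConjugate q'] [Fact (1 ≤ q)] [Fact (1 ≤ q')]
    (f : Fin n → Lp ℂ p μ) (g : Fin n → Lp ℂ p' μ) :
    ‖pairLp f g‖ ≤ ‖vecLp q f‖ * ‖vecLp q' g‖ := by
  rw [pairLp_eq_integral]
  have h1 : eLpNorm (fun x => ∑ k, vecLp q f x k * vecLp q' g x k) 1 μ ≤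
      (1 : ℝ≥0) * eLpNorm (vecLp q f) p μ * eLpNorm (vecLp q' g) p' μ :=
    eLpNorm_le_eLpNorm_mul_eLpNorm_of_nnnorm (Lp.aestronglyMeasurable _)
      (Lp.aestronglyMeasurable _)
      (fun (v : PiLp q fun _ : Fin n => ℂ) (w : PiLp q' fun _ : Fin n => ℂ) => ∑ k, v k * w k) 1
      (ae_of_all _ fun x => by
        rw [one_mul]
        exact norm_sum_mul_le (q := q) (q' := q') (vecLp q f x).ofLp (vecLp q' g x).ofLp)
  have h2 : (fun x => ∑ k, vecLp q f x k * vecLp q' g x k) =ᵐ[μ] fun x => ∑ k, f k x * g k x := by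
    filter_upwards [coeFn_vecLp (q := q) f, coeFn_vecLp (q := q') g] with x h3 h4
    rw [h3, h4]
  rw [eLpNorm_congr_ae h2, ENNReal.coe_one, one_mul, ← Lp.enorm_def, ← Lp.enorm_def,
    eLpNorm_one_eq_lintegral_enorm] at h1
  have h3 := (enorm_integral_le_lintegral_enorm (μ := μ) fun x => ∑ k, f k x * g k x).trans h1
  rw [enorm_eq_nnnorm, enorm_eq_nnnorm, enorm_eq_nnnorm, ← ENNReal.coe_mul,
    ENNReal.coe_le_coe] at h3
  exact_mod_cast h3

theorem norm_rpow_eq_integral {E : Type*} [NormedAddCommGroup E] (hp : p ≠ ∞) (f : Lp E p μ) :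
    ‖f‖ ^ p.toReal = ∫ x, ‖f x‖ ^ p.toReal ∂μ := by
  have hp0 : p ≠ 0 := (zero_lt_one.trans_le (Fact.out : 1 ≤ p)).ne'
  have hpr := ENNReal.toReal_pos hp0 hp
  rw [Lp.norm_def, (Lp.memLp f).eLpNorm_eq_integral_rpow_norm hp0 hp,
    ENNReal.toReal_ofReal (by positivity), ← Real.rpow_mul (integral_nonneg fun x => by positivity),
    inv_mul_cancel₀ hpr.ne', Real.rpow_one]

theorem norm_vecLp_rpow [Fact (1 ≤ q)] (hp : p ≠ ∞) (f : Fin n → Lp ℂ p μ) :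
    ‖vecLp q f‖ ^ p.toReal = ∫ x, ‖WithLp.toLp q fun k => f k x‖ ^ p.toReal ∂μ := by
  rw [norm_rpow_eq_integral hp]
  refine integral_congr_ae ?_
  filter_upwards [coeFn_vecLp (q := q) f] with x hx
  rw [hx]

/-- The norm of `L^p(ℓ^r)` can be computed by pairing with simple functions. -/
theorem norm_vecLp_le_of_pairLp [p.HolderConjugate p'] [r.HolderConjugate r'] [Fact (1 ≤ r)]
    [Fact (1 ≤ r')] (hp1 : 1 < p) (hp : p ≠ ∞) (hr1 : 1 < r) (hr : r ≠ ∞) (f : Fin n → Lp ℂ p μ)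
    {C : ℝ} (hC : 0 ≤ C) (h : ∀ G : SimpleFunc Ω (Fin n → ℂ), G.FinMeasSupp μ →
      ‖pairLp f (stepTuple p' μ id G)‖ ≤ C * ‖vecLp r' (stepTuple p' μ id G)‖) :
    ‖vecLp r f‖ ≤ C := by
  have hp' : p' ≠ ∞ := by
    rintro rfl
    have := ENNReal.holderConjugate_iff.1 (inferInstance : p.HolderConjugate ∞)
    simp only [ENNReal.inv_top, add_zero, ENNReal.inv_eq_one] at this
    exact hp1.ne' this
  have hpp := ENNReal.HolderConjugate.toReal_of_ne_top hp hp'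
  set K := ‖vecLp (μ := μ) (p := p) (n := n) r‖
  have hK : 0 ≤ K := norm_nonneg _
  refine le_of_forall_pos_le_add fun ε hε => ?_
  obtain ⟨G, hG, hGε⟩ := exists_stepTuple_near hp f (ε := ε / (2 * (K + 1))) (by positivity)
  set f₀ := stepTuple p μ id G with hf₀
  have h1 : ‖vecLp r (f - f₀)‖ ≤ ε / 2 := by
    refine (ContinuousLinearMap.le_opNorm _ _).trans ?_
    calc K * ‖f - f₀‖ ≤ (K + 1) * (ε / (2 * (K + 1))) := by gcongr; linarith
      _ = ε / 2 := by field_simp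
  have hN0 := normingMap_zero (n := n) r p.toReal
  -- The test function norms the approximant $f_0$: below, $\|f_0\|^p$, $\|g\|^{p'}$ and the pairing
  -- of $f_0$ with $g$ all equal $I$.
  have h2 := h (G.map (normingMap r p.toReal)) (hG.map hN0)
  rw [stepTuple_map hN0 hG] at h2
  set g := stepTuple p' μ (normingMap r p.toReal) G with hg
  set I := ∫ x, ‖WithLp.toLp r (G x)‖ ^ p.toReal ∂μ with hI
  have hI0 : 0 ≤ I := integral_nonneg fun x =>
    Real.rpow_nonneg (norm_nonneg (WithLp.toLp r (G x))) _
  have e1 : ‖vecLp r f₀‖ ^ p.toReal = I := by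
    rw [norm_vecLp_rpow hp]
    refine integral_congr_ae ?_
    filter_upwards [coeFn_stepTuple (p := p) (Φ := id) rfl hG] with x hx
    rw [hx]; rfl
  have e2 : ‖vecLp r' g‖ ^ p'.toReal = I := by
    rw [norm_vecLp_rpow hp']
    refine integral_congr_ae ?_
    filter_upwards [coeFn_stepTuple (p := p') hN0 hG] with x hx
    rw [hx, norm_toLp_normingMap hr1 hr hpp.lt, ← Real.rpow_mul (norm_nonneg _),
      hpp.sub_one_mul_conj]
  have e3 : pairLp f₀ g = I := by
    rw [pairLp_eq_integral, hI, ← integral_complex_ofReal]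
    refine integral_congr_ae ?_
    filter_upwards [coeFn_stepTuple (p := p) (Φ := id) rfl hG,
      coeFn_stepTuple (p := p') hN0 hG] with x hx hx'
    rw [← sum_mul_normingMap hr1.le hr hpp.pos]
    refine Finset.sum_congr rfl fun k _ => ?_
    have h3 := congrFun hx k
    have h4 := congrFun hx' k
    simp only [id] at h3 h4
    rw [hf₀, hg, h3, h4]
  have e4 : ‖pairLp (f - f₀) g‖ ≤ ε / 2 * ‖vecLp r' g‖ :=
    (norm_pairLp_le (q := r) (q' := r') _ _).trans
      (mul_le_mul_of_nonneg_right h1 (norm_nonneg _))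
  have e5 : I ≤ (C + ε / 2) * ‖vecLp r' g‖ := by
    have : pairLp f₀ g = pairLp f g - pairLp (f - f₀) g := by rw [pairLp_sub_left]; ring
    calc I = ‖pairLp f₀ g‖ := by rw [e3, Complex.norm_real, Real.norm_of_nonneg hI0]
      _ ≤ ‖pairLp f g‖ + ‖pairLp (f - f₀) g‖ := by rw [this]; exact norm_sub_le _ _
      _ ≤ C * ‖vecLp r' g‖ + ε / 2 * ‖vecLp r' g‖ := add_le_add h2 e4
      _ = _ := by ring
  have e6 : ‖vecLp r f₀‖ ≤ C + ε / 2 := by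
    rcases (norm_nonneg (vecLp r f₀)).eq_or_lt with h0 | hpos
    · rw [← h0]; positivity
    have hIpos : 0 < I := by rw [← e1]; positivity
    have hgpos : 0 < ‖vecLp r' g‖ := by
      refine (norm_nonneg _).lt_of_ne fun h0 => ?_
      rw [← h0, Real.zero_rpow hpp.symm.pos.ne'] at e2
      exact hIpos.ne e2
    have e7 : ‖vecLp r f₀‖ = I ^ (1 / p.toReal) := by
      rw [← e1, ← Real.rpow_mul (norm_nonneg _), mul_one_div_cancel hpp.pos.ne', Real.rpow_one]
    have e8 : ‖vecLp r' g‖ = I ^ (1 / p'.toReal) := by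
      rw [← e2, ← Real.rpow_mul (norm_nonneg _), mul_one_div_cancel hpp.symm.pos.ne', Real.rpow_one]
    have e9 : ‖vecLp r f₀‖ * ‖vecLp r' g‖ = I := by
      rw [e7, e8, ← Real.rpow_add hIpos, one_div, one_div, hpp.inv_add_inv_eq_one, Real.rpow_one]
    rw [← e9] at e5
    exact le_of_mul_le_mul_right e5 hgpos
  calc ‖vecLp r f‖ = ‖vecLp r f₀ + vecLp r (f - f₀)‖ := by rw [← map_add, add_sub_cancel]
    _ ≤ _ := norm_add_le _ _
    _ ≤ C + ε := by linarith

end VecLp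

end RBdd

namespace RBdd

/-! ### Stein interpolation in `L^p(ℓ^q)` -/

section Stein

variable {Ω : Type*} [MeasurableSpace Ω] {μ : Measure Ω} {p p' q q' r r' : ℝ≥0∞}
  [Fact (1 ≤ p)] [Fact (1 ≤ p')] {n : ℕ}

theorem differentiable_stepTuple {Φ : ℂ → (Fin n → ℂ) → Fin n → ℂ}
    (hΦ : ∀ v k, Differentiable ℂ fun ζ => Φ ζ v k) (G : SimpleFunc Ω (Fin n → ℂ)) (k : Fin n) :
    Differentiable ℂ fun ζ => stepTuple p μ (Φ ζ) G k := by
  classical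
  unfold stepTuple stepLp
  exact Differentiable.fun_sum fun v _ => (hΦ v k).smul_const _

/-- The bound is uniform over all $\Phi$, hence over the analytic parameter; it supplies the
boundedness on the strip required by the three lines theorem. -/
theorem exists_norm_stepTuple_le (s : ℝ≥0∞) (G : SimpleFunc Ω (Fin n → ℂ)) :
    ∃ a : ℝ, 0 ≤ a ∧ ∀ (Φ : (Fin n → ℂ) → Fin n → ℂ),
      (∀ v k, ‖Φ v k‖ ≤ ‖WithLp.toLp s v‖) → ∀ k, ‖stepTuple p μ Φ G k‖ ≤ a := by
  classical
  refine ⟨∑ v ∈ G.range.filter (· ≠ 0), |‖WithLp.toLp s v‖| * ‖indLp p μ (G ⁻¹' {v})‖,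
    by positivity, fun Φ hΦ k => ?_⟩
  refine (norm_sum_le _ _).trans (Finset.sum_le_sum fun v _ => ?_)
  rw [norm_smul]
  gcongr
  exact (hΦ v k).trans (le_abs_self _)

theorem toReal_inv_le_one (hq : 1 ≤ q) : (q⁻¹).toReal ≤ 1 :=
  ENNReal.toReal_le_of_le_ofReal zero_le_one (by simpa using hq)

theorem toReal_inv_conj [hqq : q.HolderConjugate q'] : (q'⁻¹).toReal = 1 - (q⁻¹).toReal := by
  have h := ENNReal.holderConjugate_iff.1 hqq
  have h1 : q⁻¹ ≠ ∞ := ne_top_of_le_ne_top ENNReal.one_ne_top (h ▸ le_self_add)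
  have h2 : q'⁻¹ ≠ ∞ := ne_top_of_le_ne_top ENNReal.one_ne_top (h ▸ le_add_self)
  rw [eq_sub_iff_add_eq', ← ENNReal.toReal_add h1 h2, h, ENNReal.toReal_one]

variable {q₀ q₁ : ℝ≥0∞} [Fact (1 ≤ q₀)] [Fact (1 ≤ q₁)] [Fact (1 ≤ r)]

/-- The bound for the pairing of step functions in Stein's interpolation theorem. -/
theorem norm_pairLp_stein_le [p.HolderConjugate p'] [Fact (1 ≤ r')] [hrr : r.HolderConjugate r']
    (hr1 : 1 < r) (hr : r ≠ ∞) {τ : ℝ}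
    (hτ : τ ∈ Set.Icc (0 : ℝ) 1) (hrτ : (r⁻¹).toReal = (1 - τ) * (q₀⁻¹).toReal + τ * (q₁⁻¹).toReal)
    {W : Fin n → ℂ → Lp ℂ p μ →L[ℂ] Lp ℂ p μ}
    (hW : ∀ k, DifferentiableOn ℂ (W k) (Complex.re ⁻¹' Set.Icc 0 1)) {K C : ℝ}
    (hK : ∀ k, ∀ ζ ∈ Complex.re ⁻¹' Set.Icc (0 : ℝ) 1, ‖W k ζ‖ ≤ K) (hC : 0 ≤ C)
    (h₀ : ∀ ζ : ℂ, ζ.re = 0 → ∀ f : Fin n → Lp ℂ p μ,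
      ‖vecLp q₀ fun k => W k ζ (f k)‖ ≤ C * ‖vecLp q₀ f‖)
    (h₁ : ∀ ζ : ℂ, ζ.re = 1 → ∀ f : Fin n → Lp ℂ p μ,
      ‖vecLp q₁ fun k => W k ζ (f k)‖ ≤ C * ‖vecLp q₁ f‖)
    {G G' : SimpleFunc Ω (Fin n → ℂ)} (hG : G.FinMeasSupp μ) (hG' : G'.FinMeasSupp μ) :
    ‖pairLp (fun k => W k τ (stepTuple p μ id G k)) (stepTuple p' μ id G')‖ ≤
      C * ‖vecLp r (stepTuple p μ id G)‖ * ‖vecLp r' (stepTuple p' μ id G')‖ := by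
  have hr1' : 1 ≤ r' := Fact.out
  have hr' : r' ≠ ∞ := by
    rintro rfl
    have := ENNReal.holderConjugate_iff.1 hrr
    simp only [ENNReal.inv_top, add_zero, ENNReal.inv_eq_one] at this
    exact hr1.ne' this
  have hconj := ENNReal.HolderConjugate.toReal_of_ne_top hr hr'
  set a := (q₀⁻¹).toReal with ha
  set b := (q₁⁻¹).toReal with hb
  have ha1 : a ≤ 1 := toReal_inv_le_one Fact.out
  have hb1 : b ≤ 1 := toReal_inv_le_one Fact.out
  have ha0 : 0 ≤ a := ENNReal.toReal_nonneg
  have hb0 : 0 ≤ b := ENNReal.toReal_nonneg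
  -- $\beta$ is affine with values $1/q_0$, $1/q_1$, $1/r$ at $0$, $1$, $\tau$. The exponents
  -- $\gamma=r\beta$ and $\gamma'=r'(1-\beta)$ equal $1$ at $\tau$, so the analytic families pass
  -- through the given step functions there.
  set β : ℂ → ℂ := fun ζ => (1 - ζ) * a + ζ * b with hβ
  have hβre : ∀ ζ, (β ζ).re = (1 - ζ.re) * a + ζ.re * b := fun ζ => by simp [hβ]
  have hβd : Differentiable ℂ β := by fun_prop
  set γ : ℂ → ℂ := fun ζ => (r.toReal : ℂ) * β ζ with hγ
  set γ' : ℂ → ℂ := fun ζ => (r'.toReal : ℂ) * (1 - β ζ) with hγ'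
  have hγd : Differentiable ℂ γ := hβd.const_mul _
  have hγd' : Differentiable ℂ γ' := (hβd.const_sub 1).const_mul _
  have hγre : ∀ ζ, (γ ζ).re = r.toReal * (β ζ).re := fun ζ => Complex.re_ofReal_mul _ _
  have hγre' : ∀ ζ, (γ' ζ).re = r'.toReal * (1 - (β ζ).re) := fun ζ => by
    simp only [hγ', Complex.re_ofReal_mul, Complex.sub_re, Complex.one_re]
  have hβτ : β τ = (r.toReal : ℂ)⁻¹ := by
    have : β τ = (((1 - τ) * a + τ * b : ℝ) : ℂ) := by simp [hβ]
    rw [this, ← hrτ, ENNReal.toReal_inv]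
    push_cast
    rfl
  have hγτ : γ τ = 1 := by
    simp only [hγ, hβτ]
    exact mul_inv_cancel₀ (by exact_mod_cast hconj.pos.ne')
  have hγτ' : γ' τ = 1 := by
    simp only [hγ', hβτ]
    have : (1 : ℂ) - (r.toReal : ℂ)⁻¹ = ((r'.toReal)⁻¹ : ℝ) := by
      rw [← hconj.one_sub_inv]; push_cast; rfl
    rw [this]
    exact_mod_cast mul_inv_cancel₀ hconj.symm.pos.ne'
  set f : ℂ → Fin n → Lp ℂ p μ := fun ζ => stepTuple p μ (powerMap r (γ ζ)) G with hf
  set g : ℂ → Fin n → Lp ℂ p' μ := fun ζ => stepTuple p' μ (powerMap r' (γ' ζ)) G' with hg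
  have hfτ : f τ = stepTuple p μ id G := by
    simp only [hf, hγτ]
    congr 1
    exact funext fun v => powerMap_one hr1.le v
  have hgτ : g τ = stepTuple p' μ id G' := by
    simp only [hg, hγτ']
    congr 1
    exact funext fun v => powerMap_one hr1' v
  have hfd : ∀ k, Differentiable ℂ fun ζ => f ζ k := fun k =>
    differentiable_stepTuple (Φ := fun ζ => powerMap r (γ ζ))
      (fun v k => (differentiable_powerMap hr1.le v k).comp hγd) G k
  have hgd : ∀ k, Differentiable ℂ fun ζ => g ζ k := fun k =>
    differentiable_stepTuple (Φ := fun ζ => powerMap r' (γ' ζ))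
      (fun v k => (differentiable_powerMap hr1' v k).comp hγd') G' k
  set F : ℂ → ℂ := fun ζ => pairLp (fun k => W k ζ (f ζ k)) (g ζ) with hF
  set D := C * ‖vecLp r (stepTuple p μ id G)‖ * ‖vecLp r' (stepTuple p' μ id G')‖
  have hD : 0 ≤ D := by positivity
  -- On an edge the two families have $L^p(\ell^s)$ and $L^{p'}(\ell^{s'})$ norms at most those of
  -- the original functions in $L^p(\ell^r)$ and $L^{p'}(\ell^{r'})$. Only the inner exponent moves;
  -- $p$ is fixed.
  have edge : ∀ (s : ℝ≥0∞) [Fact (1 ≤ s)] (ζ : ℂ), (β ζ).re = (s⁻¹).toReal →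
      (∀ f : Fin n → Lp ℂ p μ, ‖vecLp s fun k => W k ζ (f k)‖ ≤ C * ‖vecLp s f‖) → ‖F ζ‖ ≤ D := by
    intro s _ ζ hs hbd
    have hs' : Fact (1 ≤ s.conjExponent) := ⟨ENNReal.HolderConjugate.one_le s.conjExponent s⟩
    have e1 : ‖vecLp s (f ζ)‖ ≤ ‖vecLp r (stepTuple p μ id G)‖ :=
      norm_vecLp_stepTuple_le (powerMap_zero _ _) rfl hG fun v =>
        norm_toLp_powerMap_le hr1.le hr Fact.out (by rw [hγre, hs]) v
    have e2 : ‖vecLp s.conjExponent (g ζ)‖ ≤ ‖vecLp r' (stepTuple p' μ id G')‖ :=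
      norm_vecLp_stepTuple_le (powerMap_zero _ _) rfl hG' fun v =>
        norm_toLp_powerMap_le hr1' hr' Fact.out
          (by rw [hγre', hs, toReal_inv_conj (q := s) (q' := s.conjExponent)]) v
    calc ‖F ζ‖ ≤ _ := norm_pairLp_le (q := s) (q' := s.conjExponent) _ _
      _ ≤ (C * ‖vecLp s (f ζ)‖) * ‖vecLp s.conjExponent (g ζ)‖ := by gcongr; exact hbd _
      _ ≤ D := mul_le_mul (mul_le_mul_of_nonneg_left e1 hC) e2 (norm_nonneg _)
        (mul_nonneg hC (norm_nonneg _))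
  have hFd : DifferentiableOn ℂ F (Complex.re ⁻¹' Set.Icc 0 1) := by
    simp only [hF, pairLp]
    refine DifferentiableOn.fun_sum fun k _ => ?_
    have e1 : DifferentiableOn ℂ (fun ζ => W k ζ (f ζ k)) (Complex.re ⁻¹' Set.Icc 0 1) :=
      (hW k).clm_apply (hfd k).differentiableOn
    exact (((ContinuousLinearMap.mul ℂ ℂ).lpPairing μ p p').differentiable.comp_differentiableOn
      e1).clm_apply (hgd k).differentiableOn
  -- Within the strip $0\le\operatorname{Re}\beta\le1$, so both exponents have nonnegative real part
  -- and `norm_powerMap_le` applies.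
  have hFb : BddAbove ((norm ∘ F) '' Complex.HadamardThreeLines.verticalClosedStrip 0 1) := by
    obtain ⟨A, hA0, hA⟩ := exists_norm_stepTuple_le (p := p) (μ := μ) r G
    obtain ⟨A', hA0', hA'⟩ := exists_norm_stepTuple_le (p := p') (μ := μ) r' G'
    refine ⟨∑ _k : Fin n, ‖(ContinuousLinearMap.mul ℂ ℂ).lpPairing μ p p'‖ * (K * A) * A', ?_⟩
    rintro _ ⟨ζ, hζ, rfl⟩
    have hζ' : ζ.re ∈ Set.Icc (0 : ℝ) 1 := hζ
    have b1 : 0 ≤ (β ζ).re := by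
      rw [hβre]
      have := sub_nonneg.2 hζ'.2
      have := hζ'.1
      positivity
    have b2 : (β ζ).re ≤ 1 := by
      rw [hβre]
      nlinarith [hζ'.1, hζ'.2]
    have e1 : ∀ k, ‖f ζ k‖ ≤ A := hA _ fun v k => norm_powerMap_le hr1.le
      (by rw [hγre]; exact mul_nonneg hconj.pos.le b1) v k
    have e2 : ∀ k, ‖g ζ k‖ ≤ A' := hA' _ fun v k => norm_powerMap_le hr1'
      (by rw [hγre']; exact mul_nonneg hconj.symm.pos.le (sub_nonneg.2 b2)) v k
    simp only [Function.comp_apply, hF, pairLp]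
    refine (norm_sum_le _ _).trans (Finset.sum_le_sum fun k _ => ?_)
    have hK0 : 0 ≤ K := (norm_nonneg _).trans (hK k ζ hζ)
    refine (ContinuousLinearMap.le_opNorm₂ _ _ _).trans ?_
    have e3 : ‖W k ζ (f ζ k)‖ ≤ K * A := (ContinuousLinearMap.le_opNorm _ _).trans
      (mul_le_mul (hK k ζ hζ) (e1 k) (norm_nonneg _) hK0)
    have e4 := e2 k
    gcongr
  have hcl : closure (Complex.HadamardThreeLines.verticalStrip 0 1) ⊆
      Complex.re ⁻¹' Set.Icc (0 : ℝ) 1 :=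
    closure_minimal (Set.preimage_mono Set.Ioo_subset_Icc_self)
      (isClosed_Icc.preimage Complex.continuous_re)
  have key := Complex.HadamardThreeLines.norm_le_interp_of_mem_verticalClosedStrip₀₁' F
    (z := (τ : ℂ)) (a := D) (b := D) (by simpa [Complex.HadamardThreeLines.verticalClosedStrip] using hτ)
    (hFd.mono hcl).diffContOnCl hFb
    (fun ζ hζ => edge q₀ ζ (by rw [hβre, (hζ : ζ.re = 0)]; simp [ha]) (h₀ ζ hζ))
    (fun ζ hζ => edge q₁ ζ (by rw [hβre, (hζ : ζ.re = 1)]; simp [hb]) (h₁ ζ hζ))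
  rw [Complex.ofReal_re, ← Real.rpow_add_of_nonneg hD (sub_nonneg.2 hτ.2) hτ.1, sub_add_cancel,
    Real.rpow_one] at key
  rw [← hfτ, ← hgτ]
  exact key

/-- Stein's interpolation theorem for operators acting diagonally on `L^p(ℓ^q)`. -/
theorem norm_vecLp_stein_le (hp1 : 1 < p) (hp : p ≠ ∞) (hr1 : 1 < r) (hr : r ≠ ∞) {τ : ℝ}
    (hτ : τ ∈ Set.Icc (0 : ℝ) 1) (hrτ : (r⁻¹).toReal = (1 - τ) * (q₀⁻¹).toReal + τ * (q₁⁻¹).toReal)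
    {W : Fin n → ℂ → Lp ℂ p μ →L[ℂ] Lp ℂ p μ}
    (hW : ∀ k, DifferentiableOn ℂ (W k) (Complex.re ⁻¹' Set.Icc 0 1)) {K C : ℝ}
    (hK : ∀ k, ∀ ζ ∈ Complex.re ⁻¹' Set.Icc (0 : ℝ) 1, ‖W k ζ‖ ≤ K) (hC : 0 ≤ C)
    (h₀ : ∀ ζ : ℂ, ζ.re = 0 → ∀ f : Fin n → Lp ℂ p μ,
      ‖vecLp q₀ fun k => W k ζ (f k)‖ ≤ C * ‖vecLp q₀ f‖)
    (h₁ : ∀ ζ : ℂ, ζ.re = 1 → ∀ f : Fin n → Lp ℂ p μ,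
      ‖vecLp q₁ fun k => W k ζ (f k)‖ ≤ C * ‖vecLp q₁ f‖) (f : Fin n → Lp ℂ p μ) :
    ‖vecLp r fun k => W k τ (f k)‖ ≤ C * ‖vecLp r f‖ := by
  have hp' : Fact (1 ≤ p.conjExponent) := ⟨ENNReal.HolderConjugate.one_le p.conjExponent p⟩
  have hr' : Fact (1 ≤ r.conjExponent) := ⟨ENNReal.HolderConjugate.one_le r.conjExponent r⟩
  -- Both sides are continuous in $f$, so step functions suffice; duality then reduces the second
  -- function to a step function too.
  have hclosed : IsClosed {f : Fin n → Lp ℂ p μ |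
      ‖vecLp r fun k => W k τ (f k)‖ ≤ C * ‖vecLp r f‖} := by
    refine isClosed_le ?_ ?_
    · exact ((vecLp r).continuous.comp (continuous_pi fun k =>
        (W k τ).continuous.comp (continuous_apply k))).norm
    · exact ((vecLp r).continuous.norm).const_mul C
  refine hclosed.closure_subset (Metric.mem_closure_iff.2 fun ε hε => ?_)
  obtain ⟨G, hG, hGε⟩ := exists_stepTuple_near hp f hε
  refine ⟨stepTuple p μ id G, ?_, by rwa [dist_eq_norm]⟩
  refine norm_vecLp_le_of_pairLp (p' := p.conjExponent) (r' := r.conjExponent) hp1 hp hr1 hr _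
    (by positivity) fun G' hG' => ?_
  exact norm_pairLp_stein_le hr1 hr hτ hrτ hW hK hC h₀ h₁ hG hG'

end Stein

end RBdd

namespace RBdd

/-! ### `𝓡_r`-boundedness of resolvents -/

theorem ofReal_mul_exp_mem_sector {δ s x : ℝ} (hδ : δ ≤ Real.pi) (hs : 0 < s) (hx : |x| < δ) :
    (s : ℂ) * Complex.exp (x * Complex.I) ∈ sector δ := by
  refine ofReal_mul_mem_sector ⟨Complex.exp_ne_zero _, ?_⟩ hs
  have := abs_lt.1 (hx.trans_le hδ)
  rw [Complex.exp_mul_I, Complex.arg_cos_add_sin_mul_I ⟨this.1, this.2.le⟩]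
  exact hx

/-- The modulus depends only on $\operatorname{Im}\zeta$ and the argument only on
$\operatorname{Re}\zeta$, so the left edge of the strip is mapped to positive times. -/
theorem exp_mul_I_eq (ρ η : ℝ) (ζ : ℂ) : (ρ : ℂ) * Complex.exp (η * ζ * Complex.I) =
    ((ρ * Real.exp (-(η * ζ.im)) : ℝ) : ℂ) * Complex.exp ((η * ζ.re : ℝ) * Complex.I) := by
  push_cast
  rw [mul_assoc (ρ : ℂ), ← Complex.exp_add]
  congr 2
  conv_lhs => rw [← Complex.re_add_im ζ]
  linear_combination (η : ℂ) * ζ.im * Complex.I_sq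

/-- Off a sector of angle near `π / 2` one can rotate by a small angle into the left half-plane. -/
theorem exists_rotation {φ δ : ℝ} (hφ : φ ∈ Set.Ioo 0 (Real.pi / 2)) (hδ : 0 < δ)
    (hδφ : 2 * δ < Real.pi / 2 - φ) {z : ℂ} (hz : z ∉ closure (sector (Real.pi / 2 - δ / 2))) :
    z ∈ offSector φ ∧ ∃ η : ℝ, |η| = δ ∧
      ‖z * (((‖z‖⁻¹ : ℝ) : ℂ) * Complex.exp (η * Complex.I))‖ ≤ 1 ∧
      (z * (((‖z‖⁻¹ : ℝ) : ℂ) * Complex.exp (η * Complex.I))).re ≤ -Real.sin (δ / 2) := by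
  obtain ⟨h0, harg⟩ := re_le_of_notMem_closure_sector
    (θ := Real.pi / 2 - δ / 2) ⟨by linarith [hφ.1], by linarith [hφ.1, hφ.2]⟩ hz
  have hpos := norm_pos_iff.2 h0
  have hpi := Complex.abs_arg_le_pi z
  constructor
  · have h1 : Real.cos |z.arg| < Real.cos φ :=
      Real.cos_lt_cos_of_nonneg_of_le_pi hφ.1.le hpi (by linarith)
    rw [Real.cos_abs] at h1
    have h2 : ‖z‖ * Real.cos z.arg = z.re := Complex.norm_mul_cos_arg z
    show z.re < ‖z‖ * Real.cos φ
    rw [← h2]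
    gcongr
  have h1 : ∀ η : ℝ, z * (((‖z‖⁻¹ : ℝ) : ℂ) * Complex.exp (η * Complex.I)) =
      Complex.exp (((z.arg + η : ℝ) : ℂ) * Complex.I) := fun η => by
    conv_lhs => rw [← Complex.norm_mul_exp_arg_mul_I z]
    have : (‖z‖ : ℂ) ≠ 0 := by exact_mod_cast hpos.ne'
    simp only [norm_mul, Complex.norm_real, norm_norm, Complex.norm_exp_ofReal_mul_I, mul_one]
    push_cast
    rw [add_mul, Complex.exp_add]
    field_simp
  -- Here $|\arg z|+\delta$ lies between $\pi/2+\delta/2$ and $\pi+\delta$; beyond $\pi$ it is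
  -- reflected to an angle that is still at least $\pi/2+\delta/2$, as $\delta$ is small.
  have h2 : Real.cos (|z.arg| + δ) ≤ -Real.sin (δ / 2) := by
    rw [← Real.cos_add_pi_div_two]
    rcases le_total (|z.arg| + δ) Real.pi with h | h
    · exact Real.cos_le_cos_of_nonneg_of_le_pi (by linarith) h (by linarith)
    · rw [← Real.cos_two_pi_sub (|z.arg| + δ)]
      exact Real.cos_le_cos_of_nonneg_of_le_pi (by linarith) (by linarith)
        (by linarith [hφ.1])
  -- The rotation goes away from the positive axis, so its sign is that of $\arg z$.
  rcases le_total 0 z.arg with h | h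
  · refine ⟨δ, abs_of_pos hδ, ?_, ?_⟩
    · rw [h1, Complex.norm_exp_ofReal_mul_I]
    · rw [h1, Complex.exp_ofReal_mul_I_re]
      rwa [abs_of_nonneg h] at h2
  · refine ⟨-δ, by rw [abs_neg, abs_of_pos hδ], ?_, ?_⟩
    · rw [h1, Complex.norm_exp_ofReal_mul_I]
    · rw [h1, Complex.exp_ofReal_mul_I_re, ← Real.cos_neg, neg_add, neg_neg]
      rwa [abs_of_nonpos h] at h2

theorem isSectorResolvent_resolvent {X : Type*} [NormedAddCommGroup X] [NormedSpace ℂ X]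
    {A : X →ₗ.[ℂ] X} {φ C : ℝ} (hφ : φ ∈ Set.Ioo 0 (Real.pi / 2))
    (hspec : spectrum A ⊆ closure (sector φ))
    (hres : ∀ z ∉ closure (sector φ), ‖z • resolvent A z‖ ≤ C) :
    IsSectorResolvent A φ C (resolvent A) where
  mem_Ioo := hφ
  isResolventAt z hz := resolvent_spec <| by
    by_contra h
    exact notMem_closure_sector hφ hz (hspec h)
  norm_le z hz := by
    have h := hres z (notMem_closure_sector hφ hz)
    rwa [norm_smul, mul_comm, ← le_div_iff₀ (norm_pos_iff.2 (ne_zero_of_mem_offSector hz))] at h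

theorem exists_interpolation {p q r : ℝ≥0∞} (hp : 1 ≤ p) (hq : 1 ≤ q)
    (hr : (p < r ∧ r < q) ∨ (q < r ∧ r < p)) : 1 < r ∧ r ≠ ∞ ∧ ∃ τ ∈ Set.Ioo (0 : ℝ) 1,
      (r⁻¹).toReal = (1 - τ) * (q⁻¹).toReal + τ * (p⁻¹).toReal := by
  have hr1 : 1 < r := by
    rcases hr with h | h
    exacts [hp.trans_lt h.1, hq.trans_lt h.1]
  have hrt : r ≠ ∞ := by
    rcases hr with h | h
    exacts [h.2.ne_top, h.2.ne_top]
  have hfin : ∀ {s : ℝ≥0∞}, 1 ≤ s → s⁻¹ ≠ ∞ := fun hs =>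
    ENNReal.inv_ne_top.2 (zero_lt_one.trans_le hs).ne'
  have key : ∀ {s t : ℝ≥0∞}, 1 ≤ s → 1 ≤ t → s < t → (t⁻¹).toReal < (s⁻¹).toReal :=
    fun hs ht hst => (ENNReal.toReal_lt_toReal (hfin ht) (hfin hs)).2 (ENNReal.inv_lt_inv.2 hst)
  refine ⟨hr1, hrt, ((r⁻¹).toReal - (q⁻¹).toReal) / ((p⁻¹).toReal - (q⁻¹).toReal), ?_, ?_⟩
  · rcases hr with h | h
    · have h1 := key hp hr1.le h.1
      have h2 := key hr1.le hq h.2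
      refine ⟨div_pos (by linarith) (by linarith), (div_lt_one (by linarith)).2 (by linarith)⟩
    · have h1 := key hq hr1.le h.1
      have h2 := key hr1.le hp h.2
      refine ⟨div_pos_of_neg_of_neg (by linarith) (by linarith),
        (div_lt_one_of_neg (by linarith)).2 (by linarith)⟩
  · have h0 : (p⁻¹).toReal - (q⁻¹).toReal ≠ 0 := by
      rcases hr with h | h
      · exact sub_ne_zero.2 (key hp hq (h.1.trans h.2)).ne'
      · exact sub_ne_zero.2 (key hq hp (h.1.trans h.2)).ne
    field_simp
    ring

section Resolvents

variable {Ω : Type*} [MeasurableSpace Ω] {μ : Measure Ω} {p q r : ℝ≥0∞}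
  [Fact (1 ≤ p)] {n : ℕ}

theorem norm_vecLp_smul_le [Fact (1 ≤ q)] {a : Fin n → ℂ} {c : ℝ} (ha : ∀ k, ‖a k‖ ≤ c)
    (hc : 0 ≤ c) (f : Fin n → Lp ℂ p μ) :
    ‖vecLp q fun k => a k • f k‖ ≤ c * ‖vecLp q f‖ := by
  have h1 : c * ‖vecLp q f‖ = ‖vecLp q fun k => (c : ℂ) • f k‖ := by
    rw [show (fun k => (c : ℂ) • f k) = (c : ℂ) • f from rfl, map_smul, norm_smul,
      Complex.norm_real, Real.norm_of_nonneg hc]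
  rw [h1]
  refine norm_vecLp_le_of_ae ?_
  filter_upwards [ae_all_iff.2 fun k => Lp.coeFn_smul (a k) (f k),
    ae_all_iff.2 fun k => Lp.coeFn_smul (c : ℂ) (f k)] with x h2 h3
  refine norm_toLp_mono Fact.out fun k => ?_
  rw [h2 k, h3 k, Pi.smul_apply, Pi.smul_apply, norm_smul, norm_smul, Complex.norm_real,
    Real.norm_of_nonneg hc]
  gcongr
  exact ha k

theorem norm_vecLp_self_rpow (hp : p ≠ ∞) (f : Fin n → Lp ℂ p μ) :
    ‖vecLp p f‖ ^ p.toReal = ∑ k, ‖f k‖ ^ p.toReal := by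
  have hp1 : 1 ≤ p := Fact.out
  have hp0 : p ≠ 0 := (zero_lt_one.trans_le hp1).ne'
  rw [norm_vecLp_rpow hp]
  simp only [norm_toLp_rpow hp1 hp, norm_rpow_eq_integral hp]
  exact integral_finsetSum _ fun k _ => (Lp.memLp (f k)).integrable_norm_rpow hp0 hp

/-- By Fubini $L^p(\ell^p)=\ell^p(L^p)$, where a diagonal operator is bounded by the largest norm of
its entries. -/
theorem norm_vecLp_self_le (hp : p ≠ ∞) {U : Fin n → Lp ℂ p μ →L[ℂ] Lp ℂ p μ} {K : ℝ} (hK : 0 ≤ K)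
    (hU : ∀ k, ‖U k‖ ≤ K) (f : Fin n → Lp ℂ p μ) :
    ‖vecLp p fun k => U k (f k)‖ ≤ K * ‖vecLp p f‖ := by
  have hp0 : p ≠ 0 := (zero_lt_one.trans_le (Fact.out : 1 ≤ p)).ne'
  have hpr := ENNReal.toReal_pos hp0 hp
  rw [← Real.rpow_le_rpow_iff (norm_nonneg _) (by positivity) hpr,
    Real.mul_rpow hK (norm_nonneg _), norm_vecLp_self_rpow hp, norm_vecLp_self_rpow hp,
    Finset.mul_sum]
  refine Finset.sum_le_sum fun k _ => ?_
  rw [← Real.mul_rpow hK (norm_nonneg _)]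
  gcongr
  exact (U k).le_of_opNorm_le (hU k) _

theorem norm_vecLp_absLp [Fact (1 ≤ q)] (f : Fin n → Lp ℂ p μ) :
    ‖vecLp q fun k => absLp (f k)‖ ≤ ‖vecLp q f‖ := by
  refine norm_vecLp_le_of_ae ?_
  have h1 : ∀ k, absLp (f k) =ᵐ[μ] fun x => ((‖f k x‖ : ℝ) : ℂ) := fun k => MemLp.coeFn_toLp _
  filter_upwards [ae_all_iff.2 h1] with x hx
  refine norm_toLp_mono Fact.out fun k => ?_
  rw [hx k]
  exact (Complex.norm_real _).trans_le (norm_norm _).le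

theorem norm_vecLp_le_of_dominates [Fact (1 ≤ q)] {D S : Fin n → Lp ℂ p μ →L[ℂ] Lp ℂ p μ}
    (h : ∀ k, Dominates (D k) (S k)) (f : Fin n → Lp ℂ p μ) :
    ‖vecLp q fun k => S k (f k)‖ ≤ ‖vecLp q fun k => D k (absLp (f k))‖ := by
  refine norm_vecLp_le_of_ae ?_
  filter_upwards [ae_all_iff.2 fun k => h k (f k)] with x hx
  refine norm_toLp_mono Fact.out fun k => ?_
  exact (Complex.le_def.1 (hx k)).1.trans (Complex.re_le_norm _)

variable {A : Fin n → Lp ℂ p μ →ₗ.[ℂ] Lp ℂ p μ} {φ ψ M : ℝ}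
  {R : Fin n → ℂ → Lp ℂ p μ →L[ℂ] Lp ℂ p μ} (h : ∀ k, IsSectorResolvent (A k) φ M (R k))
  (hφψ : φ < ψ) (hψ : ψ < Real.pi / 2)
include h hφψ hψ

/-- Stein interpolation along $\zeta\mapsto\rho_ke^{i\eta_k\zeta}$. For $\operatorname{Re}\zeta=0$
the times are positive and `hq` applies; for $\operatorname{Re}\zeta=1$ only the uniform bound on
the sector is used, in $L^p(\ell^p)$. -/
theorem norm_vecLp_contourExp_le [Fact (1 ≤ q)] [Fact (1 ≤ r)] (hφ0 : 0 < φ)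
    (hp1 : 1 < p) (hp : p ≠ ∞) (hr1 : 1 < r)
    (hr : r ≠ ∞) {τ : ℝ} (hτ : τ ∈ Set.Icc (0 : ℝ) 1)
    (hrτ : (r⁻¹).toReal = (1 - τ) * (q⁻¹).toReal + τ * (p⁻¹).toReal) {C : ℝ}
    (hKC : ‖(contourConst ψ)⁻¹‖ * ((∫ u, contourWeight ψ u) * (M / (1 - Real.cos ψ))) ≤ C)
    (hC : 0 ≤ C)
    (hq : ∀ s : Fin n → ℝ, (∀ k, 0 < s k) → ∀ f : Fin n → Lp ℂ p μ,
      ‖vecLp q fun k => contourExp (R k) ψ (s k) (f k)‖ ≤ C * ‖vecLp q f‖)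
    {ρ η : Fin n → ℝ} (hρ : ∀ k, 0 < ρ k) (hη : ∀ k, |η k| < ψ - φ) (f : Fin n → Lp ℂ p μ) :
    ‖vecLp r fun k => contourExp (R k) ψ (ρ k * Complex.exp (η k * τ * Complex.I)) (f k)‖ ≤
      C * ‖vecLp r f‖ := by
  have hδ : ψ - φ ≤ Real.pi := by linarith [Real.pi_pos]
  have hmem : ∀ k, ∀ ζ ∈ Complex.re ⁻¹' Set.Icc (0 : ℝ) 1,
      (ρ k : ℂ) * Complex.exp (η k * ζ * Complex.I) ∈ sector (ψ - φ) := fun k ζ hζ => by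
    rw [exp_mul_I_eq]
    refine ofReal_mul_exp_mem_sector hδ (mul_pos (hρ k) (Real.exp_pos _)) ?_
    rw [abs_mul, abs_of_nonneg hζ.1]
    exact (mul_le_of_le_one_right (abs_nonneg _) hζ.2).trans_lt (hη k)
  have hbd : ∀ k, ∀ ζ ∈ Complex.re ⁻¹' Set.Icc (0 : ℝ) 1,
      ‖contourExp (R k) ψ (ρ k * Complex.exp (η k * ζ * Complex.I))‖ ≤ C := fun k ζ hζ =>
    ((h k).norm_contourExp_le hφψ hψ (hmem k ζ hζ)).trans hKC
  refine norm_vecLp_stein_le (q₀ := q) (q₁ := p) hp1 hp hr1 hr hτ hrτ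
    (W := fun k ζ => contourExp (R k) ψ (ρ k * Complex.exp (η k * ζ * Complex.I)))
    (fun k ζ hζ => ?_) hbd hC (fun ζ hζ f => ?_) (fun ζ hζ f => ?_) f
  · obtain ⟨U', hU', -⟩ := (h k).exists_hasDerivAt_contourExp' hφψ hψ (hmem k ζ hζ)
    have h2 : DifferentiableAt ℂ (fun ζ : ℂ => (ρ k : ℂ) * Complex.exp (η k * ζ * Complex.I)) ζ := by
      fun_prop
    exact (hU'.differentiableAt.comp ζ h2).differentiableWithinAt
  · have h3 : ∀ k, (ρ k : ℂ) * Complex.exp (η k * ζ * Complex.I) =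
        ((ρ k * Real.exp (-(η k * ζ.im)) : ℝ) : ℂ) := fun k => by
      rw [exp_mul_I_eq, hζ]; simp
    simp only [h3]
    exact hq _ (fun k => mul_pos (hρ k) (Real.exp_pos _)) f
  · exact norm_vecLp_self_le hp hC (fun k => hbd k ζ (by simp [hζ])) f

/-- All components are Laplace integrals over the same variable $s$, hence one integral in
$L^p(\ell^r)$. The scalar factors are at most $e^{-cs}$, and integrating this majorant gives the
factor $1/c$. -/
theorem norm_vecLp_smul_resolvent_le [Fact (1 ≤ r)] (hA : ∀ k, Dense ((A k).domain : Set (Lp ℂ p μ)))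
    {lam z : Fin n → ℂ} (hl : ∀ k, lam k ∈ offSector φ) (hz : ∀ k, z k ∈ sector (ψ - φ)) {c B : ℝ}
    (hc : 0 < c) (hre : ∀ k, (lam k * z k).re ≤ -c) (hnorm : ∀ k, ‖lam k * z k‖ ≤ 1)
    (f : Fin n → Lp ℂ p μ)
    (hB : ∀ s : ℝ, 0 < s → ‖vecLp r fun k => contourExp (R k) ψ (s * z k) (f k)‖ ≤ B) :
    ‖vecLp r fun k => lam k • R k (lam k) (f k)‖ ≤ B / c := by
  have hre' : ∀ k, (lam k * z k).re < 0 := fun k => (hre k).trans_lt (neg_lt_zero.2 hc)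
  set F : ℝ → Fin n → Lp ℂ p μ := fun s k =>
    -(lam k * z k) • Complex.exp (s * (lam k * z k)) • contourExp (R k) ψ (s * z k) (f k) with hF
  have hFi : ∀ k, IntegrableOn (fun s => F s k) (Set.Ioi 0) := fun k =>
    ((h k).integrable_laplace hφψ hψ (hz k) (hre' k) (f k)).smul (-(lam k * z k))
  have h1 : (fun k => lam k • R k (lam k) (f k)) = ∫ s in Set.Ioi (0 : ℝ), F s := by
    funext k
    rw [(h k).integral_laplace hφψ hψ (hA k) (hl k) (hz k) (hre' k), ← integral_smul]
    exact (eval_integral hFi k).symm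
  have hexp : IntegrableOn (fun s : ℝ => Real.exp (-c * s)) (Set.Ioi 0) :=
    integrableOn_exp_mul_Ioi (neg_lt_zero.2 hc) 0
  rw [h1, ← (vecLp r).integral_comp_comm (Integrable.of_eval hFi)]
  refine (norm_integral_le_of_norm_le (hexp.mul_const B) ?_).trans_eq ?_
  · refine (ae_restrict_iff' measurableSet_Ioi).2 (ae_of_all _ fun s hs => ?_)
    have h2 : F s = fun k => (-(lam k * z k) * Complex.exp (s * (lam k * z k))) •
        contourExp (R k) ψ (s * z k) (f k) := by
      funext k; simp only [hF, smul_smul]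
    rw [h2]
    refine (norm_vecLp_smul_le (fun k => ?_) (Real.exp_pos (-c * s)).le _).trans ?_
    · rw [norm_mul, norm_neg, Complex.norm_exp, Complex.re_ofReal_mul]
      have h3 : s * (lam k * z k).re ≤ -c * s := by
        rw [mul_comm (-c)]
        exact mul_le_mul_of_nonneg_left (hre k) (le_of_lt hs)
      exact (mul_le_mul (hnorm k) (Real.exp_le_exp.2 h3) (Real.exp_pos _).le zero_le_one).trans_eq
        (one_mul _)
    · gcongr
      exact hB s hs
  · rw [integral_mul_const, integral_exp_mul_Ioi (neg_lt_zero.2 hc)]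
    simp [div_eq_mul_inv, mul_comm]

end Resolvents

/-! ### Choice of angles and the bound in $L^p(\ell^r)$ -/

section Main

variable {Ω : Type*} [MeasurableSpace Ω] {μ : Measure Ω} {p q r : ℝ≥0∞} [Fact (1 ≤ p)]

/-- Domination of semigroups gives `𝓡_r`-boundedness of resolvents. -/
theorem exists_rqBounded_resolventFamily (hp_one : 1 < p) (hp_top : p ≠ ∞) (hq_one : 1 ≤ q)
    {T : ℝ} {A : ℝ → Lp ℂ p μ →ₗ.[ℂ] Lp ℂ p μ}
    (hA : ∀ t ∈ Set.Icc 0 T, IsSectorial (A t)) {φ : ℝ} (hφ : φ ∈ Set.Ioo 0 (Real.pi / 2))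
    (hspec : ∀ t ∈ Set.Icc 0 T, spectrum (A t) ⊆ closure (sector φ))
    (hres : ∃ C : ℝ, ∀ t ∈ Set.Icc 0 T, ∀ z ∉ closure (sector φ), ‖z • resolvent (A t) z‖ ≤ C)
    (hdom : ∃ 𝒯 : Set (Lp ℂ p μ →L[ℂ] Lp ℂ p μ), RqBounded q 𝒯 ∧
      ∀ t ∈ Set.Icc 0 T, ∀ s : ℝ, 0 ≤ s → ∃ D ∈ 𝒯, Dominates D (semigroup (-A t) s))
    (hr : (p < r ∧ r < q) ∨ (q < r ∧ r < p)) :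
    ∃ θ ∈ Set.Ioo φ (Real.pi / 2), RqBounded r (resolventFamily A T θ) := by
  obtain ⟨hr1, hrt, τ, hτ, hrτ⟩ := exists_interpolation hp_one.le hq_one hr
  have : Fact (1 ≤ q) := ⟨hq_one⟩
  have : Fact (1 ≤ r) := ⟨hr1.le⟩
  obtain ⟨M, hM⟩ := hres
  obtain ⟨𝒯, h𝒯, hdom⟩ := hdom
  obtain ⟨Cq, hCq⟩ := (rqBounded_iff 𝒯).1 h𝒯
  set ψ := (φ + Real.pi / 2) / 2 with hψdef
  have hφψ : φ < ψ := by linarith [hφ.2]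
  have hψ : ψ < Real.pi / 2 := by linarith [hφ.2]
  -- Rotations by $\pm\delta$ stay inside the sector of holomorphy $|\arg z|<\psi-\varphi$.
  -- Interpolation retains the fraction $\tau$ of this angle, and half of $\delta\tau$ is kept as
  -- margin for the decay rate $\sin(\delta\tau/2)$.
  set δ := (ψ - φ) / 2 with hδdef
  have hδ : 0 < δ := by linarith
  have hδτ : 0 < δ * τ := mul_pos hδ hτ.1
  have hδτ' : δ * τ < δ := mul_lt_of_lt_one_right hδ hτ.2
  -- One constant for both edges of the strip: the $\mathcal R_q$-bound and the uniform bound on the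
  -- sector.
  set C : ℝ := max Cq
    (‖(contourConst ψ)⁻¹‖ * ((∫ u, contourWeight ψ u) * (M / (1 - Real.cos ψ))))
  have hC : 0 ≤ C := Cq.coe_nonneg.trans (le_max_left _ _)
  have hc : 0 < Real.sin (δ * τ / 2) :=
    Real.sin_pos_of_pos_of_lt_pi (by positivity) (by linarith [Real.pi_pos, hφ.1])
  refine ⟨Real.pi / 2 - δ * τ / 2, ⟨by linarith, by linarith⟩, ?_⟩
  refine (rqBounded_iff _).2 ⟨⟨C / Real.sin (δ * τ / 2), by positivity⟩, fun n S f hS => ?_⟩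
  choose t ht z hz hSz using hS
  have hrot := fun k => exists_rotation hφ hδτ (by linarith) (hz k)
  choose hoff η hη hnorm hre using hrot
  have hR : ∀ k, IsSectorResolvent (A (t k)) φ M (resolvent (A (t k))) := fun k =>
    isSectorResolvent_resolvent hφ (hspec _ (ht k)) (hM _ (ht k))
  have hq : ∀ s : Fin n → ℝ, (∀ k, 0 < s k) → ∀ f : Fin n → Lp ℂ p μ,
      ‖vecLp q fun k => contourExp (resolvent (A (t k))) ψ (s k) (f k)‖ ≤ C * ‖vecLp q f‖ := by
    intro s hs f
    have h1 := fun k => hdom (t k) (ht k) (s k) (hs k).le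
    choose D hD hDS using h1
    have h2 : ∀ k, semigroup (-A (t k)) (s k) = contourExp (resolvent (A (t k))) ψ (s k) :=
      fun k => (hR k).semigroup_eq hφψ hψ (hA _ (ht k)).dense_domain (hs k)
    simp only [← h2]
    calc _ ≤ _ := norm_vecLp_le_of_dominates hDS f
      _ ≤ Cq * ‖vecLp q fun k => absLp (f k)‖ := hCq n D _ hD
      _ ≤ C * ‖vecLp q f‖ := mul_le_mul (le_max_left _ _) (norm_vecLp_absLp f) (norm_nonneg _) hC
  have hpos : ∀ k, 0 < ‖z k‖⁻¹ := fun k =>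
    inv_pos.2 (norm_pos_iff.2 (ne_zero_of_mem_offSector (hoff k)))
  have key := norm_vecLp_smul_resolvent_le (r := r) hR hφψ hψ
    (fun k => (hA _ (ht k)).dense_domain) hoff
    (z := fun k => ((‖z k‖⁻¹ : ℝ) : ℂ) * Complex.exp (η k * Complex.I))
    (fun k => ofReal_mul_exp_mem_sector (by linarith [Real.pi_pos, hφ.1]) (hpos k)
      (by rw [hη]; linarith)) hc hre hnorm f (B := C * ‖vecLp r f‖) fun s hs => by
    -- The family is started with angle $\eta_k/\tau=\pm\delta$, so that at $\zeta=\tau$ its angle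
    -- is $\eta_k$. The factor $\|z_k\|^{-1}$ normalises $|\lambda z|$ to $1$, making the decay rate
    -- common to all $k$.
    have h3 := norm_vecLp_contourExp_le (q := q) (r := r) hR hφψ hψ hφ.1 hp_one hp_top hr1 hrt
      ⟨hτ.1.le, hτ.2.le⟩ hrτ (le_max_right _ _) hC hq (ρ := fun k => s * ‖z k‖⁻¹)
      (η := fun k => η k / τ) (fun k => mul_pos hs (hpos k))
      (fun k => by
        rw [abs_div, hη, abs_of_pos hτ.1, mul_div_cancel_right₀ _ hτ.1.ne']; linarith) f
    have h4 : (τ : ℂ) ≠ 0 := by exact_mod_cast hτ.1.ne'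
    have h6 : ∀ k, (s : ℂ) * (((‖z k‖⁻¹ : ℝ) : ℂ) * Complex.exp (η k * Complex.I)) =
        ((s * ‖z k‖⁻¹ : ℝ) : ℂ) * Complex.exp (((η k / τ : ℝ) : ℂ) * τ * Complex.I) := fun k => by
      push_cast
      rw [div_mul_cancel₀ _ h4, mul_assoc]
    simpa only [h6] using h3
  have h5 : (fun k => S k (f k)) = fun k => z k • resolvent (A (t k)) (z k) (f k) := by
    funext k; rw [hSz k]; rfl
  rw [h5]
  exact key.trans_eq (div_mul_eq_mul_div _ _ _).symm

end Main

end RBdd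

namespace RBdd

/-! ### Khintchine's inequality -/

section Khintchine

variable {n : ℕ}

/-- The sum `∑ₖ εₖ aₖ` with signs `ε`. -/
def signSum {V : Type*} [AddCommGroup V] (a : Fin n → V) (ε : Fin n → ℤˣ) : V :=
  ∑ k, (ε k : ℤ) • a k

/-- By independence the expectation factors into $\prod_k\cosh a_k$, and $\cosh x\le e^{x^2/2}$. -/
theorem expect_exp_signSum_le (a : Fin n → ℝ) :
    𝔼 ε : Fin n → ℤˣ, Real.exp (signSum a ε) ≤ Real.exp ((∑ k, a k ^ 2) / 2) := by
  have h1 : ∀ ε : Fin n → ℤˣ, Real.exp (signSum a ε) = ∏ k, Real.exp ((ε k : ℤ) * a k) := by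
    intro ε
    simp only [signSum, zsmul_eq_mul, Real.exp_sum]
  have h2 : ∑ ε : Fin n → ℤˣ, Real.exp (signSum a ε) =
      ∏ k, ∑ e : ℤˣ, Real.exp ((e : ℤ) * a k) := by
    rw [Finset.prod_univ_sum, Fintype.piFinset_univ]
    exact Finset.sum_congr rfl fun ε _ => h1 ε
  have h3 : ∀ k, ∑ e : ℤˣ, Real.exp ((e : ℤ) * a k) = 2 * Real.cosh (a k) := fun k => by
    rw [show (Finset.univ : Finset ℤˣ) = {1, -1} from rfl,
      Finset.sum_pair (by decide), Real.cosh_eq]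
    simp
    ring
  rw [Fintype.expect_eq_sum_div_card, h2]
  simp only [h3, Finset.prod_mul_distrib, Finset.prod_const, Finset.card_univ, Fintype.card_fin,
    Fintype.card_pi, Fintype.card_units_int]
  rw [Nat.cast_pow, Nat.cast_ofNat, mul_div_cancel_left₀ _ (by positivity), Finset.sum_div,
    Real.exp_sum]
  exact Finset.prod_le_prod (fun k _ => (Real.cosh_pos _).le) fun k _ =>
    Real.cosh_le_exp_half_sq _

theorem signSum_neg {V : Type*} [AddCommGroup V] (a : Fin n → V) (ε : Fin n → ℤˣ) :
    signSum (-a) ε = -signSum a ε := by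
  simp [signSum]

theorem map_signSum {V W : Type*} [AddCommGroup V] [AddCommGroup W] (L : V →+ W) (a : Fin n → V)
    (ε : Fin n → ℤˣ) : L (signSum a ε) = signSum (fun k => L (a k)) ε := by
  simp [signSum]

theorem expect_exp_abs_signSum_le {a : Fin n → ℝ} (ha : ∑ k, a k ^ 2 ≤ 1) :
    𝔼 ε : Fin n → ℤˣ, Real.exp |signSum a ε| ≤ 2 * Real.exp (1 / 2) := by
  have h1 : 𝔼 ε : Fin n → ℤˣ, Real.exp |signSum a ε| ≤
      𝔼 ε : Fin n → ℤˣ, (Real.exp (signSum a ε) + Real.exp (signSum (-a) ε)) :=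
    Finset.expect_le_expect fun ε _ => by
      rw [signSum_neg]; exact Real.exp_abs_le _
  have h2 := expect_exp_signSum_le a
  have h3 := expect_exp_signSum_le (-a)
  simp only [Pi.neg_apply, neg_sq] at h3
  have h4 : Real.exp ((∑ k, a k ^ 2) / 2) ≤ Real.exp (1 / 2) := Real.exp_le_exp.2 (by linarith)
  rw [Finset.expect_add_distrib] at h1
  linarith

theorem sum_sq_le_of_norm_le {b : Fin n → ℝ} {a : Fin n → ℂ} (h : ∀ k, |b k| ≤ ‖a k‖)
    (ha : ‖WithLp.toLp 2 a‖ ≤ 1) : ∑ k, b k ^ 2 ≤ 1 := by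
  have h1 : ‖WithLp.toLp 2 a‖ ^ 2 = ∑ k, ‖a k‖ ^ 2 := EuclideanSpace.norm_sq_eq _
  have h2 : ‖WithLp.toLp 2 a‖ ^ 2 ≤ 1 := pow_le_one₀ (norm_nonneg _) ha
  refine (Finset.sum_le_sum fun k _ => ?_).trans (h1.symm.trans_le h2)
  rw [← sq_abs]
  exact pow_le_pow_left₀ (abs_nonneg _) (h k) 2

/-- From $|z|\le|\operatorname{Re}z|+|\operatorname{Im}z|$ and $2xy\le x^2+y^2$; the factor $1/2$ in
the exponent is the price of splitting into real and imaginary parts. -/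
theorem expect_exp_norm_signSum_le {a : Fin n → ℂ} (ha : ‖WithLp.toLp 2 a‖ ≤ 1) :
    𝔼 ε : Fin n → ℤˣ, Real.exp (‖signSum a ε‖ / 2) ≤ 2 * Real.exp (1 / 2) := by
  have h1 := expect_exp_abs_signSum_le (sum_sq_le_of_norm_le (fun k => Complex.abs_re_le_norm _) ha)
  have h2 := expect_exp_abs_signSum_le (sum_sq_le_of_norm_le (fun k => Complex.abs_im_le_norm _) ha)
  have h3 : 𝔼 ε : Fin n → ℤˣ, Real.exp (‖signSum a ε‖ / 2) ≤ 𝔼 ε : Fin n → ℤˣ,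
      (Real.exp |signSum (fun k => (a k).re) ε| + Real.exp |signSum (fun k => (a k).im) ε|) / 2 :=
    Finset.expect_le_expect fun ε _ => by
      have e1 : signSum (fun k => (a k).re) ε = (signSum a ε).re :=
        (map_signSum Complex.reAddGroupHom a ε).symm
      have e2 : signSum (fun k => (a k).im) ε = (signSum a ε).im :=
        (map_signSum Complex.imAddGroupHom a ε).symm
      rw [e1, e2]
      set u := |(signSum a ε).re|
      set v := |(signSum a ε).im|
      have e3 : Real.exp (‖signSum a ε‖ / 2) ≤ Real.exp (u / 2) * Real.exp (v / 2) := by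
        rw [← Real.exp_add, ← add_div]
        exact Real.exp_le_exp.2 (by linarith [Complex.norm_le_abs_re_add_abs_im (signSum a ε)])
      have e4 : Real.exp u = Real.exp (u / 2) ^ 2 := by
        rw [← Real.exp_nat_mul]; push_cast; ring_nf
      have e5 : Real.exp v = Real.exp (v / 2) ^ 2 := by
        rw [← Real.exp_nat_mul]; push_cast; ring_nf
      rw [e4, e5]
      nlinarith [sq_nonneg (Real.exp (u / 2) - Real.exp (v / 2))]
  rw [← Finset.expect_div, Finset.expect_add_distrib] at h3
  linarith

theorem exists_rpow_le_exp (P : ℝ) (hP : 0 ≤ P) :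
    ∃ C : ℝ, 0 ≤ C ∧ ∀ t : ℝ, 0 ≤ t → t ^ P ≤ C * Real.exp (t / 2) := by
  obtain ⟨m, hm⟩ := exists_nat_ge P
  refine ⟨1 + 2 ^ m * m.factorial, by positivity, fun t ht => ?_⟩
  have h1 := Real.pow_div_factorial_le_exp (t / 2) (by positivity) m
  have h2 : t ^ m ≤ 2 ^ m * m.factorial * Real.exp (t / 2) := by
    rw [div_pow, div_div, div_le_iff₀ (by positivity)] at h1
    linarith
  have h3 : 1 ≤ Real.exp (t / 2) := Real.one_le_exp (by positivity)
  have h4 : t ^ P ≤ 1 + t ^ m := by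
    rcases le_total t 1 with h | h
    · exact (Real.rpow_le_one ht h hP).trans (le_add_of_nonneg_right (by positivity))
    · refine le_trans ?_ (le_add_of_nonneg_left zero_le_one)
      rw [← Real.rpow_natCast]
      exact Real.rpow_le_rpow_of_exponent_le h hm
  linarith

/-- The upper bound in Khintchine's inequality. -/
theorem exists_expect_rpow_le (P : ℝ) (hP : 0 < P) :
    ∃ C : ℝ, 0 ≤ C ∧ ∀ (n : ℕ) (a : Fin n → ℂ),
      𝔼 ε : Fin n → ℤˣ, ‖signSum a ε‖ ^ P ≤ C * ‖WithLp.toLp 2 a‖ ^ P := by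
  obtain ⟨C, hC, h⟩ := exists_rpow_le_exp P hP.le
  refine ⟨C * (2 * Real.exp (1 / 2)), by positivity, fun n a => ?_⟩
  set N := ‖WithLp.toLp 2 a‖ with hN
  rcases (norm_nonneg (WithLp.toLp 2 a)).eq_or_lt with h0 | hpos
  · have ha : a = 0 := by
      rw [eq_comm, norm_eq_zero] at h0
      exact (WithLp.toLp_injective 2) (h0.trans (WithLp.toLp_zero 2).symm)
    have h1 : ∀ ε : Fin n → ℤˣ, ‖signSum a ε‖ ^ P = 0 := fun ε => by
      simp [ha, signSum, Real.zero_rpow hP.ne']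
    simp only [h1, Finset.expect_const_zero]
    positivity
  · have h1 : ∀ ε : Fin n → ℤˣ, ‖signSum a ε‖ ^ P =
        N ^ P * ‖signSum ((N : ℂ)⁻¹ • a) ε‖ ^ P := fun ε => by
      have e1 : signSum ((N : ℂ)⁻¹ • a) ε = (N : ℂ)⁻¹ * signSum a ε :=
        (map_signSum (AddMonoidHom.mulLeft (N : ℂ)⁻¹) a ε).symm
      rw [← Real.mul_rpow hpos.le (norm_nonneg _), e1, norm_mul, norm_inv, Complex.norm_real,
        Real.norm_of_nonneg hpos.le, mul_inv_cancel_left₀ hpos.ne']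
    have h2 : ‖WithLp.toLp 2 ((N : ℂ)⁻¹ • a)‖ ≤ 1 := by
      rw [WithLp.toLp_smul, norm_smul, norm_inv, Complex.norm_real, Real.norm_of_nonneg hpos.le,
        inv_mul_cancel₀ hpos.ne']
    simp only [h1, ← Finset.mul_expect]
    rw [mul_comm]
    gcongr
    calc _ ≤ 𝔼 ε : Fin n → ℤˣ, C * Real.exp (‖signSum ((N : ℂ)⁻¹ • a) ε‖ / 2) :=
          Finset.expect_le_expect fun ε _ => h _ (norm_nonneg _)
      _ ≤ _ := by
          rw [← Finset.mul_expect]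
          gcongr
          exact expect_exp_norm_signSum_le h2

/-- For $i\ne j$, flipping the sign $\varepsilon_i$ permutes the sign vectors and negates the
product. -/
theorem expect_sign_mul_sign (i j : Fin n) :
    𝔼 ε : Fin n → ℤˣ, ((ε i : ℤ) : ℝ) * ((ε j : ℤ) : ℝ) = if i = j then 1 else 0 := by
  split_ifs with hij
  · subst hij
    have h : ∀ ε : Fin n → ℤˣ, ((ε i : ℤ) : ℝ) * ((ε i : ℤ) : ℝ) = 1 := fun ε => by
      rw [← Int.cast_mul, ← Units.val_mul, Int.units_mul_self]; simp
    simp only [h]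
    exact Finset.expect_const Finset.univ_nonempty _
  · have h : 𝔼 ε : Fin n → ℤˣ, ((ε i : ℤ) : ℝ) * ((ε j : ℤ) : ℝ) =
        𝔼 ε : Fin n → ℤˣ, -(((ε i : ℤ) : ℝ) * ((ε j : ℤ) : ℝ)) :=
      Fintype.expect_equiv (Equiv.mulLeft (Pi.mulSingle i (-1))) _ _ fun ε => by
        simp [Pi.mulSingle_eq_of_ne (Ne.symm hij)]
    rw [Finset.expect_neg_distrib] at h
    linarith

theorem expect_signSum_sq (a : Fin n → ℝ) :
    𝔼 ε : Fin n → ℤˣ, signSum a ε ^ 2 = ∑ k, a k ^ 2 := by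
  have h1 : ∀ ε : Fin n → ℤˣ, signSum a ε ^ 2 =
      ∑ i, ∑ j, ((ε i : ℤ) : ℝ) * ((ε j : ℤ) : ℝ) * (a i * a j) := fun ε => by
    simp only [signSum, zsmul_eq_mul, sq, Finset.sum_mul_sum]
    exact Finset.sum_congr rfl fun i _ => Finset.sum_congr rfl fun j _ => by ring
  simp only [h1, Finset.expect_sum_comm, ← Finset.expect_mul, expect_sign_mul_sign]
  simp [sq]

theorem expect_norm_signSum_sq (a : Fin n → ℂ) :
    𝔼 ε : Fin n → ℤˣ, ‖signSum a ε‖ ^ 2 = ‖WithLp.toLp 2 a‖ ^ 2 := by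
  have h1 : ‖WithLp.toLp 2 a‖ ^ 2 = ∑ k, ‖a k‖ ^ 2 := EuclideanSpace.norm_sq_eq _
  have h2 : ∀ z : ℂ, ‖z‖ ^ 2 = z.re ^ 2 + z.im ^ 2 := fun z => by
    rw [Complex.sq_norm, Complex.normSq_apply]; ring
  have e1 : ∀ ε, (signSum a ε).re = signSum (fun k => (a k).re) ε :=
    map_signSum Complex.reAddGroupHom a
  have e2 : ∀ ε, (signSum a ε).im = signSum (fun k => (a k).im) ε :=
    map_signSum Complex.imAddGroupHom a
  rw [h1]
  simp only [h2, e1, e2]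
  rw [Finset.expect_add_distrib, expect_signSum_sq, expect_signSum_sq, Finset.sum_add_distrib]

/-- The lower bound in Khintchine's inequality. -/
theorem exists_norm_le_expect : ∃ C : ℝ, 0 ≤ C ∧ ∀ (n : ℕ) (a : Fin n → ℂ),
    ‖WithLp.toLp 2 a‖ ≤ C * 𝔼 ε : Fin n → ℤˣ, ‖signSum a ε‖ := by
  obtain ⟨C, hC, h⟩ := exists_expect_rpow_le (4 : ℕ) (by norm_num)
  simp only [Real.rpow_natCast] at h
  refine ⟨2 * (2 * C + 2), by positivity, fun n a => ?_⟩
  set N := ‖WithLp.toLp 2 a‖ with hN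
  have hE : 0 ≤ 𝔼 ε : Fin n → ℤˣ, ‖signSum a ε‖ :=
    Finset.expect_nonneg fun ε _ => norm_nonneg _
  rcases (norm_nonneg (WithLp.toLp 2 a)).eq_or_lt with h0 | hpos
  · rw [hN, ← h0]; positivity
  -- Truncation at height $L$: $t^2\le Lt$ below it and $t^2\le t^4/L^2$ above it. With this $L$ the
  -- fourth moment contributes at most $N^2/2$, which is absorbed by the second moment $N^2$.
  set L := (2 * C + 2) * N with hL
  have hLpos : 0 < L := by positivity
  have h1 : ∀ t : ℝ, 0 ≤ t → t ^ 2 ≤ L * t + t ^ 4 / L ^ 2 := fun t ht => by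
    rcases le_total t L with htL | htL
    · have : 0 ≤ t ^ 4 / L ^ 2 := by positivity
      nlinarith
    · have : t ^ 2 ≤ t ^ 4 / L ^ 2 := by
        rw [le_div_iff₀ (by positivity)]
        nlinarith [pow_le_pow_left₀ hLpos.le htL 2, sq_nonneg t]
      have : 0 ≤ L * t := by positivity
      linarith
  have h2 : N ^ 2 ≤ L * (𝔼 ε : Fin n → ℤˣ, ‖signSum a ε‖) + C * N ^ 4 / L ^ 2 := by
    rw [hN, ← expect_norm_signSum_sq, ← hN]
    calc _ ≤ 𝔼 ε : Fin n → ℤˣ, (L * ‖signSum a ε‖ + ‖signSum a ε‖ ^ 4 / L ^ 2) :=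
          Finset.expect_le_expect fun ε _ => h1 _ (norm_nonneg _)
      _ ≤ _ := by
          rw [Finset.expect_add_distrib, ← Finset.mul_expect, ← Finset.expect_div]
          gcongr
          exact h n a
  have h3 : C * N ^ 4 / L ^ 2 ≤ N ^ 2 / 2 := by
    rw [div_le_iff₀ (by positivity), hL]
    have : C ≤ (2 * C + 2) ^ 2 / 2 := by nlinarith
    calc C * N ^ 4 ≤ (2 * C + 2) ^ 2 / 2 * N ^ 4 := by gcongr
      _ = _ := by ring
  have h4 : N * N ≤ N * (2 * (2 * C + 2) * 𝔼 ε : Fin n → ℤˣ, ‖signSum a ε‖) := by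
    rw [hL] at h2
    nlinarith
  exact le_of_mul_le_mul_left h4 hpos

/-! ### Khintchine's inequality in $L^p$ and $\mathcal R$-boundedness -/

variable {Ω : Type*} [MeasurableSpace Ω] {μ : Measure Ω} {p : ℝ≥0∞} [Fact (1 ≤ p)]

omit [Fact (1 ≤ p)] in
theorem coeFn_signSum (f : Fin n → Lp ℂ p μ) (ε : Fin n → ℤˣ) :
    (signSum f ε : Lp ℂ p μ) =ᵐ[μ] fun x => signSum (fun k => f k x) ε := by
  have h : ∀ k, ((ε k : ℤ) • f k : Lp ℂ p μ) =ᵐ[μ] fun x => (ε k : ℤ) • f k x := fun k => by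
    filter_upwards [Lp.coeFn_smul ((ε k : ℤ) : ℂ) (f k)] with x hx
    rw [Int.cast_smul_eq_zsmul] at hx
    rw [hx, Pi.smul_apply, Int.cast_smul_eq_zsmul]
  filter_upwards [coeFn_finsetSum Finset.univ fun k => (ε k : ℤ) • f k, ae_all_iff.2 h]
    with x h1 h2
  rw [signSum, h1]
  exact Finset.sum_congr rfl fun k _ => h2 k

/-- The scalar lower bound at each point, followed by the triangle inequality in $L^p$ for the
average over the signs. -/
theorem exists_norm_vecLp_two_le : ∃ C : ℝ, 0 ≤ C ∧ ∀ (n : ℕ) (f : Fin n → Lp ℂ p μ),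
    ‖vecLp 2 f‖ ≤ C * 𝔼 ε : Fin n → ℤˣ, ‖signSum f ε‖ := by
  obtain ⟨C, hC, h⟩ := exists_norm_le_expect
  refine ⟨C, hC, fun n f => ?_⟩
  set c : ℝ := C / Fintype.card (Fin n → ℤˣ) with hc
  have hc0 : 0 ≤ c := by positivity
  have habs : ∀ g : Lp ℂ p μ, absLp g =ᵐ[μ] fun x => ((‖g x‖ : ℝ) : ℂ) := fun g =>
    MemLp.coeFn_toLp _
  have habs' : ∀ g : Lp ℂ p μ, ‖absLp g‖ ≤ ‖g‖ := fun g => by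
    refine Lp.norm_le_norm_of_ae_le ?_
    filter_upwards [habs g] with x hx
    rw [hx, Complex.norm_real, norm_norm]
  have h1 : ‖vecLp 2 f‖ ≤ ‖(c : ℂ) • ∑ ε : Fin n → ℤˣ, absLp (signSum f ε)‖ := by
    refine Lp.norm_le_norm_of_ae_le ?_
    filter_upwards [coeFn_vecLp (q := 2) f,
      Lp.coeFn_smul (c : ℂ) (∑ ε : Fin n → ℤˣ, absLp (signSum f ε)),
      coeFn_finsetSum Finset.univ fun ε : Fin n → ℤˣ => absLp (signSum f ε),
      ae_all_iff.2 fun ε : Fin n → ℤˣ => habs (signSum f ε),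
      ae_all_iff.2 fun ε : Fin n → ℤˣ => coeFn_signSum f ε] with x e1 e2 e3 e4 e5
    rw [e1, e2, Pi.smul_apply, e3]
    simp only [e4, e5]
    refine (h n _).trans_eq ?_
    rw [← Complex.ofReal_sum, norm_smul, Complex.norm_real, Complex.norm_real,
      Real.norm_of_nonneg hc0, Real.norm_of_nonneg (by positivity),
      Fintype.expect_eq_sum_div_card, hc, div_mul_eq_mul_div, mul_div_assoc]
  refine h1.trans ?_
  rw [norm_smul, Complex.norm_real, Real.norm_of_nonneg hc0, Fintype.expect_eq_sum_div_card,
    mul_div_assoc', ← div_mul_eq_mul_div]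
  gcongr
  exact (norm_sum_le _ _).trans (Finset.sum_le_sum fun ε _ => habs' _)

/-- Jensen's inequality raises the average to the power $p$; interchanging it with the integral over
$\Omega$ leaves the scalar upper bound with exponent $p$. -/
theorem exists_expect_norm_signSum_le (hp : p ≠ ∞) : ∃ C : ℝ, 0 ≤ C ∧
    ∀ (n : ℕ) (f : Fin n → Lp ℂ p μ),
      𝔼 ε : Fin n → ℤˣ, ‖signSum f ε‖ ≤ C * ‖vecLp 2 f‖ := by
  have hp1 : 1 ≤ p := Fact.out
  have hp0 : p ≠ 0 := (zero_lt_one.trans_le hp1).ne'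
  have hpr := ENNReal.toReal_pos hp0 hp
  have hpr1 : 1 ≤ p.toReal := by
    rw [← ENNReal.toReal_one]; exact ENNReal.toReal_mono hp hp1
  obtain ⟨C, hC, h⟩ := exists_expect_rpow_le p.toReal hpr
  refine ⟨C ^ (p.toReal)⁻¹, by positivity, fun n f => ?_⟩
  set N := (Fintype.card (Fin n → ℤˣ) : ℝ) with hN
  have hNpos : 0 < N := by
    rw [hN]; exact_mod_cast Fintype.card_pos
  have h1 : (𝔼 ε : Fin n → ℤˣ, ‖signSum f ε‖) ^ p.toReal ≤
      𝔼 ε : Fin n → ℤˣ, ‖signSum f ε‖ ^ p.toReal := by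
    have := Real.rpow_arith_mean_le_arith_mean_rpow Finset.univ (fun _ : Fin n → ℤˣ => N⁻¹)
      (fun ε => ‖signSum f ε‖) (fun _ _ => by positivity)
      (by rw [Finset.sum_const, nsmul_eq_mul, Finset.card_univ, mul_inv_cancel₀ hNpos.ne'])
      (fun _ _ => norm_nonneg _) hpr1
    rw [← Finset.mul_sum, ← Finset.mul_sum] at this
    rwa [Fintype.expect_eq_sum_div_card, Fintype.expect_eq_sum_div_card, div_eq_inv_mul,
      div_eq_inv_mul]
  have h2 : 𝔼 ε : Fin n → ℤˣ, ‖signSum f ε‖ ^ p.toReal ≤ C * ‖vecLp 2 f‖ ^ p.toReal := by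
    have hint : ∀ ε : Fin n → ℤˣ, Integrable (fun x => ‖signSum f ε x‖ ^ p.toReal) μ := fun ε =>
      (Lp.memLp (signSum f ε)).integrable_norm_rpow hp0 hp
    simp only [norm_rpow_eq_integral hp]
    rw [Fintype.expect_eq_sum_div_card, ← integral_finsetSum _ fun ε _ => hint ε,
      ← integral_div, ← integral_const_mul]
    refine integral_mono_ae ((integrable_finsetSum _ fun ε _ => hint ε).div_const _)
      (((Lp.memLp (vecLp 2 f)).integrable_norm_rpow hp0 hp).const_mul C) ?_
    filter_upwards [coeFn_vecLp (q := 2) f,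
      ae_all_iff.2 fun ε : Fin n → ℤˣ => coeFn_signSum f ε] with x e1 e2
    simp only [e1, e2]
    rw [← Fintype.expect_eq_sum_div_card]
    exact h n _
  rw [← Real.rpow_le_rpow_iff (Finset.expect_nonneg fun ε _ => norm_nonneg _) (by positivity) hpr,
    Real.mul_rpow (by positivity) (norm_nonneg _), ← Real.rpow_mul hC, inv_mul_cancel₀ hpr.ne',
    Real.rpow_one]
  exact h1.trans h2

/-- On `L^p(Ω)` with `p < ∞`, `𝓡_2`-boundedness implies `𝓡`-boundedness. -/
theorem RqBounded.rBounded (hp : p ≠ ∞) {𝒯 : Set (Lp ℂ p μ →L[ℂ] Lp ℂ p μ)}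
    (h : RqBounded 2 𝒯) : RBounded 𝒯 := by
  obtain ⟨C, hC⟩ := (rqBounded_iff 𝒯).1 h
  obtain ⟨a, ha, ha'⟩ := exists_expect_norm_signSum_le (μ := μ) hp
  obtain ⟨b, hb, hb'⟩ := exists_norm_vecLp_two_le (μ := μ) (p := p)
  refine ⟨⟨a * (C * b), by positivity⟩, fun n T f hT => ?_⟩
  have h1 : ∀ (g : Fin n → Lp ℂ p μ) (ε : Fin n → ℤˣ),
      ∑ k, ((ε k : ℤ) : ℂ) • g k = signSum g ε := fun g ε => by
    simp only [signSum, Int.cast_smul_eq_zsmul]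
  simp only [h1]
  calc 𝔼 ε : Fin n → ℤˣ, ‖signSum (fun k => T k (f k)) ε‖
      ≤ a * ‖vecLp 2 fun k => T k (f k)‖ := ha' n _
    _ ≤ a * (C * (b * 𝔼 ε : Fin n → ℤˣ, ‖signSum f ε‖)) := by
        gcongr
        exact (hC n T f hT).trans (mul_le_mul_of_nonneg_left (hb' n f) C.coe_nonneg)
    _ = a * (C * b) * 𝔼 ε : Fin n → ℤˣ, ‖signSum f ε‖ := by ring

end Khintchine

end RBdd

/-! ### Conclusion: $\mathcal R_r$- and $\mathcal R$-boundedness -/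

theorem mainTheorem7 {Ω : Type*} [MeasurableSpace Ω] (μ : Measure Ω) [SigmaFinite μ]
    (p q : ℝ≥0∞) [Fact (1 ≤ p)] (hp_one : 1 < p) (hp_top : p ≠ ∞) (hq_one : 1 ≤ q)
    (T : ℝ) (A : ℝ → Lp ℂ p μ →ₗ.[ℂ] Lp ℂ p μ)
    (hA : ∀ t ∈ Set.Icc 0 T, RBdd.IsSectorial (A t))
    (φ : ℝ) (hφ : φ ∈ Set.Ioo 0 (Real.pi / 2))
    (hspec : ∀ t ∈ Set.Icc 0 T, RBdd.spectrum (A t) ⊆ closure (RBdd.sector φ))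
    (hres : ∃ C : ℝ, ∀ t ∈ Set.Icc 0 T, ∀ z ∉ closure (RBdd.sector φ),
      ‖z • RBdd.resolvent (A t) z‖ ≤ C)
    (hdom : ∃ 𝒯 : Set (Lp ℂ p μ →L[ℂ] Lp ℂ p μ), RBdd.RqBounded q 𝒯 ∧
      ∀ t ∈ Set.Icc 0 T, ∀ s : ℝ, 0 ≤ s →
        ∃ D ∈ 𝒯, RBdd.Dominates D (RBdd.semigroup (-A t) s)) :
    (∀ r : ℝ≥0∞, (p < r ∧ r < q) ∨ (q < r ∧ r < p) →
      ∃ θ ∈ Set.Ioo φ (Real.pi / 2), RBdd.RqBounded r (RBdd.resolventFamily A T θ)) ∧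
    ((p < 2 ∧ 2 < q) ∨ (q < 2 ∧ 2 < p) →
      ∃ θ ∈ Set.Ioo φ (Real.pi / 2), RBdd.RqBounded 2 (RBdd.resolventFamily A T θ) ∧
        RBdd.RBounded (RBdd.resolventFamily A T θ)) := by
  have hr := fun r => RBdd.exists_rqBounded_resolventFamily (r := r) hp_one hp_top hq_one hA hφ
    hspec hres hdom
  refine ⟨hr, fun h2 => ?_⟩
  obtain ⟨θ, hθ, hθ'⟩ := hr 2 h2
  exact ⟨θ, hθ, hθ', hθ'.rBounded hp_top⟩
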